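/- Let $n\ge 1$ and $W=\mathfrak S_n$, acting by permuting coordinates on $V=\{x\in K^n:\sum_i x_i=0\}$ ($K=\mathbb R$ or $\mathbb C$). Let $c=(1,2,\dots,n)$, $C=\langle c\rangle\le W$, and $\omega=e^{2\pi i/n}$. **Noncrossing parking functions.** Let $T$ be the set of transpositions, $\ell_T(w)$ the least number of elements of $T$ with product $w$, and $u\le_T v$ iff $\ell_T(v)=\ell_T(u)+\ell_T(u^{-1}v)$. The noncrossing flats are the fixed subspaces $V^w$ of the real space $V$, for $1\le_T w\le_T c$. For a flat $X$ let $W_X$ be its pointwise stabilizer. $\mathsf{Park}^{NC}_W$ is the set of classes $[w,X]$ with $w\in W$ and $X$ a noncrossing flat, where $[w,X]=[w',X']$ iff $X=X'$ and $wW_X=w'W_X$. The group $W\times C$ acts on it by $(v,c^d).[w,X]=[vwc^{-d},c^d(X)]$. **Algebraic parking space.** Let $x_1,\dots,x_{n-1}$ be a basis of the complex dual $V^*$ and let $\Theta=(\theta_1,\dots,\theta_{n-1})$ be a homogeneous system of parameters of degree $n+1$ in $\mathbb C[V]=\mathbb C[x_1,\dots,x_{n-1}]$ such that the linear map $x_i\mapsto\theta_i$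 is $W$-equivariant. Put $\mathsf{Park}^{alg}_W=\mathbb C[V]/(\theta_1-x_1,\dots,\theta_{n-1}-x_{n-1})$, with $W$ acting by linear substitutions and $c^d$ acting by $x_i\mapsto\omega^{-d}x_i$. **Theorem.** 1. For every such choice of $(x_i)$ and $\Theta$, $\mathsf{Park}^{alg}_W$ is isomorphic to the permutation representation $\mathbb C[\mathsf{Park}^{NC}_W]$ as a representation of $W\times C$. 2. For every $u\in W$ and $\ell\in\mathbb Z$, the number of elements of $\mathsf{Park}^{NC}_W$ fixed by $(u,c^\ell)$ is $(n+1)^{\mathrm{mult}_u(\omega^\ell)}$, where $\mathrm{mult}_u(\omega^\ell)$ is the multiplicity of $\omega^\ell$ as an eigenvalue of $u$ on the complex space $V$. 3. For every $u\in W$ and $\ell\in\mathbb Z$ with $c^\ell\ne1$, let $d$ be the order of $c^\ell$ and $r_d(u)$ the number of cycles of $u$ of length divisible by $d$. Then the number of elements of $\mathsf{Park}^{NC}_W$ fixed by $(u,c^\ell)$ is $(n+1)^{r_d(u)}$, and this is also the number of functions $f:[n]\to[n]\cup\{0\}$ with $f(u(j))=c^\ell(f(j))$ for all $j\in[n]$,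 where $c^\ell(0)=0$. -/

import Mathlib

noncomputable section

namespace TypeAParking

open Equiv (Perm)

/-! ### The symmetric group as a reflection group -/

/-- The space `V = 𝟏^⊥ ⊆ K^n` of vectors with coordinate sum zero. -/
def reflSpace (K : Type) [Field K] (n : ℕ) : Submodule K (Fin n → K) where
  carrier := {x | ∑ i, x i = 0}
  add_mem' := by
    intro a b ha hb
    simp only [Set.mem_ofPred_eq] at ha hb ⊢
    simp [Finset.sum_add_distrib, ha, hb]
  zero_mem' := by simp
  smul_mem' := by
    intro c a ha
    simp only [Set.mem_ofPred_eq] at ha ⊢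
    simp [← Finset.mul_sum, ha]

/-- The reflection representation of `𝔖_n` on `V`: coordinates are permuted,
`(w • x)_i = x_{w⁻¹ i}`, that is, `w e_i = e_{w i}`. -/
def reflRep (K : Type) [Field K] (n : ℕ) :
    Representation K (Perm (Fin n)) (reflSpace K n) where
  toFun w := (LinearMap.funLeft K K (w⁻¹ : Perm (Fin n))).restrict (by
    intro x hx
    change ∑ i, x i = 0 at hx
    change ∑ i, x (w⁻¹ i) = 0
    rw [Equiv.sum_comp (w⁻¹) x]
    exact hx)
  map_one' := by
    ext x i
    simp [LinearMap.restrict_apply]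
  map_mul' := by
    intro u v
    ext x i
    simp [LinearMap.restrict_apply, LinearMap.funLeft_apply]

/-- The Coxeter element `c = s_1 s_2 ⋯ s_{n-1} = (1, 2, …, n)`. -/
abbrev cox (n : ℕ) : Perm (Fin n) := finRotate n

/-- The cyclic group `C = ⟨c⟩`. -/
abbrev coxGroup (n : ℕ) : Subgroup (Perm (Fin n)) := Subgroup.zpowers (cox n)

/-- The element `c^ℓ` of `C`. -/
def coxPow (n : ℕ) (l : ℤ) : coxGroup n := ⟨cox n ^ l, l, rfl⟩

/-- The group `W × C`. -/
abbrev WC (n : ℕ) : Type := Perm (Fin n) × coxGroup n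

/-- `ω = e^{2πi/h}`, where the Coxeter number of `𝔖_n` is `h = n`. -/
def omega (n : ℕ) : ℂ := Complex.exp (2 * Real.pi * Complex.I / n)

/-! ### Noncrossing parking functions -/

/-- Reflection length: the least number of reflections (transpositions) with product `w`. -/
def reflLength {n : ℕ} (w : Perm (Fin n)) : ℕ :=
  sInf {k | ∃ L : List (Perm (Fin n)), (∀ t ∈ L, t.IsSwap) ∧ L.length = k ∧ L.prod = w}

/-- The absolute order `u ≤_T v`. -/
def AbsLE {n : ℕ} (u v : Perm (Fin n)) : Prop :=
  reflLength v = reflLength u + reflLength (u⁻¹ * v)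

/-- The fixed space `V^w ⊆ V` of `w` in the real reflection representation. -/
def fixedSpace {n : ℕ} (w : Perm (Fin n)) : Submodule ℝ (reflSpace ℝ n) :=
  LinearMap.eqLocus (reflRep ℝ n w) LinearMap.id

/-- `X` is a noncrossing flat: `X = V^w` for some `w` in the interval `[1, c]_T`. -/
def IsNCFlat {n : ℕ} (X : Submodule ℝ (reflSpace ℝ n)) : Prop :=
  ∃ w : Perm (Fin n), AbsLE 1 w ∧ AbsLE w (cox n) ∧ fixedSpace w = X

/-- The pointwise stabilizer `W_X` of `X`. -/
def pointStab {n : ℕ} (X : Submodule ℝ (reflSpace ℝ n)) : Subgroup (Perm (Fin n)) where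
  carrier := {w | ∀ x ∈ X, reflRep ℝ n w x = x}
  mul_mem' := by
    intro a b ha hb x hx
    rw [map_mul, Module.End.mul_apply, hb x hx, ha x hx]
  one_mem' := by intro x _; simp
  inv_mem' := by
    intro a ha x hx
    conv_lhs => rw [← ha x hx]
    rw [← Module.End.mul_apply, ← map_mul]
    simp

/-- The noncrossing flats `NC(W)`. -/
def NCFlat (n : ℕ) : Type := {X : Submodule ℝ (reflSpace ℝ n) // IsNCFlat X}

/-- The relation `(w, X) ∼ (w', X')`: `X = X'` and `w W_X = w' W_X`. -/
def parkSetoid (n : ℕ) : Setoid (Perm (Fin n) × NCFlat n) where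
  r p q := p.2 = q.2 ∧
    (QuotientGroup.mk p.1 : Perm (Fin n) ⧸ pointStab p.2.1) = QuotientGroup.mk q.1
  iseqv :=
    { refl := fun _ => ⟨rfl, rfl⟩
      symm := by
        rintro ⟨w, X⟩ ⟨w', X'⟩ ⟨h, h'⟩
        dsimp only at h h'
        subst h
        exact ⟨rfl, h'.symm⟩
      trans := by
        rintro ⟨w, X⟩ ⟨w', X'⟩ ⟨w'', X''⟩ ⟨h, h'⟩ ⟨k, k'⟩
        dsimp only at h h' k k'
        subst h
        subst k
        exact ⟨rfl, h'.trans k'⟩ }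

/-- The noncrossing parking functions `Park^NC_W`, the classes `[w, X]` with `X ∈ NC(W)`. -/
def ParkNC (n : ℕ) : Type := Quotient (parkSetoid n)

theorem reflLength_conj {n : ℕ} (g w : Perm (Fin n)) :
    reflLength (g * w * g⁻¹) = reflLength w := by
  have key : ∀ (g w : Perm (Fin n)) (k : ℕ),
      (∃ L : List (Perm (Fin n)), (∀ t ∈ L, t.IsSwap) ∧ L.length = k ∧ L.prod = w) →
      ∃ L : List (Perm (Fin n)), (∀ t ∈ L, t.IsSwap) ∧ L.length = k ∧
        L.prod = g * w * g⁻¹ := by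
    rintro g w k ⟨L, h1, h2, h3⟩
    refine ⟨L.map (MulAut.conj g), ?_, by simpa using h2, ?_⟩
    · intro t ht
      obtain ⟨s, hs, rfl⟩ := List.mem_map.1 ht
      obtain ⟨x, y, hxy, rfl⟩ := h1 s hs
      refine ⟨g x, g y, fun h => hxy (g.injective h), ?_⟩
      rw [MulAut.conj_apply, Equiv.mul_swap_eq_swap_mul, mul_assoc, mul_inv_cancel, mul_one]
    · rw [List.prod_hom, h3, MulAut.conj_apply]
  unfold reflLength
  congr 1
  ext k
  refine ⟨fun h => ?_, key g w k⟩
  have := key g⁻¹ _ k h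
  simpa [mul_assoc] using this

theorem AbsLE.conj {n : ℕ} {u v : Perm (Fin n)} (h : AbsLE u v) (g : Perm (Fin n)) :
    AbsLE (g * u * g⁻¹) (g * v * g⁻¹) := by
  unfold AbsLE at *
  have : (g * u * g⁻¹)⁻¹ * (g * v * g⁻¹) = g * (u⁻¹ * v) * g⁻¹ := by group
  rw [this, reflLength_conj, reflLength_conj, reflLength_conj, h]

theorem fixedSpace_conj {n : ℕ} (g w : Perm (Fin n)) :
    fixedSpace (g * w * g⁻¹) = (fixedSpace w).map (reflRep ℝ n g) := by
  ext x
  simp only [fixedSpace, LinearMap.mem_eqLocus, LinearMap.id_apply, Submodule.mem_map]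
  constructor
  · intro h
    refine ⟨reflRep ℝ n g⁻¹ x, ?_, by simp⟩
    conv_rhs => rw [← h]
    simp only [← Module.End.mul_apply, ← map_mul]
    congr 2
    group
  · rintro ⟨y, hy, rfl⟩
    conv_rhs => rw [← hy]
    simp only [← Module.End.mul_apply, ← map_mul]
    congr 2
    group

theorem comm_cox {n : ℕ} (g : coxGroup n) :
    (g : Perm (Fin n)) * cox n * (g : Perm (Fin n))⁻¹ = cox n := by
  obtain ⟨g, k, rfl⟩ := g
  simp only [← zpow_neg, ← zpow_add_one, ← zpow_add]
  rw [show k + 1 + -k = 1 by ring, zpow_one]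

theorem IsNCFlat.map_cox {n : ℕ} {X : Submodule ℝ (reflSpace ℝ n)} (h : IsNCFlat X)
    (g : coxGroup n) : IsNCFlat (X.map (reflRep ℝ n g)) := by
  obtain ⟨w, h1, h2, rfl⟩ := h
  refine ⟨g * w * (g : Perm (Fin n))⁻¹, ?_, ?_, fixedSpace_conj _ _⟩
  · simpa using h1.conj (g : Perm (Fin n))
  · have := h2.conj (g : Perm (Fin n))
    rwa [comm_cox] at this

/-- `X ↦ c^d(X)` on noncrossing flats. -/
def NCFlat.rotate {n : ℕ} (g : coxGroup n) (X : NCFlat n) : NCFlat n :=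
  ⟨X.1.map (reflRep ℝ n g), X.2.map_cox g⟩

/-- The action of `W × C` on `Park^NC_W`:
`(v, g) • [w, X] = [v w g⁻¹, g(X)]` for `g = c^d`. -/
instance ParkNC.instMulAction (n : ℕ) : MulAction (WC n) (ParkNC n) where
  smul a := Quotient.map
    (fun p => (a.1 * p.1 * (a.2 : Perm (Fin n))⁻¹, NCFlat.rotate a.2 p.2)) (by
      rintro ⟨w, X⟩ ⟨w', X'⟩ ⟨h, h'⟩
      dsimp only at h h'
      subst h
      refine ⟨rfl, ?_⟩
      rw [QuotientGroup.eq] at h' ⊢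
      rintro x ⟨y, hy, rfl⟩
      have := h' y hy
      conv_rhs => rw [← this]
      simp only [← Module.End.mul_apply, ← map_mul]
      congr 2
      group)
  one_smul := by
    rintro ⟨w, X⟩
    apply congrArg (Quotient.mk (parkSetoid n))
    refine Prod.ext (by simp) (Subtype.ext ?_)
    simp [NCFlat.rotate, Module.End.one_eq_id]
  mul_smul := by
    rintro a b ⟨w, X⟩
    apply congrArg (Quotient.mk (parkSetoid n))
    refine Prod.ext (by simp [mul_assoc]) (Subtype.ext ?_)
    simp [NCFlat.rotate, Module.End.mul_eq_comp, Submodule.map_comp]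

/-- The permutation representation of `W × C` on the vector space `ℂ[Park^NC_W]` of formal
linear combinations (`MonoidAlgebra` is used only as a vector space). -/
def parkNCRep (n : ℕ) : Representation ℂ (WC n) (MonoidAlgebra ℂ (ParkNC n)) :=
  Representation.ofMulAction ℂ (WC n) (ParkNC n)

/-! ### The algebraic parking space -/

/-- The complexified dual `V^*`. -/
abbrev VDual (n : ℕ) : Type := Module.Dual ℂ (reflSpace ℂ n)

/-- `W` acting on `V^*` by `(w f)(v) = f(w⁻¹ v)`. -/
abbrev dualRep (n : ℕ) : Representation ℂ (Perm (Fin n)) (VDual n) := (reflRep ℂ n).dual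

/-- The polynomial ring `ℂ[V] = ℂ[x_1, …, x_{n-1}]` in a basis of `V^*`. -/
abbrev PolyV (n : ℕ) : Type := MvPolynomial (Fin (n - 1)) ℂ

theorem omega_zpow_eq_one {n : ℕ} {k : ℤ} (h : cox n ^ k = 1) : omega n ^ k = 1 := by
  rcases Nat.eq_zero_or_pos n with rfl | hpos
  · simp [omega]
  have hn : (n : ℤ) ∣ k := by
    have hd := orderOf_dvd_iff_zpow_eq_one.2 h
    rcases Nat.lt_or_ge n 2 with hn | hn
    · have : n = 1 := by omega
      subst this
      simp
    · rwa [← Equiv.Perm.lcm_cycleType, cycleType_finRotate_of_le hn,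
        Multiset.lcm_singleton, normalize_eq] at hd
  obtain ⟨m, rfl⟩ := hn
  have h1 : omega n ^ (n : ℤ) = 1 := by
    rw [omega, ← Complex.exp_int_mul]
    have hne : (n : ℂ) ≠ 0 := by exact_mod_cast hpos.ne'
    rw [Int.cast_natCast, mul_div_cancel₀ _ hne, Complex.exp_two_pi_mul_I]
  rw [zpow_mul, h1, one_zpow]

theorem omega_ne_zero (n : ℕ) : omega n ≠ 0 := Complex.exp_ne_zero _

theorem omega_zpow_congr {n : ℕ} {a b : ℤ} (h : cox n ^ a = cox n ^ b) :
    omega n ^ (-a) = omega n ^ (-b) := by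
  have h1 : cox n ^ (b - a) = 1 := by rw [zpow_sub, h, mul_inv_cancel]
  have h2 := omega_zpow_eq_one h1
  rw [show -a = -b + (b - a) by ring, zpow_add₀ (omega_ne_zero n), h2, mul_one]

/-- The scalar `ω^{-d}` by which `c^d ∈ C` acts on the linear forms `x_i`. -/
def coxScalar (n : ℕ) : coxGroup n →* ℂ where
  toFun g := omega n ^ (-(Classical.choose g.2 : ℤ))
  map_one' := by
    have h : cox n ^ (Classical.choose (1 : coxGroup n).2 : ℤ) = cox n ^ (0 : ℤ) := by
      rw [zpow_zero]
      exact Classical.choose_spec (1 : coxGroup n).2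
    rw [omega_zpow_congr h]
    simp
  map_mul' := by
    intro g k
    have hg : cox n ^ (Classical.choose g.2 : ℤ) = g := Classical.choose_spec g.2
    have hk : cox n ^ (Classical.choose k.2 : ℤ) = k := Classical.choose_spec k.2
    have h : cox n ^ (Classical.choose (g * k).2 : ℤ) =
        cox n ^ ((Classical.choose g.2 : ℤ) + (Classical.choose k.2 : ℤ)) := by
      rw [zpow_add, hg, hk]
      exact Classical.choose_spec (g * k).2
    rw [omega_zpow_congr h, neg_add, zpow_add₀ (omega_ne_zero n)]

theorem coxScalar_coxPow (n : ℕ) (d : ℤ) : coxScalar n (coxPow n d) = omega n ^ (-d) :=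
  omega_zpow_congr (Classical.choose_spec (coxPow n d).2)

theorem coxScalar_pow (n : ℕ) (g : coxGroup n) : coxScalar n g ^ (n + 1) = coxScalar n g := by
  have hc : cox n ^ n = 1 := by
    rcases Nat.lt_or_ge n 2 with hn | hn
    · interval_cases n
      · simp
      · exact Subsingleton.elim _ _
    · rw [← orderOf_dvd_iff_pow_eq_one, ← Equiv.Perm.lcm_cycleType,
        cycleType_finRotate_of_le hn, Multiset.lcm_singleton, normalize_eq]
  have hg : g ^ n = 1 := by
    obtain ⟨g, k, rfl⟩ := g
    ext1
    change (cox n ^ k) ^ n = 1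
    rw [← zpow_natCast, zpow_comm, zpow_natCast, hc, one_zpow]
  rw [pow_succ, ← map_pow, hg, map_one, one_mul]

/-- The inclusion `V^* → ℂ[V]` for a chosen basis `x_1, …, x_{n-1}` of `V^*`. -/
def linForm {n : ℕ} (x : Module.Basis (Fin (n - 1)) ℂ (VDual n)) : VDual n →ₗ[ℂ] PolyV n :=
  x.constr ℂ (fun i => MvPolynomial.X i)

/-- The action of `W × C` on `ℂ[V]` by algebra maps: `w ∈ W` acts by the linear substitution
`x_i ↦ w(x_i)` and `c^d` by the scalar substitution `x_i ↦ ω^{-d} x_i`. -/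
def polyAct {n : ℕ} (x : Module.Basis (Fin (n - 1)) ℂ (VDual n)) (a : WC n) :
    PolyV n →ₐ[ℂ] PolyV n :=
  MvPolynomial.aeval (fun i => coxScalar n a.2 • linForm x (dualRep n a.1 (x i)))

theorem linForm_basis {n : ℕ} (x : Module.Basis (Fin (n - 1)) ℂ (VDual n)) (i : Fin (n - 1)) :
    linForm x (x i) = MvPolynomial.X i := by
  simp [linForm]

theorem polyAct_linForm {n : ℕ} (x : Module.Basis (Fin (n - 1)) ℂ (VDual n)) (a : WC n)
    (f : VDual n) :
    polyAct x a (linForm x f) = coxScalar n a.2 • linForm x (dualRep n a.1 f) := by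
  have : (polyAct x a).toLinearMap ∘ₗ linForm x =
      coxScalar n a.2 • (linForm x ∘ₗ dualRep n a.1) := by
    refine x.ext fun i => ?_
    simp [linForm_basis, polyAct]
  exact LinearMap.congr_fun this f

theorem polyAct_one {n : ℕ} (x : Module.Basis (Fin (n - 1)) ℂ (VDual n)) :
    polyAct x 1 = AlgHom.id ℂ (PolyV n) := by
  refine MvPolynomial.algHom_ext fun i => ?_
  rw [← linForm_basis x i, polyAct_linForm, Prod.fst_one, Prod.snd_one, map_one, map_one,
    one_smul, Module.End.one_apply, AlgHom.id_apply]

theorem polyAct_mul {n : ℕ} (x : Module.Basis (Fin (n - 1)) ℂ (VDual n)) (a b : WC n) :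
    polyAct x (a * b) = (polyAct x a).comp (polyAct x b) := by
  refine MvPolynomial.algHom_ext fun i => ?_
  rw [← linForm_basis x i, AlgHom.comp_apply, polyAct_linForm, polyAct_linForm, map_smul,
    polyAct_linForm, smul_smul, Prod.fst_mul, Prod.snd_mul, map_mul, map_mul,
    Module.End.mul_apply, mul_comm (coxScalar n a.2)]

/-- A basis `x_1, …, x_{n-1}` of `V^*` together with a homogeneous system of parameters
`Θ = (θ_1, …, θ_{n-1})` of degree `h + 1 = n + 1` in `ℂ[V]` such that the linear map
`x_i ↦ θ_i` is `W`-equivariant (its injectivity is automatic). As `Θ` consists of `dim V`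
homogeneous elements of positive degree, being a system of parameters means that
`ℂ[V]/(Θ)` is finite-dimensional. -/
structure ParkingHsop (n : ℕ) where
  /-- the coordinate functionals -/
  x : Module.Basis (Fin (n - 1)) ℂ (VDual n)
  /-- the parameters -/
  θ : Fin (n - 1) → PolyV n
  homogeneous : ∀ i, (θ i).IsHomogeneous (n + 1)
  equivariant : ∀ (w : Perm (Fin n)) (f : VDual n),
    x.constr ℂ θ (dualRep n w f) = polyAct x (w, 1) (x.constr ℂ θ f)
  finite : Module.Finite ℂ (PolyV n ⧸ Ideal.span (Set.range θ))

/-- The ideal `(Θ - 𝐱) = (θ_1 - x_1, …, θ_{n-1} - x_{n-1})`. -/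
def ParkingHsop.ideal {n : ℕ} (P : ParkingHsop n) : Ideal (PolyV n) :=
  Ideal.span (Set.range fun i => P.θ i - MvPolynomial.X i)

/-- The algebraic parking space `Park^alg_W = ℂ[V]/(Θ - 𝐱)`. -/
abbrev ParkAlg {n : ℕ} (P : ParkingHsop n) : Type := PolyV n ⧸ P.ideal

theorem ParkingHsop.sub_mem {n : ℕ} (P : ParkingHsop n) (f : VDual n) :
    P.x.constr ℂ P.θ f - linForm P.x f ∈ P.ideal := by
  have : P.x.constr ℂ P.θ f - linForm P.x f =
      ∑ i, P.x.repr f i • (P.θ i - MvPolynomial.X i) := by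
    simp [linForm, Module.Basis.constr_apply_fintype, smul_sub, Finset.sum_sub_distrib]
  rw [this]
  refine Submodule.sum_mem _ fun i _ => ?_
  rw [Algebra.smul_def]
  exact Ideal.mul_mem_left _ _ (Ideal.subset_span ⟨i, rfl⟩)

theorem polyAct_cox_homogeneous {n : ℕ} (x : Module.Basis (Fin (n - 1)) ℂ (VDual n))
    (g : coxGroup n) {p : PolyV n} {m : ℕ} (hp : p.IsHomogeneous m) :
    polyAct x (1, g) p = coxScalar n g ^ m • p := by
  have hX : ∀ i, polyAct x (1, g) (MvPolynomial.X i) = coxScalar n g • MvPolynomial.X i := by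
    intro i
    rw [← linForm_basis x i, polyAct_linForm, map_one, Module.End.one_apply]
  conv_lhs => rw [p.as_sum]
  conv_rhs => rw [p.as_sum]
  rw [map_sum, Finset.smul_sum]
  refine Finset.sum_congr rfl fun d hd => ?_
  have hdeg : d.degree = m := by
    rw [Finsupp.degree_eq_weight_one]
    exact hp (MvPolynomial.mem_support_iff.1 hd)
  rw [MvPolynomial.monomial_eq, map_mul, Finsupp.prod, map_prod]
  simp only [map_pow, hX, smul_pow]
  rw [Finset.prod_smul, Finset.prod_pow_eq_pow_sum]
  rw [← hdeg, Finsupp.degree_apply, MvPolynomial.algHom_C, MvPolynomial.algebraMap_eq,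
    mul_smul_comm]

theorem ParkingHsop.ideal_le_comap {n : ℕ} (P : ParkingHsop n) (a : WC n) :
    P.ideal ≤ P.ideal.comap (polyAct P.x a) := by
  refine Ideal.span_le.2 ?_
  rintro _ ⟨i, rfl⟩
  obtain ⟨w, g⟩ := a
  change polyAct P.x (w, g) (P.θ i - MvPolynomial.X i) ∈ P.ideal
  have h1 : polyAct P.x (w, g) = (polyAct P.x (w, 1)).comp (polyAct P.x (1, g)) := by
    rw [← polyAct_mul]
    simp
  have h2 : polyAct P.x (1, g) (P.θ i - MvPolynomial.X i) =
      coxScalar n g • (P.x.constr ℂ P.θ (P.x i) - linForm P.x (P.x i)) := by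
    rw [map_sub, polyAct_cox_homogeneous P.x g (P.homogeneous i),
      polyAct_cox_homogeneous P.x g (MvPolynomial.isHomogeneous_X ℂ i), coxScalar_pow,
      linForm_basis]
    simp [smul_sub]
  rw [h1, AlgHom.comp_apply, h2, map_smul, map_sub, ← P.equivariant, polyAct_linForm, map_one,
    one_smul, Algebra.smul_def]
  exact Ideal.mul_mem_left _ _ (P.sub_mem _)

/-- The `W × C`-representation on `Park^alg_W` induced by the action on `ℂ[V]`. -/
def parkAlgRep {n : ℕ} (P : ParkingHsop n) : Representation ℂ (WC n) (ParkAlg P) where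
  toFun a := (Ideal.quotientMapₐ P.ideal (polyAct P.x a) (P.ideal_le_comap a)).toLinearMap
  map_one' := by
    refine LinearMap.ext fun y => ?_
    obtain ⟨p, rfl⟩ := Ideal.Quotient.mk_surjective y
    change Ideal.Quotient.mk P.ideal (polyAct P.x 1 p) = Ideal.Quotient.mk P.ideal p
    rw [polyAct_one, AlgHom.id_apply]
  map_mul' := by
    intro a b
    refine LinearMap.ext fun y => ?_
    obtain ⟨p, rfl⟩ := Ideal.Quotient.mk_surjective y
    change Ideal.Quotient.mk P.ideal (polyAct P.x (a * b) p) =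
      Ideal.Quotient.mk P.ideal (polyAct P.x a (polyAct P.x b p))
    rw [polyAct_mul, AlgHom.comp_apply]

/-! ### Counting -/

/-- `mult_u(z)`: the multiplicity of `z` as an eigenvalue of `u` on the complexified `V`
(`u` has finite order, hence is diagonalizable). -/
def eigMult {n : ℕ} (u : Perm (Fin n)) (z : ℂ) : ℕ :=
  Module.finrank ℂ (Module.End.eigenspace (reflRep ℂ n u) z)

/-- `r_d(u)`: the number of cycles of `u` (fixed points included) of size divisible by `d`. -/
def cyclesDvd {n : ℕ} (d : ℕ) (u : Perm (Fin n)) : ℕ :=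
  u.partition.parts.countP (fun k => d ∣ k)

/-- The set of noncrossing parking functions fixed by `(u, c^ℓ)`. -/
def fixedParkNC {n : ℕ} (u : Perm (Fin n)) (l : ℤ) : Set (ParkNC n) :=
  MulAction.fixedBy (ParkNC n) ((u, coxPow n l) : WC n)

/-- The `(u, c^ℓ)`-equivariant functions `f : [n] → [n] ∪ {0}`, that is, `f(u(j)) = c^ℓ f(j)`
for all `j`, where `c^ℓ(0) = 0`. The value `0` is encoded as `none`. -/
def equivariantFunctions {n : ℕ} (u : Perm (Fin n)) (l : ℤ) : Set (Fin n → Option (Fin n)) :=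
  {f | ∀ j, f (u j) = (f j).map (cox n ^ l)}

end TypeAParking

end

open TypeAParking

/-! A representation of a finite group in characteristic zero is determined by its character
(`Representation.nonempty_equiv_of_character_eq`). Hence it suffices to see that the trace of `(w,
c^l)` on the algebraic parking space and the number of its fixed points on noncrossing parking
functions are the same power of `n + 1`.

Algebraic side. The polynomial ring is free over the subalgebra generated by a homogeneous system of
parameters, with a basis of monomials (`exists_monomials_combine_bijective`). The form `θ_i` has
degree `n + 1 ≥ 2`, so it is the leading form of `θ_i - x_i`, and the same monomials form a basis of
the quotient by `(Θ - x)`. Diagonalize `w` on the dual space and work in eigencoordinates. Because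
`s^(n+1) = s` for the scalar `s` by which `c^l` acts, the pair `(w, c^l)` multiplies the i-th
coordinate and the i-th parameter by the same scalar `μ_i`. Computing the graded trace on the
polynomial ring in two bases shows that the trace on the quotient is the value at `q = 1` of `∏ (1 -
μ_i q^(n+1)) / (1 - μ_i q)`, which is `(n+1)` to the number of `i` with `μ_i = 1`
(`trace_quotient_eq`, `parkAlgRep_character`).

Combinatorial side. The interval below `c` consists of the permutations satisfying `ArcInvariant`,
so noncrossing flats are noncrossing partitions. If the blocks of each invariant flat `X` are
labelled equivariantly by a function `F X`, and the multiplicities of the labels determine `F X`,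
then a fixed class `[v, X]` is encoded by the equivariant function `F X ∘ v⁻¹`
(`ncard_fixedParkNC`). Suitable labels come from parking cars on a circle: every multiplicity vector
whose sum is at most the number of spots has exactly one parking outcome (`IsParkMap.ext`,
`fiberCard_parkMap`), and the cars with equal preferences form noncrossing blocks
(`IsParkMap.isNoncrossing`).

If `c^l ≠ 1`, a block is labelled by its first point after its preceding rotated copy. Every
equivariant function then has the multiplicities of an invariant flat, so fixed points and
equivariant functions are equinumerous, and the latter are counted cycle by cycle. If `c^l = 1`, a
block is labelled by its minimum, on a circle of `n + 1` spots whose last spot is empty. By Pollak's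
argument exactly one of the `n + 1` rotations of a preference function leaves that spot empty, which
divides the count of invariant functions by `n + 1`. The same correction by one relates numbers of
cycles to eigenvalue multiplicities, since the reflection representation omits the constant vectors
(`eigMult_omega`). -/

namespace Representation

/-! ### Characters determine representations in characteristic zero. -/

variable {k G : Type*} [Field k] [Group G]

section
variable {V W : Type*} [AddCommGroup V] [Module k V] [AddCommGroup W] [Module k W]
  {ρ : Representation k G V} {σ : Representation k G W}

/-- The equivalence between a representation and the product of two complementary
subrepresentations. -/
noncomputable def prodEquivOfIsCompl (p q : Subrepresentation ρ) (h : IsCompl p q) :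
    Equiv (p.toRepresentation.prod q.toRepresentation) ρ :=
  Equiv.mk (Submodule.prodEquivOfIsCompl p.toSubmodule q.toSubmodule
    ⟨disjoint_iff.2 (congrArg Subrepresentation.toSubmodule h.inf_eq_bot),
      codisjoint_iff.2 (congrArg Subrepresentation.toSubmodule h.sup_eq_top)⟩) (by
    intro g
    refine LinearMap.ext fun x => ?_
    simp [Subrepresentation.toRepresentation])

/-- The product of two equivalences of representations. -/
noncomputable def Equiv.prodCongr {V' W' : Type*} [AddCommGroup V'] [Module k V'] [AddCommGroup W'] [Module k W']
    {ρ' : Representation k G V'} {σ' : Representation k G W'}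
    (e : Equiv ρ σ) (f : Equiv ρ' σ') : Equiv (ρ.prod ρ') (σ.prod σ') :=
  Equiv.mk (e.toLinearEquiv.prodCongr f.toLinearEquiv) (by
    intro g
    refine LinearMap.ext fun x => ?_
    refine Prod.ext ?_ ?_
    · exact e.toIntertwiningMap.isIntertwining _ _ g x.1
    · exact f.toIntertwiningMap.isIntertwining _ _ g x.2)

theorem char_prod [FiniteDimensional k V] [FiniteDimensional k W] (g : G) :
    (ρ.prod σ).character g = ρ.character g + σ.character g :=
  LinearMap.trace_prodMap' _ _

/-- An injective intertwining map is an equivalence onto its range. -/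
noncomputable def IntertwiningMap.equivRange (f : IntertwiningMap ρ σ)
    (hf : Function.Injective f) : Equiv ρ f.range.toRepresentation :=
  Equiv.mk (LinearEquiv.ofInjective f.toLinearMap hf) (by
    intro g
    refine LinearMap.ext fun x => Subtype.ext ?_
    exact f.isIntertwining _ _ g x)

end


/-- A nonzero subrepresentation of least dimension works: the kernel of `f` is again a
subrepresentation of `ρ`, so by minimality it is zero or everything. This is the half of Schur's
lemma that the induction on dimension needs. -/
theorem exists_subrepresentation_forall_injective {V : Type*} [AddCommGroup V] [Module k V]
    [FiniteDimensional k V] [Nontrivial V] (ρ : Representation k G V) :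
    ∃ p : Subrepresentation ρ, 0 < Module.finrank k p.toSubmodule ∧
      ∀ (W : Type*) [AddCommGroup W] [Module k W] (σ : Representation k G W)
        (f : IntertwiningMap p.toRepresentation σ), f ≠ 0 → Function.Injective f := by
  classical
  have hex : ∃ m, 0 < m ∧ ∃ p : Subrepresentation ρ, Module.finrank k p.toSubmodule = m :=
    ⟨_, Module.finrank_pos, ⊤, finrank_top k V⟩
  obtain ⟨hpos, p, hp⟩ := Nat.find_spec hex
  have hmin := fun m => @Nat.find_min _ _ hex m
  refine ⟨p, by rwa [hp], ?_⟩
  intro W _ _ σ f hf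
  let K : Subrepresentation ρ := ⟨f.ker.toSubmodule.map p.toSubmodule.subtype, by
    rintro g _ ⟨x, hx, rfl⟩
    exact ⟨p.toRepresentation g x, f.ker.apply_mem_toSubmodule g hx, rfl⟩⟩
  have hK : Module.finrank k K.toSubmodule = Module.finrank k f.ker.toSubmodule :=
    (Submodule.equivMapOfInjective _ p.toSubmodule.injective_subtype _).finrank_eq.symm
  have hle : Module.finrank k f.ker.toSubmodule ≤ Module.finrank k p.toSubmodule :=
    Submodule.finrank_le _
  have hker : f.ker.toSubmodule = LinearMap.ker f.toLinearMap := rfl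
  rcases Nat.eq_zero_or_pos (Module.finrank k f.ker.toSubmodule) with h0 | h0
  · rw [hker] at h0
    exact LinearMap.ker_eq_bot.1 (Submodule.finrank_eq_zero.1 h0)
  · exfalso
    have h1 : ¬ Module.finrank k f.ker.toSubmodule < Nat.find hex := fun hlt =>
      hmin _ hlt ⟨h0, K, hK⟩
    have h2 : f.ker.toSubmodule = ⊤ := Submodule.eq_top_of_finrank_eq (by omega)
    rw [hker] at h2
    exact hf (IntertwiningMap.ext (LinearMap.ker_eq_top.1 h2))

/-- The pairing of characters computes the dimension of a Hom space over any field of characteristic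
zero, so a minimal piece `p` of `ρ` also maps nontrivially, hence injectively, to `σ`. Maschke's
theorem splits it off on both sides, the complements still have equal characters, and induction on
the dimension applies. -/
theorem nonempty_equiv_of_character_eq [Finite G] [CharZero k] {V W : Type*}
    [AddCommGroup V] [Module k V] [FiniteDimensional k V] [AddCommGroup W] [Module k W]
    [FiniteDimensional k W] (ρ : Representation k G V) (σ : Representation k G W)
    (h : ρ.character = σ.character) : Nonempty (Equiv ρ σ) := by
  have := Fintype.ofFinite G
  have hcard : (Nat.card G : k) ≠ 0 := Nat.cast_ne_zero.2 Nat.card_pos.ne'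
  have : Invertible (Nat.card G : k) := invertibleOfNonzero hcard
  have : NeZero (Nat.card G : k) := ⟨hcard⟩
  obtain ⟨m, hm⟩ : ∃ m, Module.finrank k V = m := ⟨_, rfl⟩
  have hfin : Module.finrank k V = Module.finrank k W := by
    have h1 := congrFun h 1
    rw [char_one, char_one] at h1
    exact_mod_cast h1
  induction m using Nat.strong_induction_on generalizing V W with
  | _ m ih =>
  rcases subsingleton_or_nontrivial V with hV | hV
  · have hW : Subsingleton W := by
      rw [← Module.finrank_zero_iff (R := k), ← hfin, Module.finrank_zero_iff]
      exact hV
    exact ⟨Equiv.mk (LinearEquiv.ofSubsingleton V W)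
      (fun g => LinearMap.ext fun x => Subsingleton.elim _ _)⟩
  · obtain ⟨p, hp, hinj⟩ := exists_subrepresentation_forall_injective ρ
    have hhom : (Module.finrank k (IntertwiningMap p.toRepresentation ρ) : k) =
        Module.finrank k (IntertwiningMap p.toRepresentation σ) := by
      rw [← card_inv_mul_sum_char_mul_char_eq_finrank,
        ← card_inv_mul_sum_char_mul_char_eq_finrank, h]
    have hne : Module.finrank k (IntertwiningMap p.toRepresentation ρ) ≠ 0 := by
      let i : IntertwiningMap p.toRepresentation ρ := ⟨p.toSubmodule.subtype, fun g => rfl⟩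
      have hi : i ≠ 0 := by
        intro h0
        have : p.toSubmodule.subtype = 0 := congrArg IntertwiningMap.toLinearMap h0
        have hb : p.toSubmodule = ⊥ := by
          rw [← Submodule.range_subtype p.toSubmodule, this, LinearMap.range_zero]
        rw [hb, finrank_bot] at hp
        exact lt_irrefl _ hp
      have : FiniteDimensional k (IntertwiningMap p.toRepresentation ρ) :=
        FiniteDimensional.of_injective
          (⟨⟨fun f => f.toLinearMap, fun _ _ => rfl⟩, fun _ _ => rfl⟩ :
            IntertwiningMap p.toRepresentation ρ →ₗ[k] p.toSubmodule →ₗ[k] V)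
          (IntertwiningMap.toLinearMap_injective _ _)
      have : Nontrivial (IntertwiningMap p.toRepresentation ρ) := ⟨i, 0, hi⟩
      exact Module.finrank_pos.ne'
    obtain ⟨f, hf⟩ : ∃ f : IntertwiningMap p.toRepresentation σ, f ≠ 0 := by
      by_contra! hall
      have : Subsingleton (IntertwiningMap p.toRepresentation σ) :=
        ⟨fun a b => (hall a).trans (hall b).symm⟩
      rw [Module.finrank_zero_of_subsingleton (M := IntertwiningMap p.toRepresentation σ)] at hhom
      exact hne (by exact_mod_cast hhom)
    have hfi := hinj _ σ f hf
    obtain ⟨q, hq⟩ := exists_isCompl p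
    obtain ⟨r, hr⟩ := exists_isCompl f.range
    have e1 := prodEquivOfIsCompl p q hq
    have e2 := prodEquivOfIsCompl f.range r hr
    have e3 := f.equivRange hfi
    have hchar : q.toRepresentation.character = r.toRepresentation.character := by
      ext g
      have h1 := congrFun (char_iso e1) g
      have h2 := congrFun (char_iso e2) g
      rw [char_prod] at h1 h2
      rw [char_iso e3, h] at h1
      exact add_left_cancel (h1.trans h2.symm)
    have hd := e1.toLinearEquiv.finrank_eq
    rw [Module.finrank_prod] at hd
    have hqr : Module.finrank k q.toSubmodule = Module.finrank k r.toSubmodule := by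
      have h1 := congrFun hchar 1
      rw [char_one, char_one] at h1
      exact_mod_cast h1
    obtain ⟨e4⟩ := ih (Module.finrank k q.toSubmodule) (by omega) _ _ hchar rfl hqr
    exact ⟨e1.symm.trans ((e3.prodCongr e4).trans e2)⟩

end Representation

/-! ### Regular sequences: exchange of terms and prime avoidance. -/

section RegularChains

open MvPolynomial

variable {σ k : Type*} [Field k]

/-- The ideal contains the homogeneous components of its elements. -/
def GradedIdeal (I : Ideal (MvPolynomial σ k)) : Prop :=
  ∀ p ∈ I, ∀ n, homogeneousComponent n p ∈ I

/-- The element `b` is not a zero divisor modulo `I`. -/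
def RegularMod {R : Type*} [CommRing R] (I : Ideal R) (b : R) : Prop :=
  ∀ f, b * f ∈ I → f ∈ I

/-- The sequence `b` is weakly regular modulo `I`. -/
def RegChain {R : Type*} [CommRing R] : ∀ {m : ℕ}, Ideal R → (Fin m → R) → Prop
  | 0, _, _ => True
  | _ + 1, I, b => RegularMod I (b 0) ∧ RegChain (I ⊔ Ideal.span {b 0}) (Fin.tail b)

theorem homogeneousComponent_mul_of_isHomogeneous {b : MvPolynomial σ k} {e : ℕ}
    (hb : b.IsHomogeneous e) (f : MvPolynomial σ k) (n : ℕ) :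
    homogeneousComponent n (b * f) =
      if e ≤ n then b * homogeneousComponent (n - e) f else 0 := by
  have hf : f = ∑ i ∈ Finset.range (f.totalDegree + 1), homogeneousComponent i f :=
    (sum_homogeneousComponent f).symm
  have key : ∀ i, homogeneousComponent n (b * homogeneousComponent i f) =
      if e + i = n then b * homogeneousComponent i f else 0 := fun i => by
    rw [homogeneousComponent_of_mem (m := n) (hb.mul (homogeneousComponent_isHomogeneous i f))]
    simp only [eq_comm]
  conv_lhs => rw [hf, Finset.mul_sum, map_sum]
  simp only [key]
  split_ifs with h
  · by_cases hn : n - e ∈ Finset.range (f.totalDegree + 1)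
    · rw [Finset.sum_eq_single_of_mem _ hn]
      · rw [if_pos (by omega)]
      · intro i _ hi
        rw [if_neg (by omega)]
    · rw [Finset.sum_eq_zero, homogeneousComponent_eq_zero, mul_zero]
      · simp only [Finset.mem_range] at hn
        omega
      · intro i hi
        rw [if_neg]
        rintro rfl
        exact hn (by simpa using hi)
  · refine Finset.sum_eq_zero fun i _ => if_neg (by omega)

theorem GradedIdeal.bot : GradedIdeal (⊥ : Ideal (MvPolynomial σ k)) := by
  intro p hp n
  rw [Ideal.mem_bot] at hp ⊢
  rw [hp, map_zero]

theorem mem_sup_span_singleton {R : Type*} [CommRing R] {I : Ideal R} {b f : R} :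
    f ∈ I ⊔ Ideal.span {b} ↔ ∃ i ∈ I, ∃ g, f = i + b * g := by
  rw [Submodule.mem_sup]
  constructor
  · rintro ⟨i, hi, z, hz, rfl⟩
    obtain ⟨g, rfl⟩ := Ideal.mem_span_singleton.1 hz
    exact ⟨i, hi, g, rfl⟩
  · rintro ⟨i, hi, g, rfl⟩
    exact ⟨i, hi, _, Ideal.mem_span_singleton.2 ⟨g, rfl⟩, rfl⟩

theorem GradedIdeal.sup_span_singleton {I : Ideal (MvPolynomial σ k)} (hI : GradedIdeal I)
    {b : MvPolynomial σ k} {e : ℕ} (hb : b.IsHomogeneous e) :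
    GradedIdeal (I ⊔ Ideal.span {b}) := by
  intro p hp n
  obtain ⟨i, hi, g, rfl⟩ := mem_sup_span_singleton.1 hp
  rw [map_add, homogeneousComponent_mul_of_isHomogeneous hb]
  refine add_mem (Ideal.mem_sup_left (hI i hi n)) ?_
  split_ifs
  · exact Ideal.mem_sup_right (Ideal.mul_mem_right _ _ (Ideal.mem_span_singleton_self b))
  · exact zero_mem _

theorem GradedIdeal.mem_of_forall {I : Ideal (MvPolynomial σ k)} {f : MvPolynomial σ k}
    (h : ∀ n, homogeneousComponent n f ∈ I) : f ∈ I := by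
  rw [← sum_homogeneousComponent f]
  exact Submodule.sum_mem _ fun i _ => h i

/-- Two consecutive members of a regular chain may be exchanged. -/
theorem RegularMod.swap {I : Ideal (MvPolynomial σ k)} (hI : GradedIdeal I)
    {a x : MvPolynomial σ k} {e : ℕ} (ha : a.IsHomogeneous e) (he : 0 < e)
    (h1 : RegularMod I a) (h2 : RegularMod (I ⊔ Ideal.span {a}) x) :
    RegularMod I x ∧ RegularMod (I ⊔ Ideal.span {x}) a := by
  -- Modulo `I`, the annihilator of `x` equals `a` times itself: regularity of `x` modulo `I + (a)`
  -- extracts a factor `a`, and regularity of `a` cancels it.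
  have hstep : ∀ f, x * f ∈ I → ∃ i ∈ I, ∃ g, x * g ∈ I ∧ f = i + a * g := by
    intro f hf
    obtain ⟨i, hi, g, rfl⟩ := mem_sup_span_singleton.1 (h2 f (Ideal.mem_sup_left hf))
    refine ⟨i, hi, g, h1 _ ?_, rfl⟩
    have : a * (x * g) = x * (i + a * g) - x * i := by ring
    rw [this]
    exact sub_mem hf (Ideal.mul_mem_left _ _ hi)
  have hx : RegularMod I x := by
    -- A graded Nakayama argument: `a` has positive degree, so the component of `a * g` in degree
    -- `n` involves only lower components of `g`.
    have hn : ∀ n f, x * f ∈ I → homogeneousComponent n f ∈ I := by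
      intro n
      induction n using Nat.strong_induction_on with
      | _ n ih =>
      intro f hf
      obtain ⟨i, hi, g, hg, rfl⟩ := hstep f hf
      rw [map_add, homogeneousComponent_mul_of_isHomogeneous ha]
      refine add_mem (hI i hi n) ?_
      split_ifs
      · exact Ideal.mul_mem_left _ _ (ih _ (by omega) g hg)
      · exact zero_mem _
    exact fun f hf => GradedIdeal.mem_of_forall fun n => hn n f hf
  refine ⟨hx, fun f hf => ?_⟩
  obtain ⟨i, hi, g, hg⟩ := mem_sup_span_singleton.1 hf
  have hg' : x * g ∈ I ⊔ Ideal.span {a} := by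
    have : x * g = -i + a * f := by rw [hg]; ring
    exact mem_sup_span_singleton.2 ⟨-i, neg_mem hi, f, this⟩
  obtain ⟨i', hi', h, rfl⟩ := mem_sup_span_singleton.1 (h2 g hg')
  have h3 : f - x * h ∈ I := by
    refine h1 _ ?_
    have : a * (f - x * h) = i + x * i' := by rw [mul_sub, hg]; ring
    rw [this]
    exact add_mem hi (Ideal.mul_mem_left _ _ hi')
  exact mem_sup_span_singleton.2 ⟨_, h3, h, by ring⟩

/-- If an ideal generated modulo `I` by a vector space `W` contains a regular element, then `W`
contains one. -/
theorem exists_regularMod_mem [Finite σ] [Infinite k] (I : Ideal (MvPolynomial σ k))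
    (W : Submodule k (MvPolynomial σ k)) {a : MvPolynomial σ k} (ha : RegularMod I a)
    (haW : a ∈ I ⊔ Ideal.span (W : Set (MvPolynomial σ k))) : ∃ x ∈ W, RegularMod I x := by
  classical
  let A := MvPolynomial σ k
  by_contra! hcon
  have hfin := associatedPrimes.finite A (A ⧸ I)
  have hU := biUnion_associatedPrimes_eq_zero_divisors A (A ⧸ I)
  have hmem : ∀ r : A, ¬ RegularMod I r ↔ ∃ p ∈ associatedPrimes A (A ⧸ I), r ∈ p := by
    intro r
    have h1 : r ∈ (⋃ p ∈ associatedPrimes A (A ⧸ I), p : Set A) ↔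
        r ∈ { r : A | ∃ x : A ⧸ I, x ≠ 0 ∧ r • x = 0 } := by rw [hU]
    simp only [Set.mem_iUnion, SetLike.mem_coe, Set.mem_ofPred_eq, exists_prop] at h1
    rw [h1]
    unfold RegularMod
    push Not
    constructor
    · rintro ⟨f, hf, hf'⟩
      exact ⟨Ideal.Quotient.mk I f, fun h => hf' (Ideal.Quotient.eq_zero_iff_mem.1 h),
        Ideal.Quotient.eq_zero_iff_mem.2 hf⟩
    · rintro ⟨x, hx, hx'⟩
      obtain ⟨f, rfl⟩ := Ideal.Quotient.mk_surjective x
      exact ⟨f, Ideal.Quotient.eq_zero_iff_mem.1 hx',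
        fun h => hx (Ideal.Quotient.eq_zero_iff_mem.2 h)⟩
  have := hfin.to_subtype
  -- Prime avoidance for vector spaces: over an infinite field `W` is not a finite union of proper
  -- subspaces, so a `W` made of zero divisors lies in a single associated prime, which then
  -- contains `I` and `a`.
  obtain ⟨⟨p, hp⟩, hpW⟩ := Subspace.exists_eq_top_of_iUnion_eq_univ (k := k) (E := W)
    (p := fun p : associatedPrimes A (A ⧸ I) =>
      (p.1.restrictScalars k).comap W.subtype) (by
    refine Set.eq_univ_of_forall fun x => ?_
    obtain ⟨p, hp, hx⟩ := (hmem x.1).1 (hcon x.1 x.2)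
    exact Set.mem_iUnion.2 ⟨⟨p, hp⟩, hx⟩)
  have hWp : ∀ x ∈ W, x ∈ p := by
    intro x hx
    have : (⟨x, hx⟩ : W) ∈ (⊤ : Submodule k W) := trivial
    rw [← hpW] at this
    exact this
  have hIp : I ≤ p := by
    have := IsAssociatedPrime.annihilator_le hp
    rwa [Submodule.annihilator_top, Ideal.annihilator_quotient] at this
  have hap : a ∈ p := by
    have : I ⊔ Ideal.span (W : Set A) ≤ p := sup_le hIp (Ideal.span_le.2 hWp)
    exact this haW
  exact (hmem a).2 ⟨p, hp, hap⟩ ha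

/-- Modulo all but the last term of the chain, prime avoidance replaces the last term by an element
of `W`. Successive exchanges with its homogeneous predecessors then bring this element to the front.
-/
theorem exists_regChain_cons [Finite σ] [Infinite k] (W : Submodule k (MvPolynomial σ k))
    {m : ℕ} (I : Ideal (MvPolynomial σ k)) (hI : GradedIdeal I)
    (a : Fin (m + 1) → MvPolynomial σ k) (e : Fin (m + 1) → ℕ)
    (hae : ∀ i, (a i).IsHomogeneous (e i)) (he : ∀ i, 0 < e i) (ha : RegChain I a)
    (haW : ∀ i, a i ∈ I ⊔ Ideal.span (W : Set (MvPolynomial σ k))) :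
    ∃ x ∈ W, RegChain I (Fin.cons x (Fin.init a) : Fin (m + 1) → MvPolynomial σ k) := by
  induction m generalizing I with
  | zero =>
    obtain ⟨x, hx, hreg⟩ := exists_regularMod_mem I W ha.1 (haW 0)
    exact ⟨x, hx, hreg, trivial⟩
  | succ m ih =>
    obtain ⟨h0, h1⟩ := ha
    obtain ⟨x, hx, h2, h3⟩ := ih (I ⊔ Ideal.span {a 0}) (hI.sup_span_singleton (hae 0))
      (Fin.tail a) (Fin.tail e) (fun i => hae i.succ) (fun i => he i.succ) h1
      (fun i => by
        have : I ⊔ Ideal.span (W : Set (MvPolynomial σ k)) ≤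
            I ⊔ Ideal.span {a 0} ⊔ Ideal.span (W : Set (MvPolynomial σ k)) :=
          sup_le_sup_right le_sup_left _
        exact this (haW i.succ))
    rw [Fin.cons_zero] at h2 h3
    rw [Fin.tail_cons] at h3
    obtain ⟨h4, h5⟩ := RegularMod.swap hI (hae 0) (he 0) h0 h2
    refine ⟨x, hx, h4, ?_⟩
    rw [Fin.tail_cons, Fin.cons_zero]
    refine ⟨h5, ?_⟩
    rw [Fin.tail_init_eq_init_tail, sup_right_comm]
    exact h3

/-- A regular sequence in the ideal generated by a vector space `W` of forms can be exchanged for a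
regular sequence in `W`. -/
theorem exists_regChain_mem [Finite σ] [Infinite k] (W : Submodule k (MvPolynomial σ k)) (d : ℕ)
    (hW : ∀ x ∈ W, x.IsHomogeneous d)
    {m : ℕ} (I : Ideal (MvPolynomial σ k)) (hI : GradedIdeal I)
    (a : Fin m → MvPolynomial σ k) (e : Fin m → ℕ)
    (hae : ∀ i, (a i).IsHomogeneous (e i)) (he : ∀ i, 0 < e i) (ha : RegChain I a)
    (haW : ∀ i, a i ∈ I ⊔ Ideal.span (W : Set (MvPolynomial σ k))) :
    ∃ b : Fin m → MvPolynomial σ k, (∀ i, b i ∈ W) ∧ RegChain I b := by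
  induction m generalizing I with
  | zero => exact ⟨a, fun i => i.elim0, trivial⟩
  | succ m ih =>
    obtain ⟨x, hx, h1, h2⟩ := exists_regChain_cons W I hI a e hae he ha haW
    rw [Fin.cons_zero] at h1 h2
    rw [Fin.tail_cons] at h2
    obtain ⟨b, hb, hb'⟩ := ih (I ⊔ Ideal.span {x}) (hI.sup_span_singleton (hW x hx))
      (Fin.init a) (Fin.init e) (fun i => hae i.castSucc) (fun i => he i.castSucc) h2
      (fun i => by
        have : I ⊔ Ideal.span (W : Set (MvPolynomial σ k)) ≤
            I ⊔ Ideal.span {x} ⊔ Ideal.span (W : Set (MvPolynomial σ k)) :=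
          sup_le_sup_right le_sup_left _
        exact this (haW i.castSucc))
    refine ⟨Fin.cons x b, ?_, ?_⟩
    · intro i
      refine Fin.cases hx (fun j => ?_) i
      rw [Fin.cons_succ]
      exact hb j
    · refine ⟨h1, ?_⟩
      rw [Fin.cons_zero, Fin.tail_cons]
      exact hb'

/-- Powers of distinct variables form a regular chain. -/
theorem regChain_X_pow [DecidableEq σ] (M : ℕ) {m : ℕ} (f : Fin m → σ)
    (hf : Function.Injective f) (T : Set σ) (hT : ∀ i, f i ∉ T) :
    RegChain (Ideal.span ((fun s => monomial s (1 : k)) ''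
      ((fun j => Finsupp.single j M) '' T))) (fun i => (X (f i) ^ M : MvPolynomial σ k)) := by
  induction m generalizing T with
  | zero => trivial
  | succ m ih =>
    constructor
    -- Membership in a monomial ideal is tested on monomials, and a power of a variable outside `T`
    -- does not affect divisibility by powers of the variables in `T`.
    · intro p hp
      rw [mem_ideal_span_monomial_image] at hp ⊢
      intro s hs
      have hs' : s + Finsupp.single (f 0) M ∈ (X (f 0) ^ M * p : MvPolynomial σ k).support := by
        rw [mem_support_iff] at hs ⊢
        rw [X_pow_eq_monomial, add_comm, coeff_monomial_mul, one_mul]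
        exact hs
      obtain ⟨_, ⟨j, hj, rfl⟩, hle⟩ := hp _ hs'
      refine ⟨_, ⟨j, hj, rfl⟩, ?_⟩
      have hne : f 0 ≠ j := fun h => hT 0 (h ▸ hj)
      rw [Finsupp.single_le_iff] at hle ⊢
      rwa [Finsupp.add_apply, Finsupp.single_eq_of_ne hne.symm, add_zero] at hle
    · have h := ih (Fin.tail f) (fun i j hij => Fin.succ_injective _ (hf hij)) (insert (f 0) T)
        (by
          rintro i (hi | hi)
          · exact Fin.succ_ne_zero i (hf hi)
          · exact hT _ hi)
      rw [Set.image_insert_eq, Set.image_insert_eq, Ideal.span_insert, sup_comm] at h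
      simpa only [X_pow_eq_monomial] using! h

/-- Modulo `b 0` the remaining coefficients vanish by induction. A nonzero coefficient at `b 0`
would then put `b 0` itself in `I`, and regularity would put `1` in `I`. -/
theorem RegChain.eq_zero_of_sum_mem {m : ℕ} (I : Ideal (MvPolynomial σ k))
    (b : Fin m → MvPolynomial σ k) (hb : RegChain I b)
    (h1 : (1 : MvPolynomial σ k) ∉ I ⊔ Ideal.span (Set.range b)) (c : Fin m → k)
    (hc : ∑ i, c i • b i ∈ I) : c = 0 := by
  induction m generalizing I with
  | zero => exact Subsingleton.elim _ _
  | succ m ih =>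
    have hspan : Ideal.span (Set.range b) = Ideal.span {b 0} ⊔
        Ideal.span (Set.range (Fin.tail b)) := by
      conv_lhs => rw [← Fin.cons_self_tail b, Fin.range_cons, Ideal.span_insert]
    rw [Fin.sum_univ_succ] at hc
    have htail := ih (I ⊔ Ideal.span {b 0}) (Fin.tail b) hb.2
      (by rwa [sup_assoc, ← hspan]) (Fin.tail c) (by
        have : ∑ i, Fin.tail c i • Fin.tail b i =
            (c 0 • b 0 + ∑ i : Fin m, c i.succ • b i.succ) + b 0 * C (- c 0) := by
          simp only [Fin.tail]
          rw [mul_comm, ← smul_eq_C_mul, neg_smul]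
          abel
        exact mem_sup_span_singleton.2 ⟨_, hc, _, this⟩)
    have h0 : ∀ i : Fin m, c i.succ = 0 := fun i => congrFun htail i
    simp only [h0, zero_smul, Finset.sum_const_zero, add_zero] at hc
    have hc0 : c 0 = 0 := by
      by_contra hne
      refine h1 (Ideal.mem_sup_left (hb.1 1 ?_))
      have : b 0 * 1 = C (c 0)⁻¹ * (c 0 • b 0) := by
        rw [smul_eq_C_mul, ← mul_assoc, ← C_mul, inv_mul_cancel₀ hne, C_1, one_mul, mul_one]
      rw [this]
      exact Ideal.mul_mem_left _ _ hc
    funext i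
    refine Fin.cases hc0 (fun j => h0 j) i

end RegularChains

/-! ### Lifting bases along a regular sequence. -/

section BasesModulo

open MvPolynomial

variable {σ k : Type*} [Field k]

/-- The family `e` maps to a basis of the quotient by `I`. -/
def BasisMod (I : Ideal (MvPolynomial σ k)) {J : Type*} (e : J → MvPolynomial σ k) : Prop :=
  (∀ c : J →₀ k, Finsupp.linearCombination k e c ∈ I → c = 0) ∧
    ∀ f, ∃ c : J →₀ k, f - Finsupp.linearCombination k e c ∈ I

theorem BasisMod.reindex {I : Ideal (MvPolynomial σ k)} {J J' : Type*}
    {e : J → MvPolynomial σ k} (h : BasisMod I e) (φ : J' ≃ J) : BasisMod I (e ∘ φ) := by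
  have key : ∀ c : J' →₀ k, Finsupp.linearCombination k (e ∘ φ) c =
      Finsupp.linearCombination k e (Finsupp.domLCongr (R := k) φ c) := by
    intro c
    simp [Finsupp.domLCongr_apply, Finsupp.linearCombination_equivMapDomain]
  constructor
  · intro c hc
    rw [key] at hc
    exact (Finsupp.domLCongr (R := k) φ).map_eq_zero_iff.1 (h.1 _ hc)
  · intro f
    obtain ⟨c, hc⟩ := h.2 f
    refine ⟨(Finsupp.domLCongr (R := k) φ).symm c, ?_⟩
    rw [key, LinearEquiv.apply_symm_apply]
    exact hc

theorem homogeneousComponent_linearCombination_mem {J : Type*} {e : J → MvPolynomial σ k}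
    (he : ∀ j, ∃ D, (e j).IsHomogeneous D) (M : Submodule k (MvPolynomial σ k))
    (hM : ∀ j, e j ∈ M) (c : J →₀ k) (n : ℕ) :
    homogeneousComponent n (Finsupp.linearCombination k e c) ∈ M := by
  rw [Finsupp.linearCombination_apply, Finsupp.sum, map_sum]
  refine Submodule.sum_mem _ fun j _ => ?_
  rw [map_smul]
  refine Submodule.smul_mem _ _ ?_
  obtain ⟨D, hD⟩ := he j
  rw [homogeneousComponent_of_mem (m := n) hD]
  split_ifs
  · exact hM j
  · exact zero_mem _

/-- Independence: reduce a relation modulo `b` to kill its terms free of `b`, cancel one factor `b`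
by regularity, and repeat. Spanning: expand modulo `b`; the error is `b` times a polynomial needed
only in lower degree, because `b` has positive degree. -/
theorem BasisMod.mul_pow {I : Ideal (MvPolynomial σ k)} (hI : GradedIdeal I)
    {b : MvPolynomial σ k} {d : ℕ} (hb : b.IsHomogeneous d) (hd : 0 < d) (hreg : RegularMod I b)
    {J : Type*} {e : J → MvPolynomial σ k} (he : ∀ j, ∃ D, (e j).IsHomogeneous D)
    (h : BasisMod (I ⊔ Ideal.span {b}) e) :
    BasisMod I (fun p : J × ℕ => e p.1 * b ^ p.2) := by
  set u : J × ℕ → MvPolynomial σ k := fun p => e p.1 * b ^ p.2 with hu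
  constructor
  · have hi0 : Function.Injective (fun j : J => (j, 0)) := fun _ _ h => (Prod.ext_iff.1 h).1
    have hi1 : Function.Injective (fun p : J × ℕ => (p.1, p.2 + 1)) := fun p q h => by
      simp only [Prod.mk.injEq] at h
      exact Prod.ext h.1 (by omega)
    have hsplit : ∀ c : J × ℕ →₀ k, Finsupp.linearCombination k u c =
        Finsupp.linearCombination k e (c.comapDomain _ hi0.injOn) +
          b * Finsupp.linearCombination k u (c.comapDomain _ hi1.injOn) := by
      intro c
      induction c using Finsupp.induction_linear with
      | zero => simp
      | add f g hf hg =>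
        rw [map_add, hf, hg, Finsupp.comapDomain_add_of_injective hi0,
          Finsupp.comapDomain_add_of_injective hi1, map_add, map_add]
        ring
      | single p r =>
        obtain ⟨j, a⟩ := p
        rcases a with _ | a
        · have h1 : (Finsupp.single (j, 0) r).comapDomain (fun j : J => (j, 0)) hi0.injOn =
              Finsupp.single j r := Finsupp.comapDomain_single (fun j : J => (j, 0)) j r _
          have h2 : (Finsupp.single (j, 0) r).comapDomain (fun p : J × ℕ => (p.1, p.2 + 1))
              hi1.injOn = 0 := by
            ext p
            simp
          rw [h1, h2]
          simp [hu]
        · have h1 : (Finsupp.single (j, a + 1) r).comapDomain (fun j : J => (j, 0))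
              hi0.injOn = 0 := by
            ext p
            simp
          have h2 : (Finsupp.single (j, a + 1) r).comapDomain (fun p : J × ℕ => (p.1, p.2 + 1))
              hi1.injOn = Finsupp.single (j, a) r :=
            Finsupp.comapDomain_single (fun p : J × ℕ => (p.1, p.2 + 1)) (j, a) r _
          rw [h1, h2]
          simp only [hu, Finsupp.linearCombination_single, map_zero, zero_add, mul_smul_comm]
          congr 1
          ring
    -- Induction on a strict bound for the exponents of `b` that occur.
    have hind : ∀ m (c : J × ℕ →₀ k), (∀ p ∈ c.support, p.2 < m) →
        Finsupp.linearCombination k u c ∈ I → c = 0 := by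
      intro m
      induction m with
      | zero =>
        intro c hc _
        rw [← Finsupp.support_eq_empty, Finset.eq_empty_iff_forall_notMem]
        exact fun p hp => by simpa using hc p hp
      | succ m ih =>
        intro c hc hcI
        rw [hsplit c] at hcI
        have h0 := h.1 _ (by
          rw [mem_sup_span_singleton]
          exact ⟨_, hcI, -(Finsupp.linearCombination k u (c.comapDomain _ hi1.injOn)), by ring⟩)
        rw [h0, map_zero, zero_add] at hcI
        have h1 := ih _ (by
          intro p hp
          have := hc _ (Finsupp.mem_support_iff.2 (by simpa using hp : c (p.1, p.2 + 1) ≠ 0))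
          simpa using this) (hreg _ hcI)
        ext ⟨j, a⟩
        rcases a with _ | a
        · exact DFunLike.congr_fun h0 j
        · exact DFunLike.congr_fun h1 (j, a)
    intro c hc
    refine hind (c.support.sup Prod.snd + 1) c (fun p hp => ?_) hc
    exact Nat.lt_succ_of_le (Finset.le_sup (f := Prod.snd) hp)
  · set M : Submodule k (MvPolynomial σ k) :=
      LinearMap.range (Finsupp.linearCombination k u) ⊔ I.restrictScalars k with hM
    have huM : ∀ p, u p ∈ M := fun p =>
      Submodule.mem_sup_left ⟨Finsupp.single p 1, by simp⟩
    have hbM : ∀ f ∈ M, b * f ∈ M := by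
      intro f hf
      obtain ⟨_, ⟨c, rfl⟩, i, hi, rfl⟩ := Submodule.mem_sup.1 hf
      rw [mul_add]
      refine add_mem ?_ (Submodule.mem_sup_right (Ideal.mul_mem_left I b hi))
      rw [Finsupp.linearCombination_apply, Finsupp.sum, Finset.mul_sum]
      refine Submodule.sum_mem _ fun p _ => ?_
      rw [mul_smul_comm]
      refine Submodule.smul_mem _ _ ?_
      have : b * u p = u (p.1, p.2 + 1) := by simp only [hu]; ring
      rw [this]
      exact huM _
    have hn : ∀ n f, homogeneousComponent n f ∈ M := by
      intro n
      induction n using Nat.strong_induction_on with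
      | _ n ih =>
      intro f
      obtain ⟨c, hc⟩ := h.2 f
      obtain ⟨i, hi, g, hg⟩ := mem_sup_span_singleton.1 hc
      have hf : f = Finsupp.linearCombination k e c + i + b * g := by
        rw [add_assoc, ← hg]; ring
      rw [hf, map_add, map_add, homogeneousComponent_mul_of_isHomogeneous hb]
      refine add_mem (add_mem ?_ (Submodule.mem_sup_right (hI i hi n))) ?_
      · refine homogeneousComponent_linearCombination_mem he M (fun j => ?_) c n
        have := huM (j, 0)
        simpa [hu] using this
      · split_ifs
        · exact hbM _ (ih _ (by omega) g)
        · exact zero_mem _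
    intro f
    have hf : f ∈ M := by
      rw [← sum_homogeneousComponent f]
      exact Submodule.sum_mem _ fun i _ => hn i f
    obtain ⟨_, ⟨c, rfl⟩, i, hi, rfl⟩ := Submodule.mem_sup.1 hf
    exact ⟨c, by simpa using hi⟩

theorem BasisMod.regChain {d : ℕ} (hd : 0 < d) {m : ℕ} (I : Ideal (MvPolynomial σ k))
    (hI : GradedIdeal I) (b : Fin m → MvPolynomial σ k) (hb : ∀ i, (b i).IsHomogeneous d)
    (hreg : RegChain I b) {J : Type*} (e : J → MvPolynomial σ k)
    (he : ∀ j, ∃ D, (e j).IsHomogeneous D) (h : BasisMod (I ⊔ Ideal.span (Set.range b)) e) :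
    BasisMod I (fun p : J × (Fin m → ℕ) => e p.1 * ∏ i, b i ^ p.2 i) := by
  induction m generalizing I with
  | zero =>
    have h' : BasisMod I e := by simpa using h
    convert h'.reindex (Equiv.prodUnique J (Fin 0 → ℕ)) using 1
    ext1 p
    simp
  | succ m ih =>
    have hspan : I ⊔ Ideal.span (Set.range b) =
        I ⊔ Ideal.span {b 0} ⊔ Ideal.span (Set.range (Fin.tail b)) := by
      conv_lhs => rw [← Fin.cons_self_tail b, Fin.range_cons, Ideal.span_insert, ← sup_assoc]
    rw [hspan] at h
    have h1 := ih (I ⊔ Ideal.span {b 0}) (hI.sup_span_singleton (hb 0)) (Fin.tail b)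
      (fun i => hb i.succ) hreg.2 h
    have h2 := h1.mul_pow hI (hb 0) hd hreg.1 (by
      rintro ⟨j, α⟩
      obtain ⟨D, hD⟩ := he j
      exact ⟨_, hD.mul (IsHomogeneous.prod _ _ _ fun i _ => (hb i.succ).pow (α i))⟩)
    let φ : J × (Fin (m + 1) → ℕ) ≃ (J × (Fin m → ℕ)) × ℕ :=
      { toFun := fun p => ((p.1, Fin.tail p.2), p.2 0)
        invFun := fun q => (q.1.1, Fin.cons q.2 q.1.2)
        left_inv := fun p => by simp
        right_inv := fun q => by simp }
    convert h2.reindex φ using 1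
    ext1 p
    simp only [Function.comp_apply, φ, Equiv.coe_fn_mk, Fin.prod_univ_succ, Fin.tail]
    ring

end BasesModulo

/-! ### Perturbation of homogeneous bases by lower-order terms. -/

section Filtration

open MvPolynomial

variable {σ k : Type*} [Field k]

/-- Polynomials of degree less than `m`. -/
noncomputable def degreeBelow (σ k : Type*) [Field k] (m : ℕ) : Submodule k (MvPolynomial σ k) :=
  ⨅ n ≥ m, LinearMap.ker (homogeneousComponent n)

theorem mem_degreeBelow {m : ℕ} {f : MvPolynomial σ k} :
    f ∈ degreeBelow σ k m ↔ ∀ n ≥ m, homogeneousComponent n f = 0 := by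
  simp [degreeBelow]

theorem degreeBelow_mono {m n : ℕ} (h : m ≤ n) : degreeBelow σ k m ≤ degreeBelow σ k n := by
  intro f hf
  rw [mem_degreeBelow] at hf ⊢
  exact fun i hi => hf i (h.trans hi)

theorem mem_degreeBelow_totalDegree (f : MvPolynomial σ k) :
    f ∈ degreeBelow σ k (f.totalDegree + 1) :=
  mem_degreeBelow.2 fun _ hn => homogeneousComponent_eq_zero _ _ hn

theorem MvPolynomial.IsHomogeneous.mem_degreeBelow {f : MvPolynomial σ k} {e m : ℕ}
    (hf : f.IsHomogeneous e) (h : e < m) : f ∈ degreeBelow σ k m :=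
  _root_.mem_degreeBelow.2 fun n hn => by
    rw [homogeneousComponent_of_mem (m := n) hf, if_neg (by omega)]

/-- A perturbation of a homogeneous basis by terms of lower degree is a basis. -/
theorem exists_basis_of_sub_mem_degreeBelow {ι : Type*}
    (u : Module.Basis ι k (MvPolynomial σ k)) (D : ι → ℕ) (hu : ∀ i, (u i).IsHomogeneous (D i))
    (v : ι → MvPolynomial σ k) (hv : ∀ i, u i - v i ∈ degreeBelow σ k (D i)) :
    ∃ B : Module.Basis ι k (MvPolynomial σ k), ∀ i, B i = v i := by
  -- The map `1 - ν` sends `u i` to `v i`. As `ν` lowers degrees it is locally nilpotent, so `1 - ν`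
  -- is invertible by a geometric series that is finite on each polynomial.
  let ν : MvPolynomial σ k →ₗ[k] MvPolynomial σ k := u.constr k (fun i => u i - v i)
  have h1 : ∀ m f, ν (homogeneousComponent m f) ∈ degreeBelow σ k m := by
    intro m f
    rw [← u.linearCombination_repr f, Finsupp.linearCombination_apply, Finsupp.sum, map_sum,
      map_sum]
    refine Submodule.sum_mem _ fun i _ => ?_
    rw [map_smul, map_smul]
    refine Submodule.smul_mem _ _ ?_
    rw [homogeneousComponent_of_mem (m := m) (hu i)]
    split_ifs with h
    · rw [h, u.constr_basis]
      exact hv i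
    · rw [map_zero]
      exact zero_mem _
  have h2 : ∀ m, ∀ f ∈ degreeBelow σ k (m + 1), ν f ∈ degreeBelow σ k m := by
    intro m f hf
    rw [mem_degreeBelow] at hf
    rw [← sum_homogeneousComponent f, map_sum]
    refine Submodule.sum_mem _ fun i _ => ?_
    by_cases hi : i ≤ m
    · exact degreeBelow_mono hi (h1 i f)
    · rw [hf i (by omega), map_zero]
      exact zero_mem _
  have h3 : ∀ m, ∀ f ∈ degreeBelow σ k m, (ν ^ m) f = 0 := by
    intro m
    induction m with
    | zero =>
      intro f hf
      rw [mem_degreeBelow] at hf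
      rw [pow_zero, Module.End.one_apply, ← sum_homogeneousComponent f]
      exact Finset.sum_eq_zero fun i _ => hf i (Nat.zero_le i)
    | succ m ih =>
      intro f hf
      rw [pow_succ, Module.End.mul_apply]
      exact ih _ (h2 m f hf)
  have hinj : Function.Injective (1 - ν : Module.End k (MvPolynomial σ k)) := by
    rw [← LinearMap.ker_eq_bot, LinearMap.ker_eq_bot']
    intro f hf
    have hf' : ν f = f := by
      rw [LinearMap.sub_apply, Module.End.one_apply, sub_eq_zero] at hf
      exact hf.symm
    have hpow : ∀ m, (ν ^ m) f = f := by
      intro m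
      induction m with
      | zero => rfl
      | succ m ih => rw [pow_succ, Module.End.mul_apply, hf', ih]
    rw [← hpow (f.totalDegree + 1)]
    exact h3 _ f (mem_degreeBelow_totalDegree f)
  have hsurj : Function.Surjective (1 - ν : Module.End k (MvPolynomial σ k)) := by
    intro f
    refine ⟨(∑ i ∈ Finset.range (f.totalDegree + 1), ν ^ i) f, ?_⟩
    rw [← Module.End.mul_apply, mul_neg_geom_sum, LinearMap.sub_apply,
      h3 _ f (mem_degreeBelow_totalDegree f), sub_zero, Module.End.one_apply]
  refine ⟨u.map (LinearEquiv.ofBijective (1 - ν : Module.End k (MvPolynomial σ k)) ⟨hinj, hsurj⟩), fun i => ?_⟩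
  rw [Module.Basis.map_apply]
  change (1 - ν : Module.End k (MvPolynomial σ k)) (u i) = v i
  rw [LinearMap.sub_apply, Module.End.one_apply, u.constr_basis, sub_sub_cancel]

end Filtration

/-! ### Freeness over a homogeneous system of parameters. -/

section Freeness

open MvPolynomial

variable {N : ℕ} {k : Type*} [Field k]

/-- The map `F ↦ ∑ j, e_j F_j(b)`. -/
noncomputable def combine {J : Type*} [Fintype J] {R : Type*} [CommRing R] [Algebra k R]
    (e : J → R) (b : Fin N → R) : (J → MvPolynomial (Fin N) k) →ₗ[k] R :=
  ∑ j, (LinearMap.mulLeft k (e j)) ∘ₗ (aeval b).toLinearMap ∘ₗ LinearMap.proj j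

theorem combine_apply {J : Type*} [Fintype J] {R : Type*} [CommRing R] [Algebra k R]
    (e : J → R) (b : Fin N → R) (F : J → MvPolynomial (Fin N) k) :
    combine e b F = ∑ j, e j * aeval b (F j) := by
  simp [combine]

/-- The basis of tuples of polynomials given by the monomials in one entry. -/
noncomputable def tupleBasis (J : Type*) [Fintype J] (N : ℕ) (k : Type*) [Field k] :
    Module.Basis (J × (Fin N →₀ ℕ)) k (J → MvPolynomial (Fin N) k) :=
  (Pi.basis fun _ : J => basisMonomials (Fin N) k).reindex (Equiv.sigmaEquivProd J _)

theorem combine_tupleBasis {J : Type*} [Fintype J] {R : Type*} [CommRing R] [Algebra k R]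
    (e : J → R) (b : Fin N → R) (p : J × (Fin N →₀ ℕ)) :
    combine e b (tupleBasis J N k p) = e p.1 * ∏ i, b i ^ p.2 i := by
  classical
  obtain ⟨j, α⟩ := p
  rw [combine_apply, Finset.sum_eq_single j]
  · simp [tupleBasis, Pi.basis_apply, aeval_monomial, Finsupp.prod_fintype]
  · intro i _ hi
    simp [tupleBasis, Pi.basis_apply, Pi.single_eq_of_ne hi]
  · simp

theorem combine_bijective_of_basisMod {J : Type*} [Fintype J]
    (e b : _ → MvPolynomial (Fin N) k) (h : BasisMod ⊥ (fun p : J × (Fin N → ℕ) =>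
      e p.1 * ∏ i, b i ^ p.2 i)) : Function.Bijective (combine (k := k) e b) := by
  have h' := h.reindex ((Equiv.refl J).prodCongr Finsupp.equivFunOnFinite :
    J × (Fin N →₀ ℕ) ≃ J × (Fin N → ℕ))
  have key : ∀ c, combine e b ((tupleBasis J N k).repr.symm c) =
      Finsupp.linearCombination k ((fun p : J × (Fin N → ℕ) => e p.1 * ∏ i, b i ^ p.2 i) ∘
        ((Equiv.refl J).prodCongr Finsupp.equivFunOnFinite :
          J × (Fin N →₀ ℕ) ≃ J × (Fin N → ℕ))) c := by
    intro c
    rw [Module.Basis.repr_symm_apply, Finsupp.apply_linearCombination]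
    congr 2
    ext1 p
    exact combine_tupleBasis e b p
  constructor
  · rw [← LinearMap.ker_eq_bot, LinearMap.ker_eq_bot']
    intro F hF
    rw [← (tupleBasis J N k).repr.symm_apply_apply F, key] at hF
    have := h'.1 _ (Ideal.mem_bot.2 hF)
    exact (LinearEquiv.map_eq_zero_iff _).1 this
  · intro f
    obtain ⟨c, hc⟩ := h'.2 f
    refine ⟨(tupleBasis J N k).repr.symm c, ?_⟩
    rw [key]
    exact (sub_eq_zero.1 (Ideal.mem_bot.1 hc)).symm

/-- The mutually inverse matrices relating `b` and `η` give an invertible linear substitution in the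
coefficient polynomials, and composition with it turns one combination map into the other. -/
theorem combine_bijective_of_linear {J : Type*} [Fintype J]
    (e : J → MvPolynomial (Fin N) k) (b η : Fin N → MvPolynomial (Fin N) k)
    (hb : LinearIndependent k b) (hbη : ∀ i, b i ∈ Submodule.span k (Set.range η))
    (hηb : ∀ i, η i ∈ Submodule.span k (Set.range b))
    (h : Function.Bijective (combine (k := k) e b)) :
    Function.Bijective (combine (k := k) e η) := by
  simp only [Submodule.mem_span_range_iff_exists_fun] at hbη hηb
  choose t ht using hbη
  choose c hc using hηb
  let T : Matrix (Fin N) (Fin N) k := t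
  let U : Matrix (Fin N) (Fin N) k := c
  have hTU : T * U = 1 := by
    ext i m
    have h1 : ∑ m, (T * U) i m • b m = ∑ m, (1 : Matrix (Fin N) (Fin N) k) i m • b m := by
      simp only [Matrix.mul_apply, Finset.sum_smul, mul_smul]
      rw [Finset.sum_comm]
      simp only [← Finset.smul_sum]
      simp [T, U, hc, ht, Matrix.one_apply]
    have h2 := Fintype.linearIndependent_iff.1 hb (fun m => (T * U) i m -
      (1 : Matrix (Fin N) (Fin N) k) i m) (by
        simp only [sub_smul, Finset.sum_sub_distrib, h1, sub_self])
    exact sub_eq_zero.1 (h2 m)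
  have hUT : U * T = 1 := mul_eq_one_comm.1 hTU
  let φ : Matrix (Fin N) (Fin N) k → MvPolynomial (Fin N) k →ₐ[k] MvPolynomial (Fin N) k :=
    fun M => aeval fun i => ∑ m, M i m • X m
  have hφ : ∀ M M', (φ M').comp (φ M) = φ (M * M') := by
    intro M M'
    refine algHom_ext fun i => ?_
    simp only [φ, AlgHom.comp_apply, aeval_X, map_sum, map_smul, Matrix.mul_apply,
      Finset.sum_smul, Finset.smul_sum, mul_smul]
    exact Finset.sum_comm
  have hφ1 : φ 1 = AlgHom.id k _ := by
    refine algHom_ext fun i => ?_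
    simp [φ, Matrix.one_apply]
  have hbij : Function.Bijective (φ U) := by
    refine Function.bijective_iff_has_inverse.2 ⟨φ T, fun p => ?_, fun p => ?_⟩
    · rw [← AlgHom.comp_apply, hφ, hUT, hφ1, AlgHom.id_apply]
    · rw [← AlgHom.comp_apply, hφ, hTU, hφ1, AlgHom.id_apply]
  have hcomb : ∀ F, combine e η F = combine e b (fun j => φ U (F j)) := by
    intro F
    rw [combine_apply, combine_apply]
    refine Finset.sum_congr rfl fun j _ => ?_
    rw [← AlgHom.comp_apply]
    congr 2
    refine algHom_ext fun i => ?_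
    simp [φ, U, hc]
  have : (combine (k := k) e η : _ → _) = combine (k := k) e b ∘ (Pi.map fun _ => φ U) :=
    funext hcomb
  rw [this]
  exact h.comp (Function.Bijective.piMap fun _ => hbij)

/-- The powers of a variable are linearly dependent in a finite-dimensional quotient, and a graded
ideal contains every term of such a relation separately. -/
theorem exists_X_pow_mem {I : Ideal (MvPolynomial (Fin N) k)} (hI : GradedIdeal I)
    (hfin : Module.Finite k (MvPolynomial (Fin N) k ⧸ I)) (i : Fin N) :
    ∃ M, (X i ^ M : MvPolynomial (Fin N) k) ∈ I := by
  have hdep : ¬ LinearIndependent k (fun m : ℕ => Ideal.Quotient.mk I (X i ^ m)) := fun h => by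
    have := h.finite
    exact not_finite ℕ
  rw [not_linearIndependent_iff] at hdep
  obtain ⟨s, c, hs, m, hm, hc⟩ := hdep
  refine ⟨m, ?_⟩
  have hmem : ∑ a ∈ s, c a • (X i ^ a : MvPolynomial (Fin N) k) ∈ I := by
    rw [← Ideal.Quotient.eq_zero_iff_mem, map_sum, ← hs]
    rfl
  have h1 := hI _ hmem m
  rw [map_sum, Finset.sum_eq_single_of_mem m hm] at h1
  · rw [map_smul, homogeneousComponent_of_mem (m := m) (isHomogeneous_X_pow i m), if_pos rfl] at h1
    have : (X i ^ m : MvPolynomial (Fin N) k) = C (c m)⁻¹ * (c m • X i ^ m) := by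
      rw [smul_eq_C_mul, ← mul_assoc, ← C_mul, inv_mul_cancel₀ hc, C_1, one_mul]
    rw [this]
    exact Ideal.mul_mem_left _ _ h1
  · intro a _ ha
    rw [map_smul, homogeneousComponent_of_mem (m := m) (isHomogeneous_X_pow i a), if_neg ha.symm,
      smul_zero]

theorem GradedIdeal.span {S : Set (MvPolynomial (Fin N) k)} {d : ℕ}
    (hS : ∀ x ∈ S, x.IsHomogeneous d) : GradedIdeal (Ideal.span S) := by
  intro p hp n
  induction hp using Submodule.span_induction generalizing n with
  | mem x hx =>
    rw [homogeneousComponent_of_mem (m := n) (hS x hx)]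
    split_ifs
    · exact Ideal.subset_span hx
    · exact zero_mem _
  | zero => simp
  | add x y _ _ hx hy => rw [map_add]; exact add_mem (hx n) (hy n)
  | smul a x _ ih =>
    rw [smul_eq_mul, ← sum_homogeneousComponent a, Finset.sum_mul, map_sum]
    refine Submodule.sum_mem _ fun i _ => ?_
    rw [homogeneousComponent_mul_of_isHomogeneous (homogeneousComponent_isHomogeneous i a)]
    split_ifs
    · exact Ideal.mul_mem_left _ _ (ih _)
    · exact zero_mem _

/-- A polynomial ring is free over the subalgebra generated by a homogeneous system of parameters,
with a basis consisting of monomials. -/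
theorem exists_monomials_combine_bijective [Infinite k] {d : ℕ} (hd : 0 < d)
    (η : Fin N → MvPolynomial (Fin N) k) (hη : ∀ i, (η i).IsHomogeneous d)
    (hfin : Module.Finite k (MvPolynomial (Fin N) k ⧸ Ideal.span (Set.range η))) :
    ∃ (J : Type) (_ : Fintype J) (β : J → (Fin N →₀ ℕ)),
      Function.Bijective (combine (k := k) (fun j => (monomial (β j) (1 : k))) η) := by
  classical
  set W := Submodule.span k (Set.range η) with hW
  have hWhom : ∀ x ∈ W, x.IsHomogeneous d := by
    intro x hx
    have : W ≤ homogeneousSubmodule (Fin N) k d := by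
      rw [hW, Submodule.span_le]
      rintro _ ⟨i, rfl⟩
      exact hη i
    exact this hx
  have hspanW : Ideal.span (W : Set (MvPolynomial (Fin N) k)) = Ideal.span (Set.range η) := by
    refine le_antisymm (Ideal.span_le.2 ?_) (Ideal.span_mono Submodule.subset_span)
    intro x hx
    have : W ≤ (Ideal.span (Set.range η)).restrictScalars k :=
      Submodule.span_le.2 Ideal.subset_span
    exact this hx
  have hgr : GradedIdeal (Ideal.span (Set.range η)) := GradedIdeal.span (d := d) (by
    rintro _ ⟨i, rfl⟩
    exact hη i)
  choose M hM using exists_X_pow_mem hgr hfin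
  -- One exponent that serves all variables; the extra `1` keeps it positive even if all `M i`
  -- vanish.
  let M0 := ∑ i, M i + 1
  -- The regular sequence of powers of the variables lies in `(η)`, so it can be exchanged for one
  -- inside the linear span of `η`. This takes the place of a Cohen–Macaulay argument.
  obtain ⟨b, hbW, hbreg⟩ := exists_regChain_mem W d hWhom ⊥ GradedIdeal.bot
    (fun i : Fin N => (X i ^ M0 : MvPolynomial (Fin N) k)) (fun _ => M0)
    (fun i => isHomogeneous_X_pow i M0) (fun _ => Nat.succ_pos _)
    (by
      have := regChain_X_pow (σ := Fin N) (k := k) M0 id Function.injective_id ∅ (by simp)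
      simpa using this)
    (by
      intro i
      rw [bot_sup_eq, hspanW]
      have hle : M i ≤ M0 := (Finset.single_le_sum (fun _ _ => Nat.zero_le _)
        (Finset.mem_univ i)).trans (Nat.le_succ _)
      exact Ideal.pow_mem_of_pow_mem _ (hM i) hle)
  have hbind : LinearIndependent k b := by
    rw [Fintype.linearIndependent_iff]
    intro c hc i
    have h1 : (1 : MvPolynomial (Fin N) k) ∉
        (⊥ : Ideal (MvPolynomial (Fin N) k)) ⊔ Ideal.span (Set.range b) := by
      rw [bot_sup_eq]
      intro h1
      have hle : Ideal.span (Set.range b) ≤ RingHom.ker (constantCoeff (σ := Fin N) (R := k)) := by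
        refine Ideal.span_le.2 ?_
        rintro _ ⟨i, rfl⟩
        have := (hWhom _ (hbW i)).coeff_eq_zero (d := 0) (by simpa using hd.ne)
        exact this
      have := hle h1
      rw [RingHom.mem_ker, map_one] at this
      exact one_ne_zero this
    exact congrFun (hbreg.eq_zero_of_sum_mem ⊥ b h1 c (Ideal.mem_bot.2 hc)) i
  have hspanb : Submodule.span k (Set.range b) = W := by
    have hle : Submodule.span k (Set.range b) ≤ W := by
      refine Submodule.span_le.2 ?_
      rintro _ ⟨i, rfl⟩
      exact hbW i
    have : FiniteDimensional k W := FiniteDimensional.span_of_finite k (Set.finite_range η)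
    -- There are `N` independent vectors `b i` in a space spanned by the `N` vectors `η i`.
    refine Submodule.eq_of_le_of_finrank_le hle ?_
    rw [finrank_span_eq_card hbind]
    exact (finrank_range_le_card η)
  have hspanI : Ideal.span (Set.range b) = Ideal.span (Set.range η) := by
    rw [← hspanW, ← hspanb]
    refine le_antisymm (Ideal.span_mono Submodule.subset_span) (Ideal.span_le.2 ?_)
    intro x hx
    have : Submodule.span k (Set.range b) ≤ (Ideal.span (Set.range b)).restrictScalars k :=
      Submodule.span_le.2 Ideal.subset_span
    exact this hx
  set I := Ideal.span (Set.range η) with hIdef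
  -- The basis of the quotient is extracted from the monomials, so that diagonal substitutions act
  -- diagonally on it.
  obtain ⟨J0, β0, hβ0, hspan, hind⟩ := exists_linearIndependent' k
    (fun α : Fin N →₀ ℕ => Ideal.Quotient.mk I (monomial α (1 : k)))
  have hJ0 : Finite J0 := hind.finite
  have := Fintype.ofFinite J0
  let ε : Fin (Fintype.card J0) ≃ J0 := (Fintype.equivFin J0).symm
  refine ⟨Fin (Fintype.card J0), inferInstance, β0 ∘ ε, ?_⟩
  have hmap : ∀ c : J0 →₀ k, Ideal.Quotient.mk I
      (Finsupp.linearCombination k (fun j => monomial (β0 j) (1 : k)) c) =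
      Finsupp.linearCombination k
        ((fun α : Fin N →₀ ℕ => Ideal.Quotient.mk I (monomial α (1 : k))) ∘ β0) c := fun c =>
    Finsupp.apply_linearCombination k (Ideal.Quotient.mkₐ k I).toLinearMap _ c
  have hbasis : BasisMod I (fun j : J0 => monomial (β0 j) (1 : k)) := by
    constructor
    · intro c hc
      rw [← Ideal.Quotient.eq_zero_iff_mem, hmap] at hc
      exact linearIndependent_iff.1 hind c hc
    · intro f
      have hf : Ideal.Quotient.mk I f ∈ Submodule.span k (Set.range
          ((fun α : Fin N →₀ ℕ => Ideal.Quotient.mk I (monomial α (1 : k))) ∘ β0)) := by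
        rw [hspan]
        induction f using MvPolynomial.induction_on' with
        | monomial α a =>
          have : monomial α a = a • monomial α (1 : k) := by
            rw [smul_monomial, smul_eq_mul, mul_one]
          rw [this]
          change a • Ideal.Quotient.mk I (monomial α 1) ∈ _
          refine Submodule.smul_mem _ a (Submodule.subset_span ?_)
          exact ⟨α, rfl⟩
        | add p q hp hq => rw [map_add]; exact add_mem hp hq
      rw [Finsupp.mem_span_range_iff_exists_finsupp] at hf
      obtain ⟨c, hc⟩ := hf
      refine ⟨c, ?_⟩
      rw [← Ideal.Quotient.eq_zero_iff_mem, map_sub, hmap, sub_eq_zero, ← hc]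
      rfl
  have hb2 := (hbasis.reindex ε)
  have hb3 := BasisMod.regChain hd ⊥ GradedIdeal.bot b (fun i => hWhom _ (hbW i)) hbreg
    ((fun j : J0 => monomial (β0 j) (1 : k)) ∘ ε) (by
      intro j
      exact ⟨_, isHomogeneous_monomial _ rfl⟩)
    (by rwa [bot_sup_eq, hspanI])
  have hb4 := combine_bijective_of_basisMod _ _ hb3
  refine combine_bijective_of_linear _ b η hbind (fun i => hbW i) (fun i => ?_) hb4
  rw [hspanb]
  exact Submodule.subset_span (Set.mem_range_self i)

end Freeness

/-! ### Graded traces of diagonal substitutions. -/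

section GradedTrace

open MvPolynomial

variable {N : ℕ} {k : Type*} [Field k]

theorem trace_eq_sum_of_basis {V ι : Type*} [AddCommGroup V] [Module k V] [Fintype ι]
    (b : Module.Basis ι k V) (f : V →ₗ[k] V) (c : ι → k) (h : ∀ i, f (b i) = c i • b i) :
    LinearMap.trace k V f = ∑ i, c i := by
  classical
  rw [LinearMap.trace_eq_matrix_trace k b, Matrix.trace]
  refine Finset.sum_congr rfl fun i _ => ?_
  rw [Matrix.diag_apply, LinearMap.toMatrix_apply, h, map_smul, b.repr_self]
  simp

/-- The scaling `X_i ↦ μ_i X_i`. -/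
noncomputable def scaleVars (μ : Fin N → k) :
    MvPolynomial (Fin N) k →ₐ[k] MvPolynomial (Fin N) k :=
  aeval fun i => μ i • X i

theorem scaleVars_monomial (μ : Fin N → k) (α : Fin N →₀ ℕ) :
    scaleVars μ (monomial α 1) = (∏ i, μ i ^ α i) • monomial α 1 := by
  rw [scaleVars, aeval_monomial, map_one, one_mul, Finsupp.prod_fintype _ _ (by simp)]
  simp only [smul_pow]
  rw [Finset.prod_smul, monomial_eq, C_1, one_mul, Finsupp.prod_fintype _ _ (by simp)]

theorem scaleVars_isHomogeneous (μ : Fin N → k) {f : MvPolynomial (Fin N) k} {n : ℕ}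
    (hf : f.IsHomogeneous n) : (scaleVars μ f).IsHomogeneous n := by
  have := hf.aeval (fun i => μ i • X i) (n := 1) (fun i => by
    rw [smul_eq_C_mul]
    exact isHomogeneous_C_mul_X _ _)
  simpa [scaleVars] using this

/-- The scaling on homogeneous polynomials of degree `n`. -/
noncomputable def scaleHom (μ : Fin N → k) (n : ℕ) :
    homogeneousSubmodule (Fin N) k n →ₗ[k] homogeneousSubmodule (Fin N) k n :=
  (scaleVars μ).toLinearMap.restrict fun _ hf => scaleVars_isHomogeneous μ hf

/-- The basis is left arbitrary because the same trace is evaluated twice: on the monomials, and on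
the products of module generators with monomials in the parameters. -/
theorem trace_scaleHom {ι : Type*} (u : Module.Basis ι k (MvPolynomial (Fin N) k)) (D : ι → ℕ)
    (hu : ∀ i, (u i).IsHomogeneous (D i)) (μ : Fin N → k) (c : ι → k)
    (hc : ∀ i, scaleVars μ (u i) = c i • u i) (n : ℕ) (S : Finset ι) (hS : ∀ i, i ∈ S ↔ D i = n) :
    LinearMap.trace k _ (scaleHom μ n) = ∑ i ∈ S, c i := by
  let w : S → homogeneousSubmodule (Fin N) k n := fun i =>
    ⟨u i, by rw [mem_homogeneousSubmodule, ← (hS i).1 i.2]; exact hu i⟩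
  have hw : LinearIndependent k w := by
    refine LinearIndependent.of_comp (homogeneousSubmodule (Fin N) k n).subtype ?_
    exact u.linearIndependent.comp (fun i : S => (i : ι)) Subtype.val_injective
  have hcomp : ∀ f : MvPolynomial (Fin N) k, homogeneousComponent n f ∈
      Submodule.span k (Set.range fun i : S => u i) := by
    intro f
    rw [← u.linearCombination_repr f]
    rw [Finsupp.linearCombination_apply, Finsupp.sum, map_sum]
    refine Submodule.sum_mem _ fun i _ => ?_
    rw [map_smul, homogeneousComponent_of_mem (m := n) (hu i)]
    refine Submodule.smul_mem _ _ ?_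
    split_ifs with h
    · exact Submodule.subset_span ⟨⟨i, (hS i).2 h.symm⟩, rfl⟩
    · exact zero_mem _
  have hspan : ⊤ ≤ Submodule.span k (Set.range w) := by
    rintro ⟨f, hf⟩ -
    have h1 := hcomp f
    rw [homogeneousComponent_of_mem (m := n) hf, if_pos rfl] at h1
    have h2 : (fun i : S => u i) = (homogeneousSubmodule (Fin N) k n).subtype ∘ w := rfl
    rw [h2, Set.range_comp, ← Submodule.map_span] at h1
    obtain ⟨x, hx, hxf⟩ := h1
    have : x = ⟨f, hf⟩ := Subtype.ext hxf
    rwa [← this]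
  rw [trace_eq_sum_of_basis (Module.Basis.mk hw hspan) (scaleHom μ n) (fun i : S => c i)]
  · exact Finset.sum_coe_sort S c
  · intro i
    rw [Module.Basis.mk_apply]
    exact Subtype.ext (hc i)

/-- The generating function `∏ 1 / (1 - μ_i q)`. -/
noncomputable def completeSeries (μ : Fin N → k) : PowerSeries k :=
  ∏ i, PowerSeries.mk fun m => μ i ^ m

theorem coeff_completeSeries (μ : Fin N → k) (n : ℕ) :
    PowerSeries.coeff n (completeSeries μ) =
      ∑ α ∈ Finset.finsuppAntidiag Finset.univ n, ∏ i, μ i ^ α i := by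
  rw [completeSeries, PowerSeries.coeff_prod]
  simp

theorem mem_finsuppAntidiag_univ {α : Fin N →₀ ℕ} {n : ℕ} :
    α ∈ Finset.finsuppAntidiag Finset.univ n ↔ α.degree = n := by
  rw [Finset.mem_finsuppAntidiag]
  simp [Finsupp.degree_eq_sum]

theorem completeSeries_mul (μ : Fin N → k) :
    completeSeries μ * ∏ i, (1 - PowerSeries.C (μ i) * PowerSeries.X) = 1 := by
  rw [completeSeries, ← Finset.prod_mul_distrib]
  refine Finset.prod_eq_one fun i _ => ?_
  ext n
  rw [mul_sub, mul_one, map_sub, mul_left_comm, PowerSeries.coeff_C_mul]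
  rcases n with _ | n
  · simp
  · rw [PowerSeries.coeff_succ_mul_X]
    simp [pow_succ, mul_comm, PowerSeries.coeff_one]

/-- The hypothesis says that `∑ c_j q^(D_j)` equals `∏ (1 - μ_i q^d) / (1 - μ_i q)`. At `q = 1` a
factor with `μ_i = 1` is the geometric sum with value `d`, and every other factor has value `1`. -/
theorem sum_eq_pow_card_of_completeSeries {J : Type*} [Fintype J] (μ : Fin N → k) (D : J → ℕ)
    (c : J → k) {d : ℕ} (hd : d ≠ 0)
    (h : (∑ j, PowerSeries.C (c j) * PowerSeries.X ^ D j) *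
      PowerSeries.expand d hd (completeSeries μ) = completeSeries μ) :
    ∑ j, c j = (d : k) ^ Nat.card {i // μ i = 1} := by
  classical
  have h1 : (∑ j, PowerSeries.C (c j) * PowerSeries.X ^ D j) *
      ∏ i, (1 - PowerSeries.C (μ i) * PowerSeries.X) =
      ∏ i, (1 - PowerSeries.C (μ i) * PowerSeries.X ^ d) := by
    have h2 : PowerSeries.expand d hd (completeSeries μ) *
        ∏ i, (1 - PowerSeries.C (μ i) * PowerSeries.X ^ d) = 1 := by
      have := congrArg (PowerSeries.expand d hd) (completeSeries_mul μ)
      rw [map_mul, map_prod, map_one] at this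
      simpa [PowerSeries.expand_C, PowerSeries.expand_X] using this
    have h3 := completeSeries_mul μ
    rw [← h] at h3
    calc _ = (∑ j, PowerSeries.C (c j) * PowerSeries.X ^ D j) *
          (∏ i, (1 - PowerSeries.C (μ i) * PowerSeries.X)) *
          (PowerSeries.expand d hd (completeSeries μ) *
        ∏ i, (1 - PowerSeries.C (μ i) * PowerSeries.X ^ d)) := by rw [h2, mul_one]
      _ = ((∑ j, PowerSeries.C (c j) * PowerSeries.X ^ D j) *
      PowerSeries.expand d hd (completeSeries μ) * ∏ i, (1 - PowerSeries.C (μ i) * PowerSeries.X))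
          * ∏ i, (1 - PowerSeries.C (μ i) * PowerSeries.X ^ d) := by ring
      _ = _ := by rw [h3, one_mul]
  have h2 : (∑ j, Polynomial.C (c j) * Polynomial.X ^ D j) *
      ∏ i, (1 - Polynomial.C (μ i) * Polynomial.X) =
      ∏ i, (1 - Polynomial.C (μ i) * Polynomial.X ^ d) := by
    apply Polynomial.coe_injective
    have hsum : ∀ f : J → Polynomial k, ((∑ j, f j : Polynomial k) : PowerSeries k) =
        ∑ j, (f j : PowerSeries k) := fun f => map_sum Polynomial.coeToPowerSeries.ringHom f _
    have hprod : ∀ f : Fin N → Polynomial k, ((∏ j, f j : Polynomial k) : PowerSeries k) =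
        ∏ j, (f j : PowerSeries k) := fun f => by
      rw [← Polynomial.coeToPowerSeries.ringHom_apply, map_prod]
      simp only [Polynomial.coeToPowerSeries.ringHom_apply]
    have hsub : ∀ f g : Polynomial k, ((f - g : Polynomial k) : PowerSeries k) = f - g :=
      fun f g => map_sub Polynomial.coeToPowerSeries.ringHom f g
    simpa [hsum, hprod, hsub] using h1
  -- For `μ i = 1` both the numerator and the denominator vanish at `1`; their common factor `z i =
  -- 1 - X` is cancelled before evaluation.
  let g : Fin N → Polynomial k := fun i =>
    if μ i = 1 then ∑ m ∈ Finset.range d, Polynomial.X ^ m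
    else 1 - Polynomial.C (μ i) * Polynomial.X ^ d
  let g' : Fin N → Polynomial k := fun i =>
    if μ i = 1 then 1 else 1 - Polynomial.C (μ i) * Polynomial.X
  let z : Fin N → Polynomial k := fun i => if μ i = 1 then 1 - Polynomial.X else 1
  have hg : ∀ i, 1 - Polynomial.C (μ i) * Polynomial.X ^ d = z i * g i := by
    intro i
    by_cases hi : μ i = 1
    · simp [z, g, hi, mul_neg_geom_sum]
    · simp [z, g, hi]
  have hg' : ∀ i, 1 - Polynomial.C (μ i) * Polynomial.X = z i * g' i := by
    intro i
    by_cases hi : μ i = 1 <;> simp [z, g', hi]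
  simp only [hg, hg', Finset.prod_mul_distrib] at h2
  have hz : ∏ i, z i ≠ 0 := by
    refine Finset.prod_ne_zero_iff.2 fun i _ => ?_
    by_cases hi : μ i = 1
    · simp only [z, hi, if_true]
      intro h0
      have := congrArg (Polynomial.eval 0) h0
      simp at this
    · simp [z, hi]
  have h3 : (∑ j, Polynomial.C (c j) * Polynomial.X ^ D j) * ∏ i, g' i = ∏ i, g i := by
    refine mul_left_cancel₀ hz ?_
    rw [← h2]
    ring
  have h4 := congrArg (Polynomial.eval 1) h3
  rw [Polynomial.eval_mul, Polynomial.eval_prod, Polynomial.eval_prod] at h4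
  have h5 : ∀ i, (g i).eval 1 = (if μ i = 1 then (d : k) else 1) * (g' i).eval 1 := by
    intro i
    by_cases hi : μ i = 1
    · simp [g, g', hi, Polynomial.eval_finsetSum]
    · simp [g, g', hi]
  simp only [h5, Finset.prod_mul_distrib] at h4
  have h6 : ∏ i, (g' i).eval 1 ≠ 0 := by
    refine Finset.prod_ne_zero_iff.2 fun i _ => ?_
    by_cases hi : μ i = 1
    · simp [g', hi]
    · simp only [g', hi, if_false]
      simp only [Polynomial.eval_sub, Polynomial.eval_one, Polynomial.eval_mul, Polynomial.eval_C,
        Polynomial.eval_X, mul_one]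
      exact sub_ne_zero.2 (Ne.symm hi)
  have h7 := mul_right_cancel₀ h6 h4
  rw [Finset.prod_ite, Finset.prod_const, Finset.prod_const_one, mul_one] at h7
  rw [Nat.card_eq_fintype_card, Fintype.card_subtype, ← h7]
  simp [Polynomial.eval_finsetSum]

end GradedTrace

/-! ### Trace on the quotient by the inhomogeneous ideal. -/

section QuotientTrace

open MvPolynomial

variable {N : ℕ} {k : Type*} [Field k]

theorem mem_degreeBelow_iff_support {m : ℕ} {f : MvPolynomial (Fin N) k} :
    f ∈ degreeBelow (Fin N) k m ↔ ∀ s ∈ f.support, s.degree < m := by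
  rw [mem_degreeBelow]
  constructor
  · intro h s hs
    by_contra hlt
    have := congrArg (coeff s) (h s.degree (not_lt.1 hlt))
    rw [coeff_homogeneousComponent, if_pos rfl, coeff_zero] at this
    exact mem_support_iff.1 hs this
  · intro h n hn
    ext s
    rw [coeff_homogeneousComponent, coeff_zero]
    split_ifs with hs
    · by_contra hne
      have := h s (mem_support_iff.2 hne)
      omega
    · rfl

theorem mul_mem_degreeBelow {m m' : ℕ} {f g : MvPolynomial (Fin N) k}
    (hf : f ∈ degreeBelow (Fin N) k m) (hg : g ∈ degreeBelow (Fin N) k (m' + 1)) :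
    f * g ∈ degreeBelow (Fin N) k (m + m') := by
  classical
  rw [mem_degreeBelow_iff_support] at *
  intro s hs
  obtain ⟨a, ha, b, hb, rfl⟩ := Finset.mem_add.1 (support_mul f g hs)
  have h1 := hf a ha
  have h2 := hg b hb
  rw [map_add]
  omega

/-- The form `f` is the leading form of `g`. -/
def IsLeadingForm (D : ℕ) (f g : MvPolynomial (Fin N) k) : Prop :=
  f.IsHomogeneous D ∧ f - g ∈ degreeBelow (Fin N) k D

theorem IsLeadingForm.self {D : ℕ} {f : MvPolynomial (Fin N) k} (hf : f.IsHomogeneous D) :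
    IsLeadingForm D f f := ⟨hf, by rw [sub_self]; exact zero_mem _⟩

theorem IsLeadingForm.mul {D D' : ℕ} {f f' g g' : MvPolynomial (Fin N) k}
    (h : IsLeadingForm D f g) (h' : IsLeadingForm D' f' g') :
    IsLeadingForm (D + D') (f * f') (g * g') := by
  refine ⟨h.1.mul h'.1, ?_⟩
  have hg' : g' ∈ degreeBelow (Fin N) k (D' + 1) := by
    have : g' = f' - (f' - g') := by ring
    rw [this]
    exact sub_mem (h'.1.mem_degreeBelow (Nat.lt_succ_self _))
      (degreeBelow_mono (Nat.le_succ _) h'.2)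
  have : f * f' - g * g' = (f' - g') * f + (f - g) * g' := by ring
  rw [this]
  refine add_mem ?_ (mul_mem_degreeBelow h.2 hg')
  rw [add_comm]
  exact mul_mem_degreeBelow h'.2 (h.1.mem_degreeBelow (Nat.lt_succ_self _))

theorem IsLeadingForm.pow {D : ℕ} {f g : MvPolynomial (Fin N) k} (h : IsLeadingForm D f g)
    (n : ℕ) : IsLeadingForm (D * n) (f ^ n) (g ^ n) := by
  induction n with
  | zero => simpa using IsLeadingForm.self (isHomogeneous_one (Fin N) k)
  | succ n ih => rw [pow_succ, pow_succ, Nat.mul_succ]; exact ih.mul h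

theorem IsLeadingForm.prod {ι : Type*} (s : Finset ι) {D : ι → ℕ}
    {f g : ι → MvPolynomial (Fin N) k} (h : ∀ i, IsLeadingForm (D i) (f i) (g i)) :
    IsLeadingForm (∑ i ∈ s, D i) (∏ i ∈ s, f i) (∏ i ∈ s, g i) := by
  classical
  induction s using Finset.induction_on with
  | empty => simpa using IsLeadingForm.self (isHomogeneous_one (Fin N) k)
  | insert a s ha ih =>
    rw [Finset.sum_insert ha, Finset.prod_insert ha, Finset.prod_insert ha]
    exact (h a).mul ih

/-- The trace of a diagonal substitution on `k[x_1, …, x_N] / (η_i - x_i)`, where the `η_i` form a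
homogeneous system of parameters of degree `d` on which the substitution acts as on the `x_i`. -/
theorem trace_quotient_eq [Infinite k] {d : ℕ} (hd : 2 ≤ d)
    (η : Fin N → MvPolynomial (Fin N) k) (hη : ∀ i, (η i).IsHomogeneous d)
    (hfin : Module.Finite k (MvPolynomial (Fin N) k ⧸ Ideal.span (Set.range η)))
    (μ : Fin N → k) (hμ : ∀ i, scaleVars μ (η i) = μ i • η i)
    (I : Ideal (MvPolynomial (Fin N) k)) (hI : I = Ideal.span (Set.range fun i => η i - X i))
    (T : (MvPolynomial (Fin N) k ⧸ I) →ₗ[k] (MvPolynomial (Fin N) k ⧸ I))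
    (hT : ∀ f, T (Ideal.Quotient.mk _ f) = Ideal.Quotient.mk _ (scaleVars μ f)) :
    Module.Finite k (MvPolynomial (Fin N) k ⧸ I) ∧
    LinearMap.trace k _ T = (d : k) ^ Nat.card {i // μ i = 1} := by
  classical
  have hd0 : d ≠ 0 := by omega
  obtain ⟨J, _, β, hbij⟩ := exists_monomials_combine_bijective (by omega) η hη hfin
  let e : J → MvPolynomial (Fin N) k := fun j => monomial (β j) 1
  let u : Module.Basis (J × (Fin N →₀ ℕ)) k (MvPolynomial (Fin N) k) :=
    (tupleBasis J N k).map (LinearEquiv.ofBijective _ hbij)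
  have hu : ∀ p, u p = e p.1 * ∏ i, η i ^ p.2 i := fun p => combine_tupleBasis e η p
  let D : J × (Fin N →₀ ℕ) → ℕ := fun p => (β p.1).degree + d * p.2.degree
  -- Replacing each `η i` by `η i - X i` changes only lower-order terms, so `v` is again a basis.
  -- Its members with nonzero exponent span `I`, and the remaining ones are the monomials `e j`.
  let v : J × (Fin N →₀ ℕ) → MvPolynomial (Fin N) k :=
    fun p => e p.1 * ∏ i, (η i - X i) ^ p.2 i
  have hlead : ∀ p, IsLeadingForm (D p) (u p) (v p) := by
    intro p
    rw [hu]
    refine IsLeadingForm.mul (IsLeadingForm.self (isHomogeneous_monomial _ rfl)) ?_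
    rw [Finsupp.degree_eq_sum, Finset.mul_sum]
    refine IsLeadingForm.prod _ fun i => IsLeadingForm.pow ⟨hη i, ?_⟩ _
    rw [sub_sub_cancel]
    -- This is where `2 ≤ d` matters: `X i` has degree below `d`.
    exact (isHomogeneous_X k i).mem_degreeBelow (by omega)
  obtain ⟨B, hB⟩ := exists_basis_of_sub_mem_degreeBelow u D (fun p => (hlead p).1) v
    (fun p => (hlead p).2)
  -- The coordinates at exponent zero. They vanish on `I`, since multiplication by `η i - X i`
  -- raises the exponent of a basis vector, and so they detect independence of the `e j` in the
  -- quotient.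
  let L : MvPolynomial (Fin N) k →ₗ[k] (J → k) :=
    LinearMap.pi fun j => (Finsupp.lapply (j, 0)) ∘ₗ B.repr.toLinearMap
  have hLI : ∀ f ∈ I, L f = 0 := by
    intro f hf
    rw [hI] at hf
    obtain ⟨c, rfl⟩ := (Ideal.mem_span_range_iff_exists_fun).1 hf
    rw [map_sum]
    refine Finset.sum_eq_zero fun i _ => ?_
    have : (L ∘ₗ LinearMap.mulRight k (η i - X i)) = 0 := by
      refine B.ext fun p => ?_
      have hmul : B p * (η i - X i) = B (p.1, p.2 + Finsupp.single i 1) := by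
        rw [hB, hB]
        simp only [v, Finsupp.add_apply, pow_add, Finset.prod_mul_distrib]
        rw [mul_assoc]
        congr 2
        rw [Finset.prod_eq_single i]
        · simp
        · intro i' _ hi'
          rw [Finsupp.single_eq_of_ne hi', pow_zero]
        · simp
      rw [LinearMap.comp_apply, LinearMap.mulRight_apply, hmul]
      funext j
      have hne : (p.1, p.2 + Finsupp.single i 1) ≠ (j, 0) := by
        intro h
        have := DFunLike.congr_fun (congrArg Prod.snd h) i
        simp at this
      simp [L, Finsupp.single_eq_of_ne hne.symm]
    exact LinearMap.congr_fun this (c i)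
  have hLe : ∀ j, L (e j) = Pi.single j 1 := by
    intro j
    have : e j = B (j, 0) := by rw [hB]; simp [v]
    rw [this]
    funext j'
    simp only [L, LinearMap.pi_apply, LinearMap.comp_apply, LinearEquiv.coe_coe, B.repr_self,
      Finsupp.lapply_apply]
    by_cases h : j' = j
    · subst h; simp
    · rw [Pi.single_eq_of_ne h, Finsupp.single_eq_of_ne]
      exact fun h' => h (Prod.ext_iff.1 h').1
  have hind : LinearIndependent k (fun j => Ideal.Quotient.mk I (e j)) := by
    rw [Fintype.linearIndependent_iff]
    intro c hc j
    have hmem : ∑ j, c j • e j ∈ I := by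
      rw [← Ideal.Quotient.eq_zero_iff_mem, map_sum, ← hc]
      rfl
    have := congrFun (hLI _ hmem) j
    simpa [map_sum, hLe, Finset.sum_apply, Pi.single_apply] using this
  have hspan : ⊤ ≤ Submodule.span k (Set.range fun j => Ideal.Quotient.mk I (e j)) := by
    rintro x -
    obtain ⟨f, rfl⟩ := Ideal.Quotient.mk_surjective x
    rw [← B.linearCombination_repr f, Finsupp.linearCombination_apply, Finsupp.sum, map_sum]
    refine Submodule.sum_mem _ fun p _ => ?_
    change B.repr f p • Ideal.Quotient.mk I (B p) ∈ _
    refine Submodule.smul_mem _ _ ?_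
    obtain ⟨j, α⟩ := p
    by_cases hα : α = 0
    · subst hα
      refine Submodule.subset_span ⟨j, ?_⟩
      rw [hB]
      simp [v]
    · obtain ⟨i, hi⟩ := Finsupp.ne_iff.1 hα
      have hiI : η i - X i ∈ I := hI ▸ Ideal.subset_span (Set.mem_range_self i)
      have : B (j, α) ∈ I := by
        rw [hB]
        refine Ideal.mul_mem_left _ _ ?_
        rw [← Finset.mul_prod_erase _ _ (Finset.mem_univ i)]
        exact Ideal.mul_mem_right _ _ (Ideal.pow_mem_of_mem _ hiI _
          (Nat.pos_of_ne_zero hi))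
      rw [Ideal.Quotient.eq_zero_iff_mem.2 this]
      exact zero_mem _
  let Q : Module.Basis J k (MvPolynomial (Fin N) k ⧸ I) := Module.Basis.mk hind hspan
  let c : J → k := fun j => ∏ i, μ i ^ β j i
  have htr : LinearMap.trace k _ T = ∑ j, c j := by
    refine trace_eq_sum_of_basis Q T c fun j => ?_
    rw [Module.Basis.mk_apply, hT, scaleVars_monomial]
    rfl
  refine ⟨Module.Finite.of_basis Q, ?_⟩
  rw [htr]
  refine sum_eq_pow_card_of_completeSeries μ (fun j => (β j).degree) c hd0 ?_
  ext n
  have hmon : PowerSeries.coeff n (completeSeries μ) = LinearMap.trace k _ (scaleHom μ n) := by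
    rw [coeff_completeSeries, trace_scaleHom (basisMonomials (Fin N) k) Finsupp.degree
      (fun α => isHomogeneous_monomial _ rfl) μ (fun α => ∏ i, μ i ^ α i)
      (fun α => scaleVars_monomial μ α) n (Finset.finsuppAntidiag Finset.univ n)
      (fun α => mem_finsuppAntidiag_univ)]
  rw [hmon]
  have hcu : ∀ p, scaleVars μ (u p) = (c p.1 * ∏ i, μ i ^ p.2 i) • u p := by
    intro p
    rw [hu, map_mul, map_prod]
    simp only [map_pow, hμ, smul_pow]
    rw [Finset.prod_smul, scaleVars_monomial, smul_mul_smul_comm]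
  -- The exponents `α` for which `e j` times the monomial in `η` with exponent `α` has degree `n`.
  let S : J → Finset (Fin N →₀ ℕ) := fun j =>
    if (β j).degree ≤ n ∧ d ∣ n - (β j).degree then
      Finset.finsuppAntidiag Finset.univ ((n - (β j).degree) / d) else ∅
  have hS : ∀ j α, α ∈ S j ↔ (β j).degree + d * α.degree = n := by
    intro j α
    simp only [S]
    split_ifs with h
    · obtain ⟨h1, q, hq⟩ := h
      rw [mem_finsuppAntidiag_univ, hq, Nat.mul_div_cancel_left _ (by omega)]
      constructor
      · rintro rfl; omega
      · intro h2
        exact Nat.eq_of_mul_eq_mul_left (by omega) (show d * α.degree = d * q by omega)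
    · constructor
      · simp
      · rintro rfl
        exact absurd ⟨Nat.le_add_right _ _, _, Nat.add_sub_cancel_left _ _⟩ h
  rw [trace_scaleHom u D (fun p => (hlead p).1) μ _ hcu n
    ((Finset.univ.sigma S).map (Equiv.sigmaEquivProd J _).toEmbedding) (by
      rintro ⟨j, α⟩
      simp [hS, D])]
  rw [Finset.sum_map, Finset.sum_sigma, Finset.sum_mul, map_sum]
  refine Finset.sum_congr rfl fun j _ => ?_
  rw [mul_assoc, PowerSeries.coeff_C_mul, PowerSeries.coeff_X_pow_mul', PowerSeries.coeff_expand]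
  simp only [Equiv.toEmbedding_apply, Equiv.sigmaEquivProd_apply, S]
  by_cases h1 : (β j).degree ≤ n
  · by_cases h2 : d ∣ n - (β j).degree
    · rw [if_pos h1, if_pos h2, if_pos ⟨h1, h2⟩, coeff_completeSeries, Finset.mul_sum]
    · rw [if_pos h1, if_neg h2, if_neg (fun h => h2 h.2), Finset.sum_empty, mul_zero]
  · rw [if_neg h1, if_neg (fun h => h1 h.1), Finset.sum_empty, mul_zero]

end QuotientTrace

/-! ### Diagonalization and eigenvalue multiplicities. -/

section Eigenbases

open MvPolynomial TypeAParking
open Equiv (Perm)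

variable {k V : Type*} [Field k] [AddCommGroup V] [Module k V]

/-- A linear endomorphism of finite order is diagonalizable. -/
theorem exists_eigenbasis_of_pow_eq_one [IsAlgClosed k] [CharZero k] [FiniteDimensional k V]
    (f : Module.End k V) {m : ℕ} (hm : m ≠ 0) (hf : f ^ m = 1) {N : ℕ}
    (hN : Module.finrank k V = N) :
    ∃ (y : Module.Basis (Fin N) k V) (c : Fin N → k), ∀ i, f (y i) = c i • y i := by
  classical
  have hss : f.IsSemisimple := by
    refine Module.End.isSemisimple_of_squarefree_aeval_eq_zero (p := Polynomial.X ^ m - 1) ?_ ?_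
    · exact (Polynomial.X_pow_sub_one_separable_iff.2 (Nat.cast_ne_zero.2 hm)).squarefree
    · simp [hf]
  have hint : DirectSum.IsInternal (fun z : k => f.eigenspace z) := by
    refine DirectSum.isInternal_submodule_of_iSupIndep_of_iSup_eq_top f.eigenspaces_iSupIndep ?_
    have h := Module.End.iSup_maxGenEigenspace_eq_top f
    simpa only [hss.isFinitelySemisimple.maxGenEigenspace_eq_eigenspace] using h
  let b := hint.collectedBasis (fun z => Module.finBasis k (f.eigenspace z))
  have := Module.Finite.finite_basis b
  have := Fintype.ofFinite (Σ z, Fin (Module.finrank k (f.eigenspace z)))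
  let φ := Fintype.equivFinOfCardEq ((Module.finrank_eq_card_basis b).symm.trans hN)
  refine ⟨b.reindex φ, fun i => (φ.symm i).1, fun i => ?_⟩
  rw [b.reindex_apply]
  exact Module.End.mem_eigenspace_iff.1 (hint.collectedBasis_mem _ _)

theorem finrank_eigenspace_eq_card {N : ℕ} (f : Module.End k V)
    (y : Module.Basis (Fin N) k V) (c : Fin N → k) (h : ∀ i, f (y i) = c i • y i) (z : k) :
    Module.finrank k (f.eigenspace z) = Nat.card {i // c i = z} := by
  classical
  have hspan : f.eigenspace z = Submodule.span k (Set.range fun i : {i // c i = z} => y i) := by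
    refine le_antisymm ?_ (Submodule.span_le.2 ?_)
    · intro x hx
      rw [Module.End.mem_eigenspace_iff] at hx
      have hzero : ∀ i, c i ≠ z → y.repr x i = 0 := by
        intro i hi
        have h1 : y.repr (f x) i = c i * y.repr x i := by
          conv_lhs => rw [← y.sum_repr x]
          simp only [map_sum, map_smul, h, y.repr_self, Finsupp.finsetSum_apply,
            Finsupp.smul_apply, smul_eq_mul, Finsupp.single_apply]
          simp [mul_comm]
        rw [hx, map_smul, Finsupp.smul_apply, smul_eq_mul] at h1
        have h2 : (c i - z) * y.repr x i = 0 := by rw [sub_mul, h1, sub_self]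
        exact (mul_eq_zero.1 h2).resolve_left (sub_ne_zero.2 hi)
      rw [← y.sum_repr x]
      refine Submodule.sum_mem _ fun i _ => ?_
      by_cases hi : c i = z
      · exact Submodule.smul_mem _ _ (Submodule.subset_span ⟨⟨i, hi⟩, rfl⟩)
      · rw [hzero i hi, zero_smul]
        exact zero_mem _
    · rintro _ ⟨⟨i, hi⟩, rfl⟩
      exact Module.End.mem_eigenspace_iff.2 (by rw [h, hi])
  rw [hspan, finrank_span_eq_card, Nat.card_eq_fintype_card]
  exact y.linearIndependent.comp _ Subtype.val_injective

theorem finrank_eigenspace_dualMap [FiniteDimensional k V] (f : Module.End k V) (z : k) :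
    Module.finrank k (Module.End.eigenspace (f.dualMap : Module.End k (Module.Dual k V)) z) =
      Module.finrank k (f.eigenspace z) := by
  rw [Module.End.eigenspace_def, Module.End.eigenspace_def]
  have h1 : (f.dualMap - z • 1 : Module.End k (Module.Dual k V)) =
      (f - z • 1 : Module.End k V).dualMap := by
    ext g x
    simp
  have h2 := LinearMap.finrank_range_add_finrank_ker (f - z • 1 : Module.End k V)
  have h3 := LinearMap.finrank_range_add_finrank_ker (f - z • 1 : Module.End k V).dualMap
  rw [LinearMap.finrank_range_dualMap_eq_finrank_range, Subspace.dual_finrank_eq] at h3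
  rw [h1]
  omega

end Eigenbases

/-! ### Eigencoordinates and the character of the algebraic parking space. -/

section ChangeOfBasis

open MvPolynomial TypeAParking
open Equiv (Perm)

variable {n : ℕ}

/-- The substitution `X_i ↦ y_i` expressing the basis `y` of `V^*` in the coordinates `x`. -/
noncomputable def coordChange (x y : Module.Basis (Fin (n - 1)) ℂ (VDual n)) :
    PolyV n →ₐ[ℂ] PolyV n :=
  aeval fun i => linForm x (y i)

theorem coordChange_linForm (x y : Module.Basis (Fin (n - 1)) ℂ (VDual n)) (f : VDual n) :
    coordChange x y (linForm y f) = linForm x f := by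
  have : (coordChange x y).toLinearMap ∘ₗ linForm y = linForm x := by
    refine y.ext fun i => ?_
    simp [linForm_basis, coordChange]
  exact LinearMap.congr_fun this f

theorem coordChange_comp (x y : Module.Basis (Fin (n - 1)) ℂ (VDual n)) :
    (coordChange x y).comp (coordChange y x) = AlgHom.id ℂ _ := by
  refine algHom_ext fun i => ?_
  rw [AlgHom.comp_apply, ← linForm_basis x i, coordChange_linForm, coordChange_linForm]
  rfl

theorem coordChange_coordChange (x y : Module.Basis (Fin (n - 1)) ℂ (VDual n)) (p : PolyV n) :
    coordChange x y (coordChange y x p) = p :=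
  DFunLike.congr_fun (coordChange_comp x y) p

/-- The change of coordinates as an algebra isomorphism. -/
noncomputable def coordEquiv (x y : Module.Basis (Fin (n - 1)) ℂ (VDual n)) :
    PolyV n ≃ₐ[ℂ] PolyV n :=
  AlgEquiv.ofAlgHom (coordChange x y) (coordChange y x) (coordChange_comp x y)
    (coordChange_comp y x)

theorem isHomogeneous_linForm (x : Module.Basis (Fin (n - 1)) ℂ (VDual n)) (f : VDual n) :
    (linForm x f).IsHomogeneous 1 := by
  rw [linForm, Module.Basis.constr_apply_fintype]
  refine IsHomogeneous.sum _ _ _ fun i _ => ?_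
  rw [smul_eq_C_mul]
  exact isHomogeneous_C_mul_X _ _

theorem isHomogeneous_coordChange (x y : Module.Basis (Fin (n - 1)) ℂ (VDual n)) {p : PolyV n}
    {m : ℕ} (hp : p.IsHomogeneous m) : (coordChange x y p).IsHomogeneous m := by
  simpa [coordChange] using hp.aeval _ (n := 1) (fun i => isHomogeneous_linForm x (y i))

/-- The ideal generated by the image of a linear map on the dual space does not depend on the basis
whose images are taken as generators. Applied to `Θ` and to `Θ - x`, this transports both ideals to
eigencoordinates. -/
theorem comap_coordChange_span (x y : Module.Basis (Fin (n - 1)) ℂ (VDual n))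
    (φ : VDual n →ₗ[ℂ] PolyV n) :
    (Ideal.span (Set.range fun i => φ (x i))).comap (coordChange x y) =
      Ideal.span (Set.range fun i => coordChange y x (φ (y i))) := by
  have hspan : ∀ (x : Module.Basis (Fin (n - 1)) ℂ (VDual n)) (ψ : VDual n →ₗ[ℂ] PolyV n) f,
      ψ f ∈ Ideal.span (Set.range fun i => ψ (x i)) := by
    intro x ψ f
    rw [← x.sum_repr f, map_sum]
    refine Submodule.sum_mem _ fun i _ => ?_
    rw [map_smul, smul_eq_C_mul]
    exact Ideal.mul_mem_left _ _ (Ideal.subset_span ⟨i, rfl⟩)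
  refine le_antisymm ?_ (Ideal.span_le.2 ?_)
  · have hle : Ideal.span (Set.range fun i => φ (x i)) ≤
        (Ideal.span (Set.range fun i => coordChange y x (φ (y i)))).comap (coordChange y x) := by
      refine Ideal.span_le.2 ?_
      rintro _ ⟨i, rfl⟩
      exact hspan y ((coordChange y x).toLinearMap ∘ₗ φ) (x i)
    intro p hp
    have := hle hp
    rwa [Ideal.mem_comap, coordChange_coordChange] at this
  · rintro _ ⟨i, rfl⟩
    rw [SetLike.mem_coe, Ideal.mem_comap, coordChange_coordChange]
    exact hspan x φ (y i)

theorem polyAct_homogeneous (x : Module.Basis (Fin (n - 1)) ℂ (VDual n)) (w : Perm (Fin n))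
    (g : coxGroup n) {p : PolyV n} {m : ℕ} (hp : p.IsHomogeneous m) :
    polyAct x (w, g) p = coxScalar n g ^ m • polyAct x (w, 1) p := by
  have h1 : polyAct x (w, g) = (polyAct x (w, 1)).comp (polyAct x (1, g)) := by
    rw [← polyAct_mul]
    simp
  rw [h1, AlgHom.comp_apply, polyAct_cox_homogeneous x g hp, map_smul]

/-- In an eigenbasis of `w` on the dual space the action is a diagonal substitution, and the trace
formula for the quotient applies. The inverse appears because `w` acts on the dual space by the
transpose of `w⁻¹`. -/
theorem parkAlgRep_character (P : ParkingHsop n) (hn : 1 ≤ n) (w : Perm (Fin n)) (l : ℤ) :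
    Module.Finite ℂ (ParkAlg P) ∧ (parkAlgRep P).character (w, coxPow n l) =
      ((n + 1 : ℕ) : ℂ) ^ eigMult w⁻¹ (omega n ^ l) := by
  have hfinrank : Module.finrank ℂ (VDual n) = n - 1 := by
    rw [Module.finrank_eq_card_basis P.x, Fintype.card_fin]
  have hfd : FiniteDimensional ℂ (VDual n) := Module.Finite.of_basis P.x
  have hord : (dualRep n w) ^ orderOf w = 1 := by rw [← map_pow, pow_orderOf_eq_one, map_one]
  obtain ⟨y, c, hy⟩ := exists_eigenbasis_of_pow_eq_one (dualRep n w) (orderOf_pos w).ne' hord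
    hfinrank
  set s := coxScalar n (coxPow n l) with hs
  set Θ := P.x.constr ℂ P.θ with hΘ
  have hΘx : ∀ i, Θ (P.x i) = P.θ i := fun i => P.x.constr_basis ℂ P.θ i
  let η : Fin (n - 1) → PolyV n := fun i => coordChange y P.x (Θ (y i))
  let μ : Fin (n - 1) → ℂ := fun i => s * c i
  have hΘhom : ∀ f, (Θ f).IsHomogeneous (n + 1) := by
    intro f
    rw [hΘ, Module.Basis.constr_apply_fintype]
    refine IsHomogeneous.sum _ _ _ fun i _ => ?_
    rw [smul_eq_C_mul]
    exact (P.homogeneous i).C_mul _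
  have hη : ∀ i, (η i).IsHomogeneous (n + 1) := fun i => isHomogeneous_coordChange _ _ (hΘhom _)
  have hact : ∀ p, polyAct P.x (w, coxPow n l) (coordChange P.x y p) =
      coordChange P.x y (scaleVars μ p) := by
    have hcomp : (polyAct P.x (w, coxPow n l)).comp (coordChange P.x y) =
        (coordChange P.x y).comp (scaleVars μ) := by
      refine algHom_ext fun i => ?_
      have h1 : coordChange P.x y (X i) = linForm P.x (y i) := aeval_X _ _
      have h2 : scaleVars μ (X i) = μ i • X i := aeval_X _ _
      have h3 : dualRep n (w, coxPow n l).1 (y i) = c i • y i := hy i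
      rw [AlgHom.comp_apply, AlgHom.comp_apply, h2, map_smul, h1, polyAct_linForm, h3, map_smul,
        smul_smul]
    exact fun p => DFunLike.congr_fun hcomp p
  -- Equivariance of `Θ` contributes `c i`; homogeneity contributes `s ^ (n + 1)`, which equals `s`.
  have hμ : ∀ i, scaleVars μ (η i) = μ i • η i := by
    intro i
    have h1 : coordChange P.x y (scaleVars μ (η i)) = μ i • Θ (y i) := by
      rw [← hact, coordChange_coordChange, polyAct_homogeneous _ _ _ (hΘhom _), ← P.equivariant,
        hy, map_smul, coxScalar_pow, smul_smul]
    rw [← coordChange_coordChange y P.x (scaleVars μ (η i)), h1, map_smul]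
  have hquot : ∀ I : Ideal (PolyV n), ∃ e : (PolyV n ⧸ I.comap (coordChange P.x y)) ≃ₗ[ℂ]
      PolyV n ⧸ I, ∀ p, e (Ideal.Quotient.mk _ p) = Ideal.Quotient.mk _ (coordChange P.x y p) := by
    intro I
    have hsurj : Function.Surjective (coordChange P.x y) :=
      fun p => ⟨_, coordChange_coordChange P.x y p⟩
    exact ⟨(Ideal.quotientEquivAlg _ I (coordEquiv P.x y)
      (Ideal.map_comap_of_surjective (coordChange P.x y) hsurj I).symm).toLinearEquiv,
      fun p => rfl⟩
  have hfin : Module.Finite ℂ (PolyV n ⧸ Ideal.span (Set.range η)) := by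
    have h1 := comap_coordChange_span P.x y Θ
    simp only [hΘx] at h1
    obtain ⟨e, -⟩ := hquot (Ideal.span (Set.range P.θ))
    change Module.Finite ℂ (PolyV n ⧸
      Ideal.span (Set.range fun i => coordChange y P.x (Θ (y i))))
    rw [← h1]
    have := P.finite
    exact Module.Finite.equiv e.symm
  have hI : P.ideal.comap (coordChange P.x y) = Ideal.span (Set.range fun i => η i - X i) := by
    have h1 := comap_coordChange_span P.x y (Θ - linForm P.x)
    simp only [LinearMap.sub_apply, hΘx, linForm_basis, map_sub, coordChange_linForm] at h1
    exact h1
  obtain ⟨e, he⟩ := hquot P.ideal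
  let T := e.symm.conj (parkAlgRep P (w, coxPow n l))
  have hT : ∀ p, T (Ideal.Quotient.mk _ p) = Ideal.Quotient.mk _ (scaleVars μ p) := by
    intro p
    change e.symm (parkAlgRep P (w, coxPow n l) (e (Ideal.Quotient.mk _ p))) = _
    rw [LinearEquiv.symm_apply_eq, he, he]
    change Ideal.Quotient.mk P.ideal (polyAct P.x _ (coordChange P.x y p)) = _
    rw [hact]
  obtain ⟨h1, h2⟩ := trace_quotient_eq (d := n + 1) (by omega) η hη hfin μ hμ _ hI T hT
  refine ⟨Module.Finite.equiv e, ?_⟩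
  rw [LinearMap.trace_conj'] at h2
  rw [Representation.character, h2]
  congr 1
  have hV : FiniteDimensional ℂ (reflSpace ℂ n) := inferInstance
  rw [eigMult, ← finrank_eigenspace_dualMap]
  change _ = Module.finrank ℂ (Module.End.eigenspace (dualRep n w) (omega n ^ l))
  rw [finrank_eigenspace_eq_card (dualRep n w) y c hy]
  refine Nat.card_congr (Equiv.subtypeEquivRight fun i => ?_)
  simp only [μ, hs, coxScalar_coxPow, zpow_neg]
  -- The scalar `s` is the inverse of `ω^l`, so `s * c i = 1` means `c i = ω^l`.
  rw [inv_mul_eq_one₀ (zpow_ne_zero _ (omega_ne_zero n)), eq_comm]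

end ChangeOfBasis

/-! ### Cyclic arcs and rotations of a circle of spots. -/

section Arcs

variable {m : ℕ}

/-- `j` lies on the cyclic arc from `b` forward to `k`. -/
def InArc (b j k : Fin m) : Prop :=
  (b ≤ j ∧ j ≤ k) ∨ (k < b ∧ b ≤ j) ∨ (j ≤ k ∧ k < b)

instance (b j k : Fin m) : Decidable (InArc b j k) := by
  unfold InArc
  infer_instance

/-- The cyclic arc from `b` forward to `k`. -/
def arc (b k : Fin m) : Finset (Fin m) := Finset.univ.filter fun j => InArc b j k

theorem mem_arc {b j k : Fin m} : j ∈ arc b k ↔ InArc b j k := by simp [arc]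

theorem arc_subset {b b' k : Fin m} (h : InArc b b' k) : arc b' k ⊆ arc b k := by
  intro j hj
  rw [mem_arc] at *
  unfold InArc at *
  omega

theorem card_arc_lt {b b' k : Fin m} (h : InArc b b' k) (hne : b' ≠ b) :
    (arc b' k).card < (arc b k).card := by
  refine Finset.card_lt_card ((Finset.ssubset_iff_of_subset (arc_subset h)).2 ⟨b, ?_, ?_⟩)
  · rw [mem_arc]; unfold InArc; omega
  · rw [mem_arc]; unfold InArc at *; omega

/-- The point `i` steps after `b`. -/
def rot (b : Fin m) (i : ℕ) : Fin m := ⟨(b + i) % m, Nat.mod_lt _ (Fin.pos b)⟩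

theorem rot_val (b : Fin m) {i : ℕ} (hi : i < m) :
    (rot b i : ℕ) = b + i ∧ (b : ℕ) + i < m ∨ (rot b i : ℕ) + m = b + i := by
  have hb := b.isLt
  rcases Nat.lt_or_ge (b + i) m with h | h
  · left
    exact ⟨Nat.mod_eq_of_lt h, h⟩
  · right
    change (b + i) % m + m = b + i
    rw [Nat.mod_eq_sub_mod h, Nat.mod_eq_of_lt (by omega)]
    omega

theorem rot_injOn (b : Fin m) : Set.InjOn (rot b) (Set.Iio m) := by
  intro i hi j hj h
  rw [Set.mem_Iio] at hi hj
  have h1 := rot_val b hi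
  have h2 := rot_val b hj
  have h3 : (rot b i : ℕ) = rot b j := congrArg Fin.val h
  omega

theorem exists_rot (b k : Fin m) : ∃ i < m, rot b i = k := by
  rcases Nat.lt_or_ge k b with h | h
  · refine ⟨m + k - b, by omega, Fin.ext ?_⟩
    have := rot_val b (show m + k - b < m by omega)
    omega
  · refine ⟨(k : ℕ) - (b : ℕ), by omega, Fin.ext ?_⟩
    have := rot_val b (show (k : ℕ) - (b : ℕ) < m by omega)
    omega

theorem arc_rot (b : Fin m) {i i' : ℕ} (hi : i < m) (h : i' ≤ i) :
    arc (rot b i') (rot b i) = (Finset.Ico i' (i + 1)).image (rot b) := by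
  ext j
  rw [mem_arc, Finset.mem_image]
  obtain ⟨x, hx, rfl⟩ := exists_rot b j
  have h1 := rot_val b hi
  have h2 := rot_val b (show i' < m by omega)
  have h3 := rot_val b hx
  constructor
  · intro harc
    refine ⟨x, ?_, rfl⟩
    rw [Finset.mem_Ico]
    unfold InArc at harc
    simp only [Fin.le_def, Fin.lt_def] at harc
    omega
  · rintro ⟨y, hy, hyx⟩
    rw [Finset.mem_Ico] at hy
    have : y = x := rot_injOn b (show y < m by omega) (show x < m from hx) hyx
    subst this
    unfold InArc
    simp only [Fin.le_def, Fin.lt_def]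
    omega

theorem sum_arc_rot (s : Fin m → ℕ) (b : Fin m) {i i' : ℕ} (hi : i < m) (h : i' ≤ i) :
    ∑ j ∈ arc (rot b i') (rot b i), s j = ∑ x ∈ Finset.Ico i' (i + 1), s (rot b x) := by
  rw [arc_rot b hi h, Finset.sum_image]
  intro x hx y hy hxy
  simp only [Finset.coe_Ico, Set.mem_Ico] at hx hy
  exact rot_injOn b (show x < m by omega) (show y < m by omega) hxy

theorem rot_zero (b : Fin m) : rot b 0 = b :=
  Fin.ext (by simp [rot, Nat.mod_eq_of_lt b.isLt])

theorem card_arc_rot (b : Fin m) {i i' : ℕ} (hi : i < m) (h : i' ≤ i) :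
    (arc (rot b i') (rot b i)).card = i + 1 - i' := by
  have := sum_arc_rot (fun _ => 1) b hi h
  simpa using this

end Arcs

/-! ### Record lows of walks with down-steps of size one. -/

section SkipFree

open Classical in
/-- In a walk whose steps are at least `-1` and which ends below its start, the number of strict
record lows at nonnegative height after the first step is the height of the first step. -/
theorem card_records (g : ℕ → ℤ) (hstep : ∀ i, g i - 1 ≤ g (i + 1)) (h1 : -1 ≤ g 1) {M : ℕ}
    (hM : 1 ≤ M) : ∃ ν : ℤ, (∀ i, 1 ≤ i → i ≤ M → ν ≤ g i) ∧ (∃ i, 1 ≤ i ∧ i ≤ M ∧ g i = ν) ∧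
      (((Finset.range M).filter fun i => 0 ≤ g (i + 1) ∧
        ∀ i', 0 < i' → i' ≤ i → g (i + 1) < g i').card : ℤ) = g 1 + 1 - max 0 ν := by
  induction M, hM using Nat.le_induction with
  | base =>
    refine ⟨g 1, fun i h h' => ?_, ⟨1, le_rfl, le_rfl, rfl⟩, ?_⟩
    · rw [le_antisymm h' h]
    · rw [Finset.range_one, Finset.filter_singleton]
      split_ifs with h
      · rw [Finset.card_singleton, max_eq_right (by simpa using h.1)]
        simp
      · have : ¬ 0 ≤ g 1 := fun h0 => h ⟨h0, fun i' a b => by omega⟩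
        rw [Finset.card_empty, max_eq_left (by omega)]
        push_cast
        omega
  | succ M hM ih =>
    obtain ⟨ν, hν, ⟨i0, hi0, hi0', hi0ν⟩, hcard⟩ := ih
    rw [Finset.range_add_one, Finset.filter_insert]
    have hnot : M ∉ (Finset.range M).filter fun i => 0 ≤ g (i + 1) ∧
        ∀ i', 0 < i' → i' ≤ i → g (i + 1) < g i' := by simp
    by_cases hlt : g (M + 1) < ν
    -- As the walk descends by at most one at a time, a new record lies exactly one below the
    -- running minimum `ν`; it is counted only while nonnegative, which matches the change of `max 0
    -- ν`.
    · have hM1 : g (M + 1) = ν - 1 := by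
        have h2 := hstep M
        have h3 := hν M hM le_rfl
        omega
      refine ⟨g (M + 1), ?_, ⟨M + 1, by omega, le_rfl, rfl⟩, ?_⟩
      · intro i hi hi'
        rcases Nat.lt_or_ge i (M + 1) with h | h
        · exact hlt.le.trans (hν i hi (by omega))
        · rw [le_antisymm hi' h]
      · split_ifs with h
        · rw [Finset.card_insert_of_notMem hnot]
          push_cast
          rw [hcard, max_eq_right h.1, max_eq_right (by omega)]
          omega
        · have : ¬ 0 ≤ g (M + 1) := fun h0 => h ⟨h0, fun i' a b =>
            hlt.trans_le (hν i' a b)⟩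
          rw [hcard, max_eq_left (by omega), max_eq_left (by omega)]
    · rw [if_neg]
      · refine ⟨ν, ?_, ⟨i0, hi0, by omega, hi0ν⟩, hcard⟩
        intro i hi hi'
        rcases Nat.lt_or_ge i (M + 1) with h | h
        · exact hν i hi (by omega)
        · rw [le_antisymm hi' h]
          omega
      · rintro ⟨-, h⟩
        have := h i0 hi0 hi0'
        omega

-- The two conditions say that the walk `g i = a 0 + ⋯ + a (i-1) - i` has a strict record low at
-- time `i + 1` and is nonnegative there. The total is at most `M`, so the walk ends at or below
-- zero, its minimum is nonpositive, and the number of records is `g 1 + 1 = a 0`.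
open Classical in
theorem card_first_hits (a : ℕ → ℕ) {M : ℕ} (hM : 1 ≤ M)
    (h : ∑ x ∈ Finset.range M, a x ≤ M) :
    ((Finset.range M).filter fun i => i + 1 ≤ ∑ x ∈ Finset.Ico 0 (i + 1), a x ∧
      ∀ i', 0 < i' → i' ≤ i → ∑ x ∈ Finset.Ico i' (i + 1), a x < i + 1 - i').card = a 0 := by
  let g : ℕ → ℤ := fun i => (∑ x ∈ Finset.range i, a x : ℕ) - i
  have hg1 : g 1 = a 0 - 1 := by simp [g]
  obtain ⟨ν, hν, ⟨i0, -, -, -⟩, hcard⟩ := card_records g (fun i => by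
    simp only [g, Finset.sum_range_succ]
    push_cast
    omega) (by omega) hM
  have hνM := hν M hM le_rfl
  have hgM : g M ≤ 0 := by
    simp only [g]
    omega
  rw [max_eq_left (by omega), hg1] at hcard
  have hfilter : ((Finset.range M).filter fun i => i + 1 ≤ ∑ x ∈ Finset.Ico 0 (i + 1), a x ∧
      ∀ i', 0 < i' → i' ≤ i → ∑ x ∈ Finset.Ico i' (i + 1), a x < i + 1 - i') =
      (Finset.range M).filter fun i => 0 ≤ g (i + 1) ∧
        ∀ i', 0 < i' → i' ≤ i → g (i + 1) < g i' := by
    refine Finset.filter_congr fun i _ => and_congr ?_ ?_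
    · rw [← Finset.range_eq_Ico]
      simp only [g]
      omega
    · refine forall_congr' fun i' => forall_congr' fun _ => forall_congr' fun hi' => ?_
      have := Finset.sum_range_add_sum_Ico a (show i' ≤ i + 1 by omega)
      simp only [g]
      omega
  rw [hfilter]
  omega

end SkipFree

/-! ### Parking on a circle: outcomes correspond to preference multiplicities. -/

section ParkingMaps

variable {m : ℕ}

/-- A parking map assigns to each spot the preferred spot of the car that is parked there, or none
if the spot is empty. Cars move forward from their preferred spot and later arrivals do not pass
beyond earlier ones. -/
def IsParkMap (P : Fin m → Option (Fin m)) : Prop :=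
  ∀ b k, P k = some b → ∀ j, InArc b j k → ∃ b', P j = some b' ∧ InArc b b' j

/-- The number of cars with preference `b`. -/
def fiberCard (P : Fin m → Option (Fin m)) (b : Fin m) : ℕ :=
  (Finset.univ.filter fun k => P k = some b).card

/-- The car parked at `k` has preference `b`, if the preferences have multiplicities `s`. -/
def IsSource (s : Fin m → ℕ) (b k : Fin m) : Prop :=
  (arc b k).card ≤ ∑ j ∈ arc b k, s j ∧
    ∀ b', InArc b b' k → b' ≠ b → ∑ j ∈ arc b' k, s j < (arc b' k).card

theorem sum_arc_fiberCard (P : Fin m → Option (Fin m)) (b k : Fin m) :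
    ∑ j ∈ arc b k, fiberCard P j =
      (Finset.univ.filter fun j => ∃ b', P j = some b' ∧ InArc b b' k).card := by
  unfold fiberCard
  rw [← Finset.card_biUnion]
  · congr 1
    ext j
    simp only [Finset.mem_biUnion, Finset.mem_filter, Finset.mem_univ, true_and, mem_arc]
    exact ⟨fun ⟨x, h, h'⟩ => ⟨x, h', h⟩, fun ⟨x, h, h'⟩ => ⟨x, h', h⟩⟩
  · intro x _ y _ hxy
    rw [Function.onFun, Finset.disjoint_left]
    intro j hj hj'
    simp only [Finset.mem_filter, Finset.mem_univ, true_and] at hj hj'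
    rw [hj] at hj'
    exact hxy (Option.some_injective _ hj')

/-- All spots from `b` to `k` hold cars with preferences in that arc. For a shorter arc starting at
`b'`, the cars preferring it also park in it, since one that passed `k` would force the car at `k`
to prefer a later spot than `b`; and the spot `k` itself is lost to a car preferring `b`. -/
theorem IsParkMap.isSource {P : Fin m → Option (Fin m)} (hP : IsParkMap P) {b k : Fin m}
    (h : P k = some b) : IsSource (fiberCard P) b k := by
  constructor
  · rw [sum_arc_fiberCard]
    refine Finset.card_le_card fun j hj => ?_
    rw [mem_arc] at hj
    obtain ⟨b', hb', harc⟩ := hP b k h j hj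
    refine Finset.mem_filter.2 ⟨Finset.mem_univ _, b', hb', ?_⟩
    unfold InArc at *
    omega
  · intro b' hb' hne
    rw [sum_arc_fiberCard]
    refine Finset.card_lt_card ((Finset.ssubset_iff_of_subset ?_).2 ⟨k, ?_, ?_⟩)
    · intro j hj
      obtain ⟨b'', hj, hb''⟩ := (Finset.mem_filter.1 hj).2
      rw [mem_arc]
      by_contra hcon
      have hk : InArc b'' k j := by unfold InArc at *; omega
      obtain ⟨x, hx, hx'⟩ := hP b'' j hj k hk
      rw [h] at hx
      obtain rfl := Option.some_injective _ hx
      apply hne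
      unfold InArc at *
      omega
    · rw [mem_arc]
      unfold InArc
      omega
    · intro hk
      obtain ⟨b'', hk, hb''⟩ := (Finset.mem_filter.1 hk).2
      rw [h] at hk
      obtain rfl := Option.some_injective _ hk
      apply hne
      unfold InArc at *
      omega

/-- No car passes an empty spot, so the cars preferring an arc that ends at `k` park in that arc and
leave `k` free. -/
theorem IsParkMap.sum_lt_of_none {P : Fin m → Option (Fin m)} (hP : IsParkMap P) {k : Fin m}
    (h : P k = none) (b : Fin m) : ∑ j ∈ arc b k, fiberCard P j < (arc b k).card := by
  rw [sum_arc_fiberCard]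
  refine Finset.card_lt_card ((Finset.ssubset_iff_of_subset ?_).2 ⟨k, ?_, ?_⟩)
  · intro j hj
    obtain ⟨b'', hj, hb''⟩ := (Finset.mem_filter.1 hj).2
    rw [mem_arc]
    by_contra hcon
    have hk : InArc b'' k j := by unfold InArc at *; omega
    obtain ⟨x, hx, hx'⟩ := hP b'' j hj k hk
    rw [h] at hx
    exact absurd hx (by simp)
  · rw [mem_arc]
    unfold InArc
    omega
  · intro hk
    obtain ⟨b'', hk, hb''⟩ := (Finset.mem_filter.1 hk).2
    rw [h] at hk
    exact absurd hk (by simp)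

theorem IsSource.unique {s : Fin m → ℕ} {b b' k : Fin m} (h : IsSource s b k)
    (h' : IsSource s b' k) : b = b' := by
  by_contra hne
  have : InArc b b' k ∨ InArc b' b k := by unfold InArc; omega
  rcases this with h1 | h1
  · exact absurd (h.2 b' h1 (Ne.symm hne)) (not_lt.2 h'.1)
  · exact absurd (h'.2 b h1 hne) (not_lt.2 h.1)

/-- A parking map is determined by the multiplicities of the preferences. -/
theorem IsParkMap.ext {P P' : Fin m → Option (Fin m)} (hP : IsParkMap P) (hP' : IsParkMap P')
    (h : fiberCard P = fiberCard P') : P = P' := by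
  funext k
  rcases hk : P k with _ | b <;> rcases hk' : P' k with _ | b'
  · rfl
  · have h1 := (hP'.isSource hk').1
    have h2 := hP.sum_lt_of_none hk b'
    rw [h] at h2
    omega
  · have h1 := (hP.isSource hk).1
    have h2 := hP'.sum_lt_of_none hk' b
    rw [h] at h1
    omega
  · have h1 := hP.isSource hk
    rw [h] at h1
    rw [h1.unique (hP'.isSource hk')]

/-- Take the shortest arc ending at `k` that has at least as many cars as spots. -/
theorem exists_isSource {s : Fin m → ℕ} {b k : Fin m} (h : (arc b k).card ≤ ∑ j ∈ arc b k, s j) :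
    ∃ b', InArc b b' k ∧ IsSource s b' k := by
  classical
  let S := Finset.univ.filter fun b' => InArc b b' k ∧ (arc b' k).card ≤ ∑ j ∈ arc b' k, s j
  have hne : S.Nonempty := ⟨b, by
    refine Finset.mem_filter.2 ⟨Finset.mem_univ _, ?_, h⟩
    unfold InArc
    omega⟩
  obtain ⟨b', hb', hmin⟩ := S.exists_min_image (fun b' => (arc b' k).card) hne
  obtain ⟨-, h1, h2⟩ := Finset.mem_filter.1 hb'
  refine ⟨b', h1, h2, fun b'' h3 h4 => ?_⟩
  by_contra hcon
  have hmem : b'' ∈ S := by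
    refine Finset.mem_filter.2 ⟨Finset.mem_univ _, ?_, not_lt.1 hcon⟩
    unfold InArc at *
    omega
  exact absurd (hmin b'' hmem) (not_le.2 (card_arc_lt h3 h4))

open Classical in
/-- The outcome of parking cars with multiplicities of preferences `s`. -/
noncomputable def parkMap (s : Fin m → ℕ) (k : Fin m) : Option (Fin m) :=
  if h : ∃ b, IsSource s b k then some h.choose else none

theorem parkMap_eq_some {s : Fin m → ℕ} {b k : Fin m} :
    parkMap s k = some b ↔ IsSource s b k := by
  unfold parkMap
  split_ifs with h
  · rw [Option.some_inj]
    exact ⟨fun hb => hb ▸ h.choose_spec, fun hb => h.choose_spec.unique hb⟩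
  · refine iff_of_false (by simp) ?_
    exact fun hb => h ⟨b, hb⟩

/-- If `b` is the source of `k`, the arc from `b` to `k` has enough cars while its part after `j`
has too few. Hence the part up to `j` has enough cars and contains a source of `j`. -/
theorem isParkMap_parkMap (s : Fin m → ℕ) : IsParkMap (parkMap s) := by
  intro b k hk j hj
  simp only [parkMap_eq_some] at hk ⊢
  have hcard : (arc b j).card ≤ ∑ x ∈ arc b j, s x := by
    obtain ⟨i, hi, rfl⟩ := exists_rot b k
    obtain ⟨x, hx, rfl⟩ : ∃ x ≤ i, rot b x = j := by
      have := mem_arc.2 hj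
      rw [← congrArg (fun c => arc c (rot b i)) (rot_zero b)] at this
      rw [arc_rot b hi (Nat.zero_le i), Finset.mem_image] at this
      obtain ⟨x, hx, rfl⟩ := this
      exact ⟨x, by simp at hx; omega, rfl⟩
    have h1 := hk.1
    rw [← congrArg (fun c => arc c (rot b i)) (rot_zero b), card_arc_rot b hi (Nat.zero_le i),
      sum_arc_rot s b hi (Nat.zero_le i)] at h1
    rw [← congrArg (fun c => arc c (rot b x)) (rot_zero b),
      card_arc_rot b (by omega) (Nat.zero_le x), sum_arc_rot s b (by omega) (Nat.zero_le x)]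
    rcases hx.eq_or_lt with rfl | hlt
    · exact h1
    · have hne : rot b (x + 1) ≠ b := by
        intro h
        have := rot_injOn b (show x + 1 < m by omega) (show 0 < m by omega) (by rw [h, rot_zero])
        omega
      have harc : InArc b (rot b (x + 1)) (rot b i) := by
        rw [← mem_arc, ← congrArg (fun c => arc c (rot b i)) (rot_zero b),
          arc_rot b hi (Nat.zero_le i)]
        exact Finset.mem_image_of_mem _ (by simp; omega)
      have h2 := hk.2 _ harc hne
      rw [sum_arc_rot s b hi (by omega), card_arc_rot b hi (by omega)] at h2
      have h3 := Finset.sum_Ico_consecutive (fun x => s (rot b x)) (Nat.zero_le (x + 1))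
        (show x + 1 ≤ i + 1 by omega)
      omega
  obtain ⟨b', h1, h2⟩ := exists_isSource hcard
  exact ⟨b', h2, h1⟩

/-- Seen from `b`, the spots with source `b` are the record lows of the walk of surpluses, and their
number is the count `s b`. -/
theorem fiberCard_parkMap (s : Fin m → ℕ) (hs : ∑ j, s j ≤ m) : fiberCard (parkMap s) = s := by
  classical
  funext b
  have hm : 1 ≤ m := Fin.pos b
  have himg : Finset.univ = (Finset.range m).image (rot b) := by
    ext k
    obtain ⟨i, hi, rfl⟩ := exists_rot b k
    simp only [Finset.mem_univ, true_iff]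
    exact Finset.mem_image_of_mem _ (Finset.mem_range.2 hi)
  have hinj : Set.InjOn (rot b) (Finset.range m) := by
    rw [Finset.coe_range]
    exact rot_injOn b
  have hsum : ∑ x ∈ Finset.range m, s (rot b x) ≤ m := by
    rw [himg, Finset.sum_image hinj] at hs
    exact hs
  have hcount := card_first_hits (fun x => s (rot b x)) hm hsum
  rw [rot_zero] at hcount
  rw [← hcount, fiberCard]
  refine (Finset.card_bij (fun i _ => rot b i) ?_ ?_ ?_).symm
  · intro i hi
    obtain ⟨him, h1, h2⟩ := Finset.mem_filter.1 hi
    rw [Finset.mem_range] at him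
    refine Finset.mem_filter.2 ⟨Finset.mem_univ _, parkMap_eq_some.2 ⟨?_, ?_⟩⟩
    · rw [← congrArg (fun c => arc c (rot b i)) (rot_zero b), card_arc_rot b him (Nat.zero_le i),
        sum_arc_rot s b him (Nat.zero_le i)]
      exact h1
    · intro b' hb' hne
      rw [← mem_arc, ← congrArg (fun c => arc c (rot b i)) (rot_zero b),
        arc_rot b him (Nat.zero_le i), Finset.mem_image] at hb'
      obtain ⟨x, hx, rfl⟩ := hb'
      have hx' := Finset.mem_Ico.1 hx
      have hx0 : 0 < x := Nat.pos_of_ne_zero fun h => hne (by rw [h, rot_zero])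
      rw [sum_arc_rot s b him (by omega), card_arc_rot b him (by omega)]
      exact h2 x hx0 (by omega)
  · intro i hi j hj hij
    exact hinj (Finset.mem_coe.2 (Finset.mem_filter.1 hi).1)
      (Finset.mem_coe.2 (Finset.mem_filter.1 hj).1) hij
  · intro k hk
    obtain ⟨i, hi, rfl⟩ := exists_rot b k
    obtain ⟨h1, h2⟩ := parkMap_eq_some.1 (Finset.mem_filter.1 hk).2
    rw [← congrArg (fun c => arc c (rot b i)) (rot_zero b), card_arc_rot b hi (Nat.zero_le i),
        sum_arc_rot s b hi (Nat.zero_le i)] at h1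
    refine ⟨i, Finset.mem_filter.2 ⟨Finset.mem_range.2 hi, h1, fun x hx hxi => ?_⟩, rfl⟩
    have h3 := h2 (rot b x) (by
      rw [← mem_arc, ← congrArg (fun c => arc c (rot b i)) (rot_zero b),
        arc_rot b hi (Nat.zero_le i)]
      exact Finset.mem_image_of_mem _ (by simp; omega)) (by
      intro h
      have := rot_injOn b (show x < m by omega) (show 0 < m by omega) (by rw [h, rot_zero])
      omega)
    rwa [sum_arc_rot s b hi (by omega), card_arc_rot b hi (by omega)] at h3

end ParkingMaps

/-! ### Equivariant functions, cycle counts and eigenvalue multiplicities. -/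

section Cycles

open TypeAParking
open Equiv (Perm)

/-- A representative and a length for each cycle, fixed points included. This form serves both the
count of equivariant functions and the dimension of eigenspaces. -/
theorem exists_cycle_transversal {n : ℕ} (u : Perm (Fin n)) :
    ∃ (ι : Type) (_ : Fintype ι) (rep : ι → Fin n) (len : ι → ℕ),
      (∀ x, ∃! i, u.SameCycle (rep i) x) ∧
      (∀ i (k : ℤ), (u ^ k) (rep i) = rep i ↔ (len i : ℤ) ∣ k) ∧
      ∀ d, Nat.card {i // d ∣ len i} = cyclesDvd d u := by
  classical
  have hsupp : ∀ c : u.cycleFactorsFinset, ∃ x, x ∈ c.1.support := by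
    intro c
    exact (Perm.mem_cycleFactorsFinset_iff.1 c.2).1.nonempty_support
  choose r hr using hsupp
  have hrc : ∀ c : u.cycleFactorsFinset, u.cycleOf (r c) = c.1 := fun c =>
    (Perm.cycle_is_cycleOf (hr c) c.2).symm
  refine ⟨u.cycleFactorsFinset ⊕ {x // x ∉ u.support}, inferInstance, Sum.elim r (fun x => x.1),
    Sum.elim (fun c => c.1.support.card) (fun _ => 1), ?_, ?_, ?_⟩
  · intro x
    by_cases hx : x ∈ u.support
    · have hc : u.cycleOf x ∈ u.cycleFactorsFinset := Perm.cycleOf_mem_cycleFactorsFinset_iff.2 hx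
      refine ⟨Sum.inl ⟨u.cycleOf x, hc⟩, ?_, ?_⟩
      · have h1 := hr ⟨u.cycleOf x, hc⟩
        exact (Perm.mem_support_cycleOf_iff.1 h1).1.symm
      · rintro (c | y) h
        · have h1 : u.SameCycle (r c) x := h
          have h2 := hrc c
          rw [h1.cycleOf_eq] at h2
          exact congrArg Sum.inl (Subtype.ext h2.symm)
        · have h1 : u.SameCycle y.1 x := h
          exact absurd (h1.mem_support_iff.2 hx) y.2
    · refine ⟨Sum.inr ⟨x, hx⟩, Perm.SameCycle.refl _ _, ?_⟩
      rintro (c | y) h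
      · have h1 : u.SameCycle (r c) x := h
        refine absurd (h1.mem_support_iff.1 ?_) hx
        have := Perm.mem_cycleFactorsFinset_support_le c.2
        exact this (hr c)
      · have h1 : u.SameCycle y.1 x := h
        refine congrArg Sum.inr (Subtype.ext ?_)
        exact h1.eq_of_left (Perm.notMem_support.1 y.2)
  · rintro (c | y) k
    · have hcyc := (Perm.mem_cycleFactorsFinset_iff.1 c.2).1
      change (u ^ k) (r c) = r c ↔ ((c.1.support.card : ℕ) : ℤ) ∣ k
      rw [← hcyc.orderOf, orderOf_dvd_iff_zpow_eq_one]
      have h1 : (c.1 ^ k) (r c) = (u ^ k) (r c) := by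
        rw [← hrc c, Perm.cycleOf_zpow_apply_self]
      rw [← h1]
      refine ⟨fun h => ?_, fun h => by rw [h, Perm.one_apply]⟩
      obtain ⟨j, hj⟩ : ∃ j : ℕ, c.1 ^ j = c.1 ^ k :=
        (isOfFinOrder_of_finite c.1).mem_powers_iff_mem_zpowers.2 ⟨k, rfl⟩
      rw [← hj] at h ⊢
      exact hcyc.pow_eq_one_iff.2 ⟨r c, Perm.mem_support.1 (hr c), h⟩
    · change (u ^ k) y.1 = y.1 ↔ ((1 : ℕ) : ℤ) ∣ k
      simp [Perm.zpow_apply_eq_self_of_apply_eq_self (Perm.notMem_support.1 y.2)]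
  · intro d
    rw [Nat.card_eq_fintype_card, Fintype.card_subtype, cyclesDvd, Perm.parts_partition,
      Perm.cycleType_def, Multiset.countP_add, Multiset.countP_map, Finset.card_def,
      Finset.filter_val, ← Multiset.countP_eq_card_filter, ← Finset.univ_disjSum_univ,
      Finset.val_disjSum, Multiset.disjSum, Multiset.countP_add, Multiset.countP_map,
      Multiset.countP_map]
    congr 1
    · rw [← Multiset.countP_eq_card_filter, ← Multiset.countP_eq_card_filter]
      conv_rhs => rw [← Multiset.attach_map_val u.cycleFactorsFinset.1, Multiset.countP_map,
        ← Multiset.countP_eq_card_filter]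
      rfl
    · have h1 : Fintype.card {x // x ∉ u.support} = Fintype.card (Fin n) - u.support.card := by
        rw [Fintype.card_subtype_compl, Fintype.card_coe]
      rw [← Multiset.countP_eq_card_filter]
      by_cases hd : d ∣ 1
      · refine (Multiset.countP_eq_card.2 fun _ _ => hd).trans ?_
        rw [Multiset.countP_eq_card.2 fun _ h => Multiset.eq_of_mem_replicate h ▸ hd,
          Multiset.card_replicate, ← h1]
        rfl
      · refine (Multiset.countP_eq_zero.2 fun _ _ => hd).trans ?_
        rw [Multiset.countP_eq_zero.2 fun _ h => Multiset.eq_of_mem_replicate h ▸ hd]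

/-- Values propagate along each cycle by `σ`, and `hy` is the condition that going once around is
consistent. -/
theorem existsUnique_equivariant {α Y ι : Type*} {u : Perm α} (σ : Perm Y) {rep : ι → α}
    {len : ι → ℕ} (hrep : ∀ x, ∃! i, u.SameCycle (rep i) x)
    (hlen : ∀ i (k : ℤ), (u ^ k) (rep i) = rep i ↔ (len i : ℤ) ∣ k) (y : ι → Y)
    (hy : ∀ i, (σ ^ len i) (y i) = y i) :
    ∃! f : α → Y, (∀ x, f (u x) = σ (f x)) ∧ ∀ i, f (rep i) = y i := by
  have hpow : ∀ f : α → Y, (∀ x, f (u x) = σ (f x)) → ∀ (k : ℤ) x,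
      f ((u ^ k) x) = (σ ^ k) (f x) := by
    intro f hf k
    induction k using Int.induction_on with
    | zero => simp
    | succ k ih =>
      intro x
      rw [zpow_add_one, zpow_add_one, Perm.mul_apply, Perm.mul_apply, ih, hf]
    | pred k ih =>
      intro x
      rw [zpow_sub_one, zpow_sub_one, Perm.mul_apply, Perm.mul_apply, ih]
      congr 1
      rw [Perm.eq_inv_iff_eq, ← hf, ← Perm.mul_apply, mul_inv_cancel, Perm.one_apply]
  choose i hi hi' using hrep
  choose k hk using hi
  have hfix : ∀ j (k : ℤ), (len j : ℤ) ∣ k → (σ ^ k) (y j) = y j := by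
    rintro j _ ⟨q, rfl⟩
    rw [zpow_mul, zpow_natCast]
    exact Perm.zpow_apply_eq_self_of_apply_eq_self (hy j) q
  have hval : ∀ j (q : ℤ) x, (u ^ q) (rep j) = x → (σ ^ k x) (y (i x)) = (σ ^ q) (y j) := by
    intro j q x hq
    obtain rfl : j = i x := hi' x j ⟨q, hq⟩
    have h1 : (u ^ (-q + k x)) (rep (i x)) = rep (i x) := by
      rw [zpow_add, Perm.mul_apply, hk, zpow_neg, Perm.inv_eq_iff_eq, hq]
    have h2 := hfix _ _ ((hlen _ _).1 h1)
    rw [zpow_add, Perm.mul_apply, zpow_neg, Perm.inv_eq_iff_eq] at h2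
    exact h2
  refine ⟨fun x => (σ ^ k x) (y (i x)), ⟨fun x => ?_, fun j => ?_⟩, ?_⟩
  · change (σ ^ k (u x)) (y (i (u x))) = _
    rw [hval (i x) (1 + k x) (u x) (by rw [zpow_add, zpow_one, Perm.mul_apply, hk]), zpow_add,
      zpow_one, Perm.mul_apply]
  · change (σ ^ k (rep j)) (y (i (rep j))) = _
    rw [hval j 0 _ (by simp)]
    simp
  · rintro f ⟨hf, hf'⟩
    funext x
    conv_lhs => rw [← hk x, hpow f hf, hf']

/-- The maps `f` with `f ∘ u = σ ∘ f` are counted cycle by cycle. -/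
theorem card_equivariant {n : ℕ} {Y : Type} [Finite Y] (u : Perm (Fin n)) (σ : Perm Y) (d : ℕ)
    (h1 : ∀ k, d ∣ k → σ ^ k = 1)
    (h2 : ∀ k, ¬ d ∣ k → ∃! y, (σ ^ k) y = y) :
    Nat.card {f : Fin n → Y // ∀ x, f (u x) = σ (f x)} = Nat.card Y ^ cyclesDvd d u := by
  classical
  obtain ⟨ι, hι, rep, len, hrep, hlen, hcard⟩ := exists_cycle_transversal u
  have hfix : ∀ f : Fin n → Y, (∀ x, f (u x) = σ (f x)) → ∀ i,
      (σ ^ len i) (f (rep i)) = f (rep i) := by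
    intro f hf i
    have hp : ∀ (k : ℕ) x, f ((u ^ k) x) = (σ ^ k) (f x) := by
      intro k
      induction k with
      | zero => simp
      | succ k ih => intro x; rw [pow_succ, pow_succ, Perm.mul_apply, Perm.mul_apply, ih, hf]
    rw [← hp]
    congr 1
    exact_mod_cast (hlen i (len i)).2 dvd_rfl
  -- Only cycles of length divisible by `d` carry a free value; on the others the value is the
  -- unique fixed point of the relevant power of `σ`.
  let Φ : {f : Fin n → Y // ∀ x, f (u x) = σ (f x)} → ({i // d ∣ len i} → Y) :=
    fun f i => f.1 (rep i)
  have hΦ : Function.Bijective Φ := by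
    constructor
    · rintro ⟨f, hf⟩ ⟨g, hg⟩ h
      obtain ⟨_, -, h3⟩ := existsUnique_equivariant σ hrep hlen (fun i => f (rep i)) (hfix f hf)
      refine Subtype.ext ((h3 f ⟨hf, fun _ => rfl⟩).trans (h3 g ⟨hg, fun i => ?_⟩).symm)
      by_cases hi : d ∣ len i
      · exact (congrFun h ⟨i, hi⟩).symm
      · exact (h2 _ hi).unique (hfix g hg i) (hfix f hf i)
    · intro y
      obtain ⟨f, ⟨hf, hf'⟩, -⟩ := existsUnique_equivariant σ hrep hlen
        (fun i => if hi : d ∣ len i then y ⟨i, hi⟩ else (h2 _ hi).choose) (fun i => by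
          by_cases hi : d ∣ len i
          · simp [h1 _ hi]
          · simp only [dif_neg hi]
            exact (h2 _ hi).choose_spec.1)
      refine ⟨⟨f, hf⟩, funext fun i => ?_⟩
      exact (hf' i.1).trans (dif_pos i.2)
  rw [Nat.card_congr (Equiv.ofBijective Φ hΦ), Nat.card_fun, hcard]

theorem cox_apply {n : ℕ} (x : Fin n) : cox n x = rot x 1 := by
  obtain _ | n := n
  · exact x.elim0
  · apply Fin.ext
    rw [finRotate_apply, Fin.val_add, rot]
    simp [Nat.add_mod]

theorem rot_rot {n : ℕ} (x : Fin n) (i j : ℕ) : rot (rot x i) j = rot x (i + j) :=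
  Fin.ext (by simp [rot, add_assoc])

theorem cox_pow_apply {n : ℕ} (k : ℕ) (x : Fin n) : (cox n ^ k) x = rot x k := by
  induction k with
  | zero => rw [pow_zero, Perm.one_apply, rot_zero]
  | succ k ih => rw [pow_succ', Perm.mul_apply, ih, cox_apply, rot_rot]

theorem cox_pow_eq_self_iff {n : ℕ} {k : ℕ} {x : Fin n} : (cox n ^ k) x = x ↔ n ∣ k := by
  have hx := x.isLt
  rw [cox_pow_apply]
  constructor
  · intro h
    have h1 : ((x : ℕ) + k) % n = x := congrArg Fin.val h
    have h2 : ((x : ℕ) + k) ≡ x + 0 [MOD n] := by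
      rw [Nat.ModEq, h1, add_zero, Nat.mod_eq_of_lt hx]
    exact (Nat.modEq_zero_iff_dvd).1 (Nat.ModEq.add_left_cancel' _ h2)
  · rintro ⟨q, rfl⟩
    exact Fin.ext (by simp [rot, Nat.mod_eq_of_lt hx])

theorem cox_pow_eq_one_iff {n : ℕ} (hn : 1 ≤ n) {k : ℕ} : cox n ^ k = 1 ↔ n ∣ k := by
  constructor
  · intro h
    rw [← cox_pow_eq_self_iff (x := ⟨0, hn⟩), h, Perm.one_apply]
  · intro h
    ext x
    rw [cox_pow_eq_self_iff.2 h, Perm.one_apply]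

theorem cox_zpow_exists_pow {n : ℕ} (l : ℤ) : ∃ k : ℕ, cox n ^ l = cox n ^ k := by
  obtain ⟨j, hj⟩ : ∃ j : ℕ, cox n ^ j = cox n ^ l :=
    (isOfFinOrder_of_finite (cox n)).mem_powers_iff_mem_zpowers.2 ⟨l, rfl⟩
  exact ⟨j, hj.symm⟩

theorem cox_zpow_eq_one_iff {n : ℕ} (hn : 1 ≤ n) {l : ℤ} : cox n ^ l = 1 ↔ (n : ℤ) ∣ l := by
  have h : orderOf (cox n) = n := by
    refine Nat.dvd_antisymm (orderOf_dvd_of_pow_eq_one ((cox_pow_eq_one_iff hn).2 dvd_rfl)) ?_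
    exact (cox_pow_eq_one_iff hn).1 (pow_orderOf_eq_one _)
  rw [← orderOf_dvd_iff_zpow_eq_one, h]

theorem cox_zpow_apply_eq_self {n : ℕ} {l : ℤ} {x : Fin n} (h : (cox n ^ l) x = x) :
    cox n ^ l = 1 := by
  obtain ⟨k, hk⟩ := cox_zpow_exists_pow (n := n) l
  rw [hk] at h ⊢
  exact (cox_pow_eq_one_iff (Fin.pos x)).2 (cox_pow_eq_self_iff.1 h)

/-- A power of the `n`-cycle is the identity as soon as it fixes a point, so nontrivial powers of
`c^l` fix only the added point. -/
theorem ncard_equivariantFunctions {n : ℕ} (u : Perm (Fin n)) (l : ℤ) :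
    (equivariantFunctions u l).ncard = (n + 1) ^ cyclesDvd (orderOf (cox n ^ l)) u := by
  have hpow : ∀ (k : ℕ) (y : Option (Fin n)),
      ((Equiv.optionCongr (cox n ^ l) : Perm (Option (Fin n))) ^ k) y =
        y.map ((cox n ^ l) ^ k : Perm (Fin n)) := by
    intro k y
    induction k with
    | zero => cases y <;> simp
    | succ k ih =>
      rw [pow_succ', Perm.mul_apply, ih, pow_succ']
      cases y <;> simp
  have h := card_equivariant u (Y := Option (Fin n)) (Equiv.optionCongr (cox n ^ l))
    (orderOf (cox n ^ l)) ?_ ?_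
  · rw [Finite.card_option, Nat.card_fin] at h
    rw [← h, ← Nat.card_coe_set_eq]
    rfl
  · intro k hk
    ext1 y
    rw [hpow, orderOf_dvd_iff_pow_eq_one.1 hk]
    cases y <;> simp
  · intro k hk
    refine ⟨none, hpow k none, ?_⟩
    rintro (_ | y) h
    · rfl
    · replace h := (hpow k _).symm.trans h
      refine absurd (orderOf_dvd_iff_pow_eq_one.2 ?_) hk
      have h1 := Option.some_injective _ h
      rw [← zpow_natCast, ← zpow_mul] at h1 ⊢
      exact cox_zpow_apply_eq_self h1

/-- The eigenspace of functions with `f ∘ u = a f`. -/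
def semiinvariants {n : ℕ} (u : Perm (Fin n)) (a : ℂ) : Submodule ℂ (Fin n → ℂ) :=
  LinearMap.eqLocus (LinearMap.funLeft ℂ ℂ u) (a • LinearMap.id)

theorem mem_semiinvariants {n : ℕ} {u : Perm (Fin n)} {a : ℂ} {f : Fin n → ℂ} :
    f ∈ semiinvariants u a ↔ ∀ x, f (u x) = a * f x :=
  funext_iff

/-- A solution is free on a cycle whose length is a multiple of the order `d` of `a` and vanishes on
every other cycle. -/
theorem finrank_semiinvariants {n : ℕ} (u : Perm (Fin n)) {a : ℂ} (ha : a ≠ 0) {d : ℕ}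
    (hd : ∀ k : ℕ, a ^ k = 1 ↔ d ∣ k) :
    Module.finrank ℂ (semiinvariants u a) = cyclesDvd d u := by
  classical
  obtain ⟨ι, hι, rep, len, hrep, hlen, hcard⟩ := exists_cycle_transversal u
  let σ : Perm ℂ := Equiv.mulLeft₀ a ha
  have hσ : ∀ (k : ℕ) z, (σ ^ k) z = a ^ k * z := by
    intro k z
    induction k with
    | zero => simp
    | succ k ih =>
      rw [pow_succ', Perm.mul_apply, ih, pow_succ', mul_assoc]
      rfl
  have hfix : ∀ f ∈ semiinvariants u a, ∀ i, (σ ^ len i) (f (rep i)) = f (rep i) := by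
    intro f hf i
    rw [mem_semiinvariants] at hf
    have hp : ∀ (k : ℕ) x, f ((u ^ k) x) = a ^ k * f x := by
      intro k
      induction k with
      | zero => simp
      | succ k ih => intro x; rw [pow_succ, pow_succ, Perm.mul_apply, ih, hf, mul_assoc]
    rw [hσ, ← hp]
    congr 1
    exact_mod_cast (hlen i (len i)).2 dvd_rfl
  let Φ : semiinvariants u a →ₗ[ℂ] ({i // d ∣ len i} → ℂ) :=
    LinearMap.funLeft ℂ ℂ (fun i => rep i.1) ∘ₗ (semiinvariants u a).subtype
  have hzero : ∀ i, ¬ d ∣ len i → ∀ f ∈ semiinvariants u a, f (rep i) = 0 := by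
    intro i hi f hf
    have h1 := hfix f hf i
    rw [hσ] at h1
    by_contra h0
    exact hi ((hd _).1 (mul_eq_right₀ h0 |>.1 h1))
  have hΦ : Function.Bijective Φ := by
    constructor
    · rintro ⟨f, hf⟩ ⟨g, hg⟩ h
      obtain ⟨_, -, h3⟩ := existsUnique_equivariant σ hrep hlen (fun i => f (rep i)) (hfix f hf)
      refine Subtype.ext ((h3 f ⟨mem_semiinvariants.1 hf, fun _ => rfl⟩).trans
        (h3 g ⟨mem_semiinvariants.1 hg, fun i => ?_⟩).symm)
      by_cases hi : d ∣ len i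
      · exact (congrFun h ⟨i, hi⟩).symm
      · rw [hzero i hi f hf, hzero i hi g hg]
    · intro y
      obtain ⟨f, ⟨hf, hf'⟩, -⟩ := existsUnique_equivariant σ hrep hlen
        (fun i => if hi : d ∣ len i then y ⟨i, hi⟩ else 0) (fun i => by
          rw [hσ]
          by_cases hi : d ∣ len i
          · rw [(hd _).2 hi, one_mul]
          · rw [dif_neg hi, mul_zero])
      refine ⟨⟨f, mem_semiinvariants.2 hf⟩, funext fun i => ?_⟩
      exact (hf' i.1).trans (dif_pos i.2)
  rw [(LinearEquiv.ofBijective Φ hΦ).finrank_eq, Module.finrank_pi, ← hcard,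
    Nat.card_eq_fintype_card]

theorem mem_eigenspace_reflRep {n : ℕ} {u : Perm (Fin n)} {z : ℂ} (hz : z ≠ 0)
    {x : reflSpace ℂ n} :
    x ∈ Module.End.eigenspace (reflRep ℂ n u) z ↔ x.1 ∈ semiinvariants u z⁻¹ := by
  rw [Module.End.mem_eigenspace_iff, mem_semiinvariants, Subtype.ext_iff, funext_iff,
    u.surjective.forall]
  refine forall_congr' fun j => ?_
  have h1 : (reflRep ℂ n u x).1 (u j) = x.1 j := by
    change x.1 (u⁻¹ (u j)) = _
    rw [← Perm.mul_apply, inv_mul_cancel, Perm.one_apply]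
  rw [h1]
  change x.1 j = z * x.1 (u j) ↔ _
  rw [eq_inv_mul_iff_mul_eq₀ hz, eq_comm]

/-- The reflection representation is the kernel of the coordinate sum. Permutation invariance of the
sum makes it vanish on an eigenspace with `z ≠ 1`; for `z = 1` the constant vector shows that it
does not vanish. -/
theorem eigMult_add {n : ℕ} (u : Perm (Fin n)) {z : ℂ} (hz : z ≠ 0) :
    eigMult u z + (if z = 1 ∧ 1 ≤ n then 1 else 0) =
      Module.finrank ℂ (semiinvariants u z⁻¹) := by
  let s : semiinvariants u z⁻¹ →ₗ[ℂ] ℂ :=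
    (∑ i, LinearMap.proj i) ∘ₗ (semiinvariants u z⁻¹).subtype
  have hs : ∀ f, s f = ∑ i, f.1 i := fun f => by simp [s]
  have hker : eigMult u z = Module.finrank ℂ s.ker := by
    refine LinearEquiv.finrank_eq (LinearEquiv.ofBijective
      ((((reflSpace ℂ n).subtype ∘ₗ
        (Module.End.eigenspace (reflRep ℂ n u) z).subtype).codRestrict _
          fun x => (mem_eigenspace_reflRep hz).1 x.2).codRestrict s.ker fun x => ?_) ⟨?_, ?_⟩)
    · rw [LinearMap.mem_ker, hs]
      exact x.1.2
    · intro x y h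
      exact Subtype.ext (Subtype.ext (congrArg (fun v => v.1.1) h))
    · intro f
      have h1 : ∑ i, f.1.1 i = 0 := by
        rw [← hs]
        exact f.2
      exact ⟨⟨⟨f.1.1, h1⟩, (mem_eigenspace_reflRep hz).2 f.1.2⟩, rfl⟩
  have hrange : Module.finrank ℂ s.range = if z = 1 ∧ 1 ≤ n then 1 else 0 := by
    split_ifs with h
    · obtain ⟨rfl, hn⟩ := h
      have h1 : s.range = ⊤ := by
        refine LinearMap.range_eq_top.2 (s.surjective ?_)
        intro h0
        have h2 := hs ⟨fun _ => 1, mem_semiinvariants.2 fun _ => by simp⟩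
        rw [h0] at h2
        have : (n : ℂ) = 0 := by simpa using h2.symm
        have := Nat.cast_eq_zero.1 this
        omega
      rw [h1, finrank_top, Module.finrank_self]
    · have h1 : s = 0 := by
        ext f
        have h2 : s f = z⁻¹ * s f := by
          rw [hs, Finset.mul_sum, ← Equiv.sum_comp u]
          exact Finset.sum_congr rfl fun i _ => mem_semiinvariants.1 f.2 i
        rw [LinearMap.zero_apply]
        by_contra h0
        have hz1 : z = 1 := by
          have := mul_eq_right₀ h0 |>.1 h2.symm
          simpa using this
        obtain rfl : n = 0 := by
          by_contra hn
          exact h ⟨hz1, by omega⟩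
        exact h0 (by rw [hs]; simp)
      rw [h1, LinearMap.range_zero, finrank_bot]
  have := s.finrank_range_add_finrank_ker
  omega

theorem omega_zpow_eq_one_iff {n : ℕ} (hn : 1 ≤ n) (l : ℤ) :
    omega n ^ l = 1 ↔ cox n ^ l = 1 := by
  rw [cox_zpow_eq_one_iff hn]
  exact (Complex.isPrimitiveRoot_exp n (by omega)).zpow_eq_one_iff_dvd l

theorem eigMult_omega {n : ℕ} (hn : 1 ≤ n) (u : Perm (Fin n)) (l : ℤ) :
    eigMult u (omega n ^ l) + (if cox n ^ l = 1 then 1 else 0) =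
      cyclesDvd (orderOf (cox n ^ l)) u := by
  have hz := zpow_ne_zero l (omega_ne_zero n)
  rw [← finrank_semiinvariants u (inv_ne_zero hz) (d := orderOf (cox n ^ l)), ← eigMult_add u hz]
  · simp [hn, omega_zpow_eq_one_iff]
  · intro k
    rw [inv_pow, inv_eq_one, orderOf_dvd_iff_pow_eq_one, ← zpow_natCast, ← zpow_mul,
      omega_zpow_eq_one_iff hn, ← zpow_natCast, ← zpow_mul]

theorem cyclesDvd_inv {n : ℕ} (d : ℕ) (u : Perm (Fin n)) : cyclesDvd d u⁻¹ = cyclesDvd d u := by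
  simp [cyclesDvd, Perm.parts_partition]

end Cycles

/-! ### Reflection length as the codimension of the invariants. -/

section ReflectionLength

open TypeAParking
open Equiv (Perm)

variable {n : ℕ}

/-- The dimension of the space of functions on `Fin n` that are invariant under `w`. -/
noncomputable def invDim (w : Perm (Fin n)) : ℕ := Module.finrank ℂ (semiinvariants w 1)

theorem mem_invariants {w : Perm (Fin n)} {f : Fin n → ℂ} :
    f ∈ semiinvariants w 1 ↔ ∀ x, f (w x) = f x := by
  simp [mem_semiinvariants]

theorem invDim_le (w : Perm (Fin n)) : invDim w ≤ n := by
  have := (semiinvariants w 1).finrank_le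
  rwa [Module.finrank_pi, Fintype.card_fin] at this

theorem invDim_one : invDim (1 : Perm (Fin n)) = n := by
  have : semiinvariants (1 : Perm (Fin n)) 1 = ⊤ := by
    ext f
    simp [mem_invariants]
  rw [invDim, this, finrank_top]
  simp

/-- The single linear condition `f a = f b` makes a function invariant under `w` also invariant
under the product. -/
theorem invDim_le_mul_swap (w : Perm (Fin n)) (a b : Fin n) :
    invDim w ≤ invDim (w * Equiv.swap a b) + 1 := by
  let φ : semiinvariants w 1 →ₗ[ℂ] ℂ :=
    ((LinearMap.proj a : (Fin n → ℂ) →ₗ[ℂ] ℂ) - LinearMap.proj b) ∘ₗ (semiinvariants w 1).subtype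
  have h1 := φ.finrank_range_add_finrank_ker
  have h2 : Module.finrank ℂ φ.range ≤ 1 := by
    simpa using φ.range.finrank_le
  have h3 : φ.ker.map (semiinvariants w 1).subtype ≤ semiinvariants (w * Equiv.swap a b) 1 := by
    rintro _ ⟨f, hf, rfl⟩
    have hab : f.1 a = f.1 b := sub_eq_zero.1 hf
    have hw := mem_invariants.1 f.2
    refine mem_invariants.2 fun x => ?_
    change f.1 (w (Equiv.swap a b x)) = f.1 x
    rw [hw, Equiv.swap_apply_def]
    split_ifs with h h'
    · rw [h, hab]
    · rw [h', hab]
    · rfl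
  have h4 := Submodule.finrank_mono h3
  rw [Submodule.finrank_map_subtype_eq] at h4
  unfold invDim
  omega

theorem invDim_le_mul_prod (w : Perm (Fin n)) (L : List (Perm (Fin n)))
    (hL : ∀ t ∈ L, t.IsSwap) : invDim w ≤ invDim (w * L.prod) + L.length := by
  induction L generalizing w with
  | nil => simp
  | cons t L ih =>
    obtain ⟨a, b, -, rfl⟩ := hL t (by simp)
    have h1 := invDim_le_mul_swap w a b
    have h2 := ih (w * Equiv.swap a b) fun t ht => hL t (by simp [ht])
    rw [List.prod_cons, ← mul_assoc, List.length_cons]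
    omega

theorem exists_prod_swaps (w : Perm (Fin n)) :
    ∃ L : List (Perm (Fin n)), (∀ t ∈ L, t.IsSwap) ∧ L.length + invDim w ≤ n ∧ L.prod = w := by
  induction hd : n - invDim w using Nat.strong_induction_on generalizing w with
  | _ d ih =>
    by_cases hw : w = 1
    · exact ⟨[], by simp, by simpa using invDim_le w, by simp [hw]⟩
    · obtain ⟨a, ha⟩ : ∃ a, w a ≠ a := by
        by_contra! h
        exact hw (Equiv.ext h)
      have hwa : w (w⁻¹ a) = a := by rw [← Perm.mul_apply, mul_inv_cancel, Perm.one_apply]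
      have hne : a ≠ w⁻¹ a := fun h => ha (by rw [h, hwa, ← h])
      -- The product fixes `a`, so the indicator of `a` becomes a new invariant function.
      have hlt : semiinvariants w 1 < semiinvariants (w * Equiv.swap a (w⁻¹ a)) 1 := by
        refine lt_of_le_of_ne ?_ ?_
        · intro f hf
          rw [mem_invariants] at hf ⊢
          have h1 : f a = f (w⁻¹ a) := by rw [← hf (w⁻¹ a), hwa]
          intro x
          rw [Perm.mul_apply, hf, Equiv.swap_apply_def]
          split_ifs with h h'
          · rw [h, h1]
          · rw [h', h1]
          · rfl
        · intro heq
          have h1 : (Pi.single a 1 : Fin n → ℂ) ∈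
              semiinvariants (w * Equiv.swap a (w⁻¹ a)) 1 := by
            refine mem_invariants.2 fun x => ?_
            have h2 : (w * Equiv.swap a (w⁻¹ a)) x = a ↔ x = a := by
              rw [Perm.mul_apply, ← Perm.eq_inv_iff_eq, Equiv.swap_apply_eq_iff,
                Equiv.swap_apply_right]
            simp only [Pi.single_apply, h2]
          rw [← heq, mem_invariants] at h1
          have h2 := h1 a
          rw [Pi.single_eq_same, Pi.single_eq_of_ne ha] at h2
          exact zero_ne_one h2
      have h1 := Submodule.finrank_lt_finrank_of_lt hlt
      change invDim w < invDim (w * Equiv.swap a (w⁻¹ a)) at h1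
      have h2 := invDim_le (w * Equiv.swap a (w⁻¹ a))
      obtain ⟨L, hL, hlen, hprod⟩ := ih _ (by omega) (w * Equiv.swap a (w⁻¹ a)) rfl
      refine ⟨L ++ [Equiv.swap a (w⁻¹ a)], ?_, ?_, ?_⟩
      · intro t ht
        rcases List.mem_append.1 ht with h | h
        · exact hL t h
        · rw [List.mem_singleton.1 h]
          exact ⟨a, _, hne, rfl⟩
      · rw [List.length_append, List.length_singleton]
        omega
      · rw [List.prod_append, hprod, List.prod_singleton, mul_assoc, Equiv.swap_mul_self, mul_one]

theorem reflLength_le {w : Perm (Fin n)} {L : List (Perm (Fin n))} (hL : ∀ t ∈ L, t.IsSwap)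
    (h : L.prod = w) : reflLength w ≤ L.length :=
  Nat.sInf_le ⟨L, hL, rfl, h⟩

theorem exists_reduced (w : Perm (Fin n)) : ∃ L : List (Perm (Fin n)),
    (∀ t ∈ L, t.IsSwap) ∧ L.length = reflLength w ∧ L.prod = w := by
  obtain ⟨L, h1, -, h2⟩ := exists_prod_swaps w
  exact Nat.sInf_mem (s := {k | ∃ L : List (Perm (Fin n)), (∀ t ∈ L, t.IsSwap) ∧
    L.length = k ∧ L.prod = w}) ⟨_, L, h1, rfl, h2⟩

theorem reflLength_add_invDim (w : Perm (Fin n)) : reflLength w + invDim w = n := by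
  refine le_antisymm ?_ ?_
  · obtain ⟨L, h1, h2, h3⟩ := exists_prod_swaps w
    have := reflLength_le h1 h3
    omega
  · obtain ⟨L, h1, h2, h3⟩ := exists_reduced w
    have h4 := invDim_le_mul_prod 1 L h1
    rw [one_mul, h3, invDim_one] at h4
    omega

theorem absLE_one (w : Perm (Fin n)) : AbsLE 1 w := by
  have h1 := reflLength_add_invDim (1 : Perm (Fin n))
  rw [invDim_one] at h1
  rw [AbsLE, inv_one, one_mul]
  omega

/-- On the cycle of `a` under `w`, the equality `f (w x) = f x` is immediate except at `a`. Since
`w` permutes this cycle, the sums of both sides over it agree, which forces the equality at `a` as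
well. -/
theorem invariant_of_mul_swap {w : Perm (Fin n)} {a b : Fin n} (hab : ¬ w.SameCycle a b)
    {f : Fin n → ℂ} (hf : f ∈ semiinvariants (w * Equiv.swap a b) 1) :
    f ∈ semiinvariants w 1 ∧ f a = f b := by
  classical
  rw [mem_invariants] at hf
  have hne : a ≠ b := fun h => hab (h ▸ Perm.SameCycle.refl _ _)
  have h1 : ∀ x, x ≠ a → x ≠ b → f (w x) = f x := by
    intro x hxa hxb
    have := hf x
    rwa [Perm.mul_apply, Equiv.swap_apply_of_ne_of_ne hxa hxb] at this
  have h2 : f (w b) = f a := by simpa using hf a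
  have h3 : f (w a) = f b := by simpa using hf b
  have h4 : f (w a) = f a := by
    let S := Finset.univ.filter fun x => w.SameCycle a x
    have h5 : ∑ x ∈ S, f (w x) = ∑ x ∈ S, f x := by
      refine Finset.sum_equiv w (fun x => ?_) fun x _ => rfl
      simp [S]
    have haS : a ∈ S := by simp [S, Perm.SameCycle.refl]
    rw [← Finset.add_sum_erase _ _ haS, ← Finset.add_sum_erase _ f haS] at h5
    have h6 : ∑ x ∈ S.erase a, f (w x) = ∑ x ∈ S.erase a, f x := by
      refine Finset.sum_congr rfl fun x hx => h1 x (Finset.ne_of_mem_erase hx) ?_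
      rintro rfl
      exact hab (Finset.mem_filter.1 (Finset.mem_of_mem_erase hx)).2
    rw [h6] at h5
    exact add_right_cancel h5
  have h5 : f a = f b := h4.symm.trans h3
  refine ⟨mem_invariants.2 fun x => ?_, h5⟩
  by_cases hxa : x = a
  · rw [hxa, h4]
  · by_cases hxb : x = b
    · rw [hxb, h2, h5]
    · exact h1 x hxa hxb

theorem invDim_mul_swap_lt {w : Perm (Fin n)} {a b : Fin n} (hab : ¬ w.SameCycle a b) :
    invDim (w * Equiv.swap a b) < invDim w := by
  classical
  refine Submodule.finrank_lt_finrank_of_lt (lt_of_le_of_ne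
    (fun f hf => (invariant_of_mul_swap hab hf).1) fun heq => ?_)
  have h1 : (fun x => if w.SameCycle a x then 1 else 0 : Fin n → ℂ) ∈ semiinvariants w 1 :=
    mem_invariants.2 fun x => by simp
  rw [← heq] at h1
  have h2 := (invariant_of_mul_swap hab h1).2
  simp [hab, Perm.SameCycle.refl] at h2

end ReflectionLength

/-! ### The interval below the Coxeter element in terms of arcs. -/

section Noncrossing

open TypeAParking
open Equiv (Perm)

variable {n : ℕ}

/-- Going forward from `a`, one meets `b` strictly before `c`, and both before returning. -/
def Between (a b c : Fin n) : Prop := (a < b ∧ b < c) ∨ (b < c ∧ c < a) ∨ (c < a ∧ a < b)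

/-- Every open cyclic arc from a point to its image is invariant under `w`. -/
def ArcInvariant (w : Perm (Fin n)) : Prop :=
  ∀ x y, Between x y (w x) → Between x (w y) (w x)

/-- No two classes of the equivalence relation cross. -/
def IsNoncrossing (r : Setoid (Fin n)) : Prop :=
  ∀ a b c d, r a c → r b d → Between a b c → Between c d a → r a b

theorem ArcInvariant.sameCycle {w : Perm (Fin n)} (hw : ArcInvariant w) {x a b : Fin n}
    (hab : w.SameCycle a b) (h : Between x a (w x)) : Between x b (w x) := by
  obtain ⟨k, rfl⟩ := hab.exists_nat_pow_eq
  clear hab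
  induction k with
  | zero => exact h
  | succ k ih => rw [pow_succ', Perm.mul_apply]; exact hw _ _ ih

theorem ne_apply_of_sameCycle {w : Perm (Fin n)} {a b : Fin n} (hab : w.SameCycle a b)
    (hne : a ≠ b) : w a ≠ a :=
  fun h => hne (hab.eq_of_left h)

theorem ArcInvariant.between_mul_swap {w : Perm (Fin n)} (hw : ArcInvariant w) {a b : Fin n}
    (hab : w.SameCycle a b) (hne : a ≠ b) (y : Fin n) (h : Between a y (w b)) :
    Between a ((w * Equiv.swap a b) y) (w b) := by
  have hb := ne_apply_of_sameCycle hab.symm hne.symm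
  have ha := ne_apply_of_sameCycle hab hne
  have h1 : ¬ Between b a (w b) := fun h' => by
    have := hw.sameCycle hab h'
    unfold Between at this
    omega
  have h2 : ¬ Between a b (w a) := fun h' => by
    have := hw.sameCycle hab.symm h'
    unfold Between at this
    omega
  rw [Perm.mul_apply]
  by_cases hyb : y = b
  · rw [hyb, Equiv.swap_apply_right]
    have : w a ≠ w b := fun h' => hne (w.injective h')
    unfold Between at *
    omega
  · have hya : y ≠ a := by unfold Between at h; omega
    rw [Equiv.swap_apply_of_ne_of_ne hya hyb]
    have h3 : w y ≠ w b := fun h' => hyb (w.injective h')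
    by_cases h4 : Between b y (w b)
    · have h5 := hw b y h4
      have hawb : a ≠ w b := by
        unfold Between at h
        omega
      clear h4 h h2
      unfold Between at h1 h5 ⊢
      omega
    · by_contra hcon
      have h5 : Between y b (w y) ∧ ¬ Between y a (w y) := by
        clear h2
        unfold Between at *
        constructor <;> omega
      exact h5.2 (hw.sameCycle hab.symm h5.1)

/-- Multiplication by the swap cuts one cycle into two. Arcs from other points still contain a whole
cycle of `w` or none of it; the two new arcs, from `a` to `w b` and from `b` to `w a`, are symmetric
to each other. -/
theorem ArcInvariant.mul_swap {w : Perm (Fin n)} (hw : ArcInvariant w) {a b : Fin n}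
    (hab : w.SameCycle a b) (hne : a ≠ b) : ArcInvariant (w * Equiv.swap a b) := by
  intro x y h
  by_cases hxa : x = a
  · subst hxa
    have h1 : (w * Equiv.swap x b) x = w b := by simp
    rw [h1] at h ⊢
    exact hw.between_mul_swap hab hne y h
  by_cases hxb : x = b
  · subst hxb
    have h1 : (w * Equiv.swap a x) x = w a := by simp
    rw [h1] at h ⊢
    rw [Equiv.swap_comm]
    exact hw.between_mul_swap hab.symm (Ne.symm hne) y h
  · have h1 : (w * Equiv.swap a b) x = w x := by
      rw [Perm.mul_apply, Equiv.swap_apply_of_ne_of_ne hxa hxb]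
    rw [h1] at h ⊢
    refine hw.sameCycle ?_ h
    rw [Perm.mul_apply, Perm.sameCycle_apply_right, Equiv.swap_apply_def]
    split_ifs with h h'
    · rw [h]; exact hab
    · rw [h']; exact hab.symm
    · exact Perm.SameCycle.refl _ _

theorem cox_val (x : Fin n) : ((cox n x : Fin n) : ℕ) = x + 1 ∨
    ((cox n x : Fin n) : ℕ) = 0 ∧ (x : ℕ) + 1 = n := by
  rw [cox_apply]
  have hx := x.isLt
  rcases Nat.lt_or_ge (x + 1) n with h | h
  · left; exact Nat.mod_eq_of_lt h
  · right
    refine ⟨?_, by omega⟩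
    change ((x : ℕ) + 1) % n = 0
    rw [show (x : ℕ) + 1 = n by omega, Nat.mod_self]

theorem arcInvariant_cox : ArcInvariant (cox n) := by
  intro x y h
  have h1 := cox_val x
  have := y.isLt
  unfold Between at h
  omega

/-- A swap raises the dimension of invariants by at most one, so under the hypothesis every swap
raises it. A swap of points from different cycles would lower it; hence each one cuts a cycle and
arc invariance persists. -/
theorem arcInvariant_of_reflLength {w : Perm (Fin n)} (hw : ArcInvariant w)
    (L : List (Perm (Fin n))) (hL : ∀ t ∈ L, t.IsSwap)
    (h : invDim w + L.length ≤ invDim (w * L.prod)) : ArcInvariant (w * L.prod) := by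
  induction L generalizing w with
  | nil => simpa using hw
  | cons t L ih =>
    obtain ⟨a, b, hne, rfl⟩ := hL t (by simp)
    have hL' : ∀ t ∈ L, t.IsSwap := fun t ht => hL t (by simp [ht])
    rw [List.prod_cons, ← mul_assoc] at h ⊢
    rw [List.length_cons] at h
    have h1 : ∀ v : Perm (Fin n), invDim (v * L.prod) ≤ invDim v + L.length := by
      intro v
      have := invDim_le_mul_prod (v * L.prod) L.reverse fun t ht => hL' t (by simpa using ht)
      rw [mul_assoc, List.length_reverse] at this
      have h5 : ∀ L : List (Perm (Fin n)), (∀ t ∈ L, t.IsSwap) →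
          L.prod * L.reverse.prod = 1 := by
        intro L
        induction L with
        | nil => simp
        | cons t L ih =>
          intro h
          obtain ⟨a, b, -, rfl⟩ := h t (by simp)
          rw [List.prod_cons, List.reverse_cons, List.prod_append, List.prod_singleton, mul_assoc,
            ← mul_assoc L.prod, ih fun t ht => h t (by simp [ht]), one_mul, Equiv.swap_mul_self]
      rwa [h5 L hL', mul_one] at this
    have h2 := h1 (w * Equiv.swap a b)
    have h3 := invDim_le_mul_swap (w * Equiv.swap a b) a b
    rw [mul_assoc w, Equiv.swap_mul_self, mul_one] at h3
    have hab : w.SameCycle a b := by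
      by_contra hab
      have := invDim_mul_swap_lt hab
      omega
    exact ih (hw.mul_swap hab hne) hL' (by omega)

theorem invDim_cox (hn : 1 ≤ n) : invDim (cox n) = 1 := by
  have h1 : 1 ≤ invDim (cox n) := by
    by_contra h
    have h0 : invDim (cox n) = 0 := by omega
    have h2 := Submodule.finrank_eq_zero.1 h0
    have h3 : (fun _ => 1 : Fin n → ℂ) ∈ semiinvariants (cox n) 1 :=
      mem_invariants.2 fun _ => rfl
    rw [h2, Submodule.mem_bot] at h3
    exact one_ne_zero (congrFun h3 ⟨0, hn⟩)
  let φ : semiinvariants (cox n) 1 →ₗ[ℂ] ℂ :=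
    LinearMap.proj (⟨0, hn⟩ : Fin n) ∘ₗ (semiinvariants (cox n) 1).subtype
  have h2 : Function.Injective φ := by
    rintro ⟨f, hf⟩ ⟨g, hg⟩ h
    have key : ∀ f ∈ semiinvariants (cox n) 1, ∀ k, f (rot ⟨0, hn⟩ k) = f ⟨0, hn⟩ := by
      intro f hf k
      rw [mem_invariants] at hf
      induction k with
      | zero => rw [rot_zero]
      | succ k ih => rw [← rot_rot, ← cox_apply, hf, ih]
    refine Subtype.ext (funext fun x => ?_)
    obtain ⟨k, -, rfl⟩ := exists_rot ⟨0, hn⟩ x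
    exact (key f hf k).trans (Eq.trans h (key g hg k).symm)
  have h3 := LinearMap.finrank_le_finrank_of_injective h2
  rw [Module.finrank_self] at h3
  exact le_antisymm h3 h1

theorem ArcInvariant.of_absLE {w : Perm (Fin n)} (h : AbsLE w (cox n)) :
    ArcInvariant w := by
  obtain ⟨L, h1, h2, h3⟩ := exists_reduced (w⁻¹ * cox n)⁻¹
  have hw : w = cox n * L.prod := by rw [h3]; group
  have hinv : invDim (w⁻¹ * cox n)⁻¹ = invDim (w⁻¹ * cox n) := by
    have : semiinvariants (w⁻¹ * cox n)⁻¹ 1 = semiinvariants (w⁻¹ * cox n) 1 := by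
      ext f
      rw [mem_invariants, mem_invariants, (w⁻¹ * cox n).surjective.forall]
      refine forall_congr' fun x => ?_
      rw [← Perm.mul_apply, inv_mul_cancel, Perm.one_apply, eq_comm]
    rw [invDim, this, invDim]
  have e1 := reflLength_add_invDim w
  have e2 := reflLength_add_invDim (cox n)
  have e3 := reflLength_add_invDim (w⁻¹ * cox n)
  have e4 := reflLength_add_invDim (w⁻¹ * cox n)⁻¹
  unfold AbsLE at h
  rw [hw]
  refine arcInvariant_of_reflLength arcInvariant_cox L h1 ?_
  rw [← hw]
  omega

/-- Unless `w = c`, some point `x` is not sent to its successor. Swapping `x` with the preimage `e`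
of that successor merges two cycles, corrects the image of `x` and keeps arc invariance, so
induction on the number of cycles ends at `c`. -/
theorem ArcInvariant.exists_prod {w : Perm (Fin n)} (hw : ArcInvariant w) (hn : 1 ≤ n) :
    ∃ L : List (Perm (Fin n)), (∀ t ∈ L, t.IsSwap) ∧ L.length + 1 ≤ invDim w ∧
      w * L.prod = cox n := by
  induction hd : invDim w using Nat.strong_induction_on generalizing w with
  | _ d ih =>
    by_cases hwc : w = cox n
    · refine ⟨[], by simp, ?_, by simp [hwc]⟩
      rw [← hd, hwc, invDim_cox hn]
      simp
    · obtain ⟨x, hx⟩ : ∃ x, w x ≠ cox n x := by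
        by_contra! h
        exact hwc (Equiv.ext h)
      obtain ⟨e, he⟩ := w.surjective (cox n x)
      have hcx := cox_val x
      -- The successor of `x` lies in the open arc from `x` to `w x`. If it were in the cycle of
      -- `x`, arc invariance would place `x` itself in that open arc.
      have hex : ¬ w.SameCycle x e := by
        intro h
        have h1 : w.SameCycle x (cox n x) := by rw [← he, Perm.sameCycle_apply_right]; exact h
        have hne : x ≠ cox n x := fun h' => hx (by
          have : n = 1 := by
            have := x.isLt
            omega
          subst this
          exact Subsingleton.elim _ _)
        have h2 := ne_apply_of_sameCycle h1 hne
        have h3 : Between x (cox n x) (w x) := by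
          have := (w x).isLt
          have := x.isLt
          unfold Between
          omega
        have h4 := hw.sameCycle h1.symm h3
        unfold Between at h4
        omega
      have hxe : x ≠ e := fun h => hex (h ▸ Perm.SameCycle.refl _ _)
      have hlt := invDim_mul_swap_lt hex
      have hmem : w.SameCycle e (cox n x) := by
        rw [← he, Perm.sameCycle_apply_right]
      have harc : ArcInvariant (w * Equiv.swap x e) := by
        -- The cycle of `e` contains the successor of `x`, and an arc ending at neither of the two
        -- contains `x` exactly when it contains that successor.
        have hI : ∀ z, z ≠ x → z ≠ e → (Between z x (w z) ↔ Between z e (w z)) := by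
          intro z hzx hze
          have hwz : w z ≠ cox n x := fun h => hze (w.injective (h.trans he.symm))
          have h1 : Between z e (w z) ↔ Between z (cox n x) (w z) :=
            ⟨hw.sameCycle hmem, hw.sameCycle hmem.symm⟩
          rw [h1]
          have := (w z).isLt
          have := x.isLt
          have := z.isLt
          unfold Between
          omega
        intro z y h
        by_cases hzx : z = x
        · rw [hzx] at h
          have h1 : (w * Equiv.swap x e) x = cox n x := by simp [he]
          rw [h1] at h
          have := y.isLt
          unfold Between at h
          omega
        by_cases hze : z = e
        · rw [hze] at h ⊢
          have h1 : (w * Equiv.swap x e) e = w x := by simp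
          rw [h1] at h ⊢
          have hye : y ≠ e := by unfold Between at h; omega
          have hyb : w y ≠ cox n x := fun h => hye (w.injective (h.trans he.symm))
          have h2 : w x ≠ x → Between x e (w x) := by
            intro hwx
            refine hw.sameCycle hmem.symm ?_
            have := (w x).isLt
            unfold Between
            omega
          have hyx : w y ≠ w x := fun h' => by
            rw [w.injective h'] at h
            clear hI
            unfold Between at *
            omega
          rw [Perm.mul_apply, Equiv.swap_apply_of_ne_of_ne (fun h' => hyx (by rw [h'])) hye]
          have f1 : e ≠ cox n x → Between e (w y) (cox n x) := by
            intro hne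
            rw [← he]
            refine hw e y ?_
            rw [he]
            by_cases hwx : w x = x
            · rw [hwx] at h
              clear hI h2
              have := e.isLt
              have := y.isLt
              unfold Between at h ⊢
              omega
            · specialize h2 hwx
              have := e.isLt
              have := y.isLt
              clear hI
              unfold Between at *
              omega
          by_cases hwx : w x = x
          · rw [hwx] at h hyx ⊢
            clear h2
            have := e.isLt
            have := (w y).isLt
            clear hI h
            unfold Between at *
            omega
          · specialize h2 hwx
            have f2 : Between x (w y) (w x) := by
              refine hw x y ?_
              clear f1 hI
              unfold Between at *
              omega
            have := e.isLt
            have := (w y).isLt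
            clear hI h
            unfold Between at *
            omega
        · have h1 : (w * Equiv.swap x e) z = w z := by
            rw [Perm.mul_apply, Equiv.swap_apply_of_ne_of_ne hzx hze]
          rw [h1] at h ⊢
          rw [Perm.mul_apply]
          refine hw z _ ?_
          rw [Equiv.swap_apply_def]
          split_ifs with h h'
          · rw [← hI z hzx hze, ← h]; assumption
          · rw [hI z hzx hze, ← h']; assumption
          · assumption
      obtain ⟨L, hL, hlen, hprod⟩ := ih _ (hd ▸ hlt) harc rfl
      refine ⟨Equiv.swap x e :: L, ?_, ?_, ?_⟩
      · intro t ht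
        rcases List.mem_cons.1 ht with h | h
        · rw [h]
          exact ⟨x, e, hxe, rfl⟩
        · exact hL t h
      · rw [List.length_cons]
        omega
      · rw [List.prod_cons, ← mul_assoc, hprod]

theorem ArcInvariant.absLE {w : Perm (Fin n)} (hw : ArcInvariant w) (hn : 1 ≤ n) :
    AbsLE w (cox n) := by
  obtain ⟨L, h1, h2, h3⟩ := hw.exists_prod hn
  have h4 : L.prod = w⁻¹ * cox n := by rw [← h3, inv_mul_cancel_left]
  have e1 := reflLength_add_invDim w
  have e2 := reflLength_add_invDim (cox n)
  have e3 := reflLength_le h1 h4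
  rw [invDim_cox hn] at e2
  obtain ⟨L1, a1, a2, a3⟩ := exists_reduced w
  obtain ⟨L2, b1, b2, b3⟩ := exists_reduced (w⁻¹ * cox n)
  have e4 : reflLength (cox n) ≤ (L1 ++ L2).length := by
    refine reflLength_le (fun t ht => ?_) (by rw [List.prod_append, a3, b3, mul_inv_cancel_left])
    rcases List.mem_append.1 ht with h | h
    · exact a1 t h
    · exact b1 t h
  rw [List.length_append] at e4
  unfold AbsLE
  omega

end Noncrossing

/-! ### Noncrossing flats as noncrossing partitions. -/

section Flats

open TypeAParking
open Equiv (Perm)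

variable {n : ℕ}

theorem between_rot {x z : Fin n} {k : ℕ} (hk : k ≤ n) (h : Between x z (rot x k)) :
    ∃ j, 0 < j ∧ j < k ∧ rot x j = z := by
  obtain ⟨j, hj, rfl⟩ := exists_rot x z
  have h1 := rot_val x hj
  refine ⟨j, ?_, ?_, rfl⟩
  · rcases Nat.eq_zero_or_pos j with rfl | h0
    · rw [rot_zero] at h
      unfold Between at h
      omega
    · exact h0
  · rcases hk.lt_or_eq with hk | rfl
    · have h2 := rot_val x hk
      unfold Between at h
      omega
    · exact hj

theorem rot_self (x : Fin n) : rot x n = x :=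
  Fin.ext (by simp [rot, Nat.mod_eq_of_lt x.isLt])

open Classical in
theorem exists_next (r : Setoid (Fin n)) (x : Fin n) : ∃ y, r x y ∧
    (∀ z, Between x z y → ¬ r x z) ∧ (y = x → ∀ z, r x z → z = x) := by
  have hex : ∃ k, 1 ≤ k ∧ r x (rot x k) := ⟨n, Fin.pos x, by rw [rot_self]⟩
  obtain ⟨h1, h2⟩ := Nat.find_spec hex
  have h3 : Nat.find hex ≤ n := Nat.find_min' hex ⟨Fin.pos x, by rw [rot_self]⟩
  have h4 : ∀ j, 0 < j → j < Nat.find hex → ¬ r x (rot x j) := fun j hj hj' h =>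
    Nat.find_min hex hj' ⟨hj, h⟩
  refine ⟨rot x (Nat.find hex), h2, ?_, ?_⟩
  · intro z hz
    obtain ⟨j, hj, hj', rfl⟩ := between_rot h3 hz
    exact h4 j hj hj'
  · intro hx z hz
    obtain ⟨j, hj, rfl⟩ := exists_rot x z
    rcases Nat.eq_zero_or_pos j with rfl | h0
    · exact rot_zero x
    · refine absurd hz (h4 j h0 ?_)
      rcases h3.lt_or_eq with h | h
      · have := rot_injOn x (show Nat.find hex < n from h) (show 0 < n by omega)
          (by rw [hx, rot_zero])
        omega
      · omega

/-- Send each point to the next point of its class. A point strictly between `x` and its image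
belongs to another class, and if its own next point left the arc, the two classes would cross. -/
theorem IsNoncrossing.exists_arcInvariant {r : Setoid (Fin n)} (hr : IsNoncrossing r) :
    ∃ w : Perm (Fin n), ArcInvariant w ∧ ∀ x y, w.SameCycle x y ↔ r x y := by
  choose f h1 h2 h3 using exists_next r
  have hinj : Function.Injective f := by
    intro x y hxy
    by_contra hne
    have hr1 : r x y := r.trans (h1 x) (r.symm (hxy ▸ h1 y))
    have e1 : f x ≠ x := fun h => hne (h3 x h y hr1).symm
    have e2 : f y ≠ y := fun h => hne (h3 y h x (r.symm hr1))
    have e3 : ¬ Between x y (f x) := fun h => h2 x y h hr1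
    have e4 : ¬ Between y x (f y) := fun h => h2 y x h (r.symm hr1)
    rw [← hxy] at e2 e4
    unfold Between at e3 e4
    omega
  let w : Perm (Fin n) := Equiv.ofBijective f (Finite.injective_iff_bijective.1 hinj)
  have hw : ∀ x, w x = f x := fun _ => rfl
  refine ⟨w, ?_, fun x y => ⟨?_, ?_⟩⟩
  · intro x y h
    rw [hw] at h ⊢
    rw [hw]
    have hxy := h2 x y h
    have e1 : f y ≠ x := fun h' => hxy (r.symm (h' ▸ h1 y))
    have e2 : f y ≠ f x := fun h' => by
      rw [hinj h'] at hxy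
      exact hxy (r.refl x)
    by_contra hcon
    refine hxy (hr x y (f x) (f y) (h1 x) (h1 y) h ?_)
    unfold Between at *
    omega
  · rintro ⟨k, rfl⟩
    have hpow : ∀ (k : ℕ) z, r z ((w ^ k) z) := by
      intro k
      induction k with
      | zero => exact fun z => r.refl z
      | succ k ih =>
        intro z
        rw [pow_succ', Perm.mul_apply]
        exact r.trans (ih z) (h1 _)
    rcases Int.eq_nat_or_neg k with ⟨k, rfl | rfl⟩
    · exact_mod_cast hpow k x
    · have := hpow k ((w ^ (-(k : ℤ))) x)
      rw [← zpow_natCast, ← Perm.mul_apply, ← zpow_add, add_neg_cancel, zpow_zero,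
        Perm.one_apply] at this
      exact r.symm this
  · intro h
    induction hd : (arc x y).card using Nat.strong_induction_on generalizing x with
    | _ d ih =>
      by_cases hxy : x = y
      · rw [hxy]
      · have e1 : f x ≠ x := fun h' => hxy (h3 x h' y h).symm
        have e2 : ¬ Between x y (f x) := fun h' => h2 x y h' h
        have e3 : InArc x (f x) y := by
          unfold Between at e2
          unfold InArc
          omega
        have := ih _ (hd ▸ card_arc_lt e3 e1) (f x) (r.trans (r.symm (h1 x)) h) rfl
        rwa [← hw, Perm.sameCycle_apply_left] at this

/-- Let `x` be the last point of the cycle of `a` before `b`. The open arc from `x` to `w x`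
contains `b`, hence `d`, but no point of the cycle of `a`; so `a` and `c` cannot separate `b` from
`d`. -/
theorem ArcInvariant.isNoncrossing {w : Perm (Fin n)} (hw : ArcInvariant w) :
    IsNoncrossing (Perm.SameCycle.setoid w) := by
  classical
  intro a b c d hac hbd h1 h2
  change w.SameCycle a c at hac
  change w.SameCycle b d at hbd
  change w.SameCycle a b
  by_contra hab
  obtain ⟨x, hx, hmin⟩ := (Finset.univ.filter fun x => w.SameCycle a x).exists_min_image
    (fun x => (arc x b).card) ⟨a, by simp [Perm.SameCycle.refl]⟩
  replace hx : w.SameCycle a x := (Finset.mem_filter.1 hx).2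
  have hmin' : ∀ z, w.SameCycle a z → InArc x z b → z = x := by
    intro z hz hz'
    by_contra hne
    exact absurd (hmin z (by simp [hz])) (not_le.2 (card_arc_lt hz' hne))
  have hxb : x ≠ b := fun h => hab (h ▸ hx)
  have hac' : a ≠ c := by
    unfold Between at h1
    omega
  have hwx : w x ≠ x := by
    intro h
    have e1 : x = a := hx.symm.eq_of_left h
    have e2 : x = c := (hx.symm.trans hac).eq_of_left h
    exact hac' (e1.symm.trans e2)
  have e1 : Between x b (w x) := by
    have h3 := hmin' (w x) (Perm.sameCycle_apply_right.2 hx)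
    unfold InArc at h3
    unfold Between
    omega
  have e2 := hw.sameCycle hbd e1
  have e3 : ∀ z, w.SameCycle a z → ¬ Between x z (w x) := by
    intro z hz hz'
    have := hw.sameCycle (hz.symm.trans hx) hz'
    unfold Between at this
    omega
  have e4 := e3 a (Perm.SameCycle.refl _ _)
  have e5 := e3 c hac
  clear hmin' hmin
  unfold Between at *
  omega

/-- The coordinates on which all vectors of `X` agree. -/
def flatRel (X : Submodule ℝ (reflSpace ℝ n)) : Setoid (Fin n) where
  r i j := ∀ v ∈ X, v.1 i = v.1 j
  iseqv := ⟨fun _ _ _ => rfl, fun h v hv => (h v hv).symm,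
    fun h h' v hv => (h v hv).trans (h' v hv)⟩

theorem reflRep_apply_apply (w : Perm (Fin n)) (v : reflSpace ℝ n) (i : Fin n) :
    (reflRep ℝ n w v).1 (w i) = v.1 i := by
  change v.1 (w⁻¹ (w i)) = _
  rw [← Perm.mul_apply, inv_mul_cancel, Perm.one_apply]

theorem reflRep_eq_self_iff {w : Perm (Fin n)} {v : reflSpace ℝ n} :
    reflRep ℝ n w v = v ↔ ∀ i, v.1 i = v.1 (w i) := by
  rw [Subtype.ext_iff, funext_iff, w.surjective.forall]
  simp only [reflRep_apply_apply]

theorem mem_fixedSpace {w : Perm (Fin n)} {v : reflSpace ℝ n} :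
    v ∈ fixedSpace w ↔ ∀ x y, w.SameCycle x y → v.1 x = v.1 y := by
  have h : v ∈ fixedSpace w ↔ ∀ i, v.1 i = v.1 (w i) := reflRep_eq_self_iff
  rw [h]
  constructor
  · intro h x y hxy
    obtain ⟨k, rfl⟩ := hxy.exists_nat_pow_eq
    clear hxy
    induction k with
    | zero => rfl
    | succ k ih => rw [pow_succ', Perm.mul_apply, ← h, ih]
  · exact fun h i => h _ _ (Perm.sameCycle_apply_right.2 (Perm.SameCycle.refl _ _))

theorem flatRel_fixedSpace {w : Perm (Fin n)} {x y : Fin n} :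
    flatRel (fixedSpace w) x y ↔ w.SameCycle x y := by
  classical
  constructor
  · intro h
    by_contra hxy
    let S : ℝ := ∑ i : Fin n, if w.SameCycle x i then 1 else 0
    have hn : (n : ℝ) ≠ 0 := by
      have := Fin.pos x
      exact_mod_cast this.ne'
    -- The indicator of the cycle of `x`, with its mean subtracted to make the coordinate sum zero.
    let v : reflSpace ℝ n := ⟨fun i => (if w.SameCycle x i then 1 else 0) - S / n, by
      change ∑ i, _ = _
      rw [Finset.sum_sub_distrib, Finset.sum_const, Finset.card_univ, Fintype.card_fin,
        nsmul_eq_mul, mul_div_cancel₀ _ hn]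
      exact sub_self S⟩
    have hv : v ∈ fixedSpace w := by
      refine mem_fixedSpace.2 fun a b hab => ?_
      have : w.SameCycle x a ↔ w.SameCycle x b := ⟨fun h => h.trans hab, fun h => h.trans hab.symm⟩
      simp only [v, this]
    have := h v hv
    simp only [v, if_neg hxy, if_pos (Perm.SameCycle.refl w x)] at this
    norm_num at this
  · exact fun h v hv => mem_fixedSpace.1 hv x y h

theorem mem_pointStab {X : Submodule ℝ (reflSpace ℝ n)} {σ : Perm (Fin n)} :
    σ ∈ pointStab X ↔ ∀ x, flatRel X x (σ x) := by
  change (∀ v ∈ X, reflRep ℝ n σ v = v) ↔ _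
  simp only [reflRep_eq_self_iff]
  exact ⟨fun h x v hv => h v hv x, fun h v hv x => h x v hv⟩

theorem flatRel_map (X : Submodule ℝ (reflSpace ℝ n)) (g : Perm (Fin n)) (i j : Fin n) :
    flatRel (X.map (reflRep ℝ n g)) (g i) (g j) ↔ flatRel X i j := by
  constructor
  · intro h v hv
    have := h _ (Submodule.mem_map_of_mem hv)
    rwa [reflRep_apply_apply, reflRep_apply_apply] at this
  · rintro h _ ⟨v, hv, rfl⟩
    rw [reflRep_apply_apply, reflRep_apply_apply]
    exact h v hv

theorem NCFlat.ext {X Y : NCFlat n} (h : ∀ i j, flatRel X.1 i j ↔ flatRel Y.1 i j) : X = Y := by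
  obtain ⟨X, w, hw, hwc, rfl⟩ := X
  obtain ⟨Y, w', hw', hwc', rfl⟩ := Y
  refine Subtype.ext (Submodule.ext fun v => ?_)
  simp only [flatRel_fixedSpace] at h
  rw [mem_fixedSpace, mem_fixedSpace]
  simp only [h]

theorem NCFlat.isNoncrossing (X : NCFlat n) : IsNoncrossing (flatRel X.1) := by
  obtain ⟨X, w, h0, h, rfl⟩ := X
  have h1 := (ArcInvariant.of_absLE h).isNoncrossing
  intro a b c d hac hbd e1 e2
  rw [flatRel_fixedSpace] at *
  exact h1 a b c d hac hbd e1 e2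

theorem IsNoncrossing.exists_flat {r : Setoid (Fin n)} (hr : IsNoncrossing r) (hn : 1 ≤ n) :
    ∃ X : NCFlat n, ∀ i j, flatRel X.1 i j ↔ r i j := by
  obtain ⟨w, hw, hwr⟩ := hr.exists_arcInvariant
  refine ⟨⟨fixedSpace w, w, absLE_one w, hw.absLE hn, rfl⟩, fun i j => ?_⟩
  rw [flatRel_fixedSpace, hwr]

end Flats

/-! ### Fixed classes as equivariant labellings. -/

section FixedPoints

open TypeAParking
open Equiv (Perm)

variable {n : ℕ}

/-- The class `[v, X]`. -/
def parkMk (v : Perm (Fin n)) (X : NCFlat n) : ParkNC n := Quotient.mk (parkSetoid n) (v, X)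

theorem parkMk_surjective (q : ParkNC n) : ∃ v X, parkMk v X = q := by
  obtain ⟨⟨v, X⟩, h⟩ := Quotient.exists_rep q
  exact ⟨v, X, h⟩

theorem smul_parkMk_eq_iff {u v : Perm (Fin n)} {X : NCFlat n} {l : ℤ} :
    ((u, coxPow n l) : WC n) • parkMk v X = parkMk v X ↔
      X.rotate (coxPow n l) = X ∧ ∀ x, flatRel X.1 x ((v⁻¹ * u * v * (cox n ^ l)⁻¹) x) := by
  refine Quotient.eq.trans ?_
  change _ ∧ _ ↔ _
  refine and_congr_right fun h => ?_
  change X.rotate (coxPow n l) = X at h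
  change QuotientGroup.mk (u * v * (cox n ^ l)⁻¹) = (QuotientGroup.mk v :
    _ ⧸ pointStab (X.rotate (coxPow n l)).1) ↔ _
  rw [h, eq_comm, QuotientGroup.eq, mem_pointStab]
  simp only [mul_assoc]

theorem parkMk_eq_parkMk_iff {v v' : Perm (Fin n)} {X X' : NCFlat n} :
    parkMk v X = parkMk v' X' ↔ X = X' ∧ ∀ x, flatRel X.1 x ((v⁻¹ * v') x) := by
  refine Quotient.eq.trans (and_congr_right fun _ => ?_)
  rw [QuotientGroup.eq, mem_pointStab]

theorem exists_perm_comp_eq {α Y : Type*} [Finite α] {f g : α → Y}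
    (h : ∀ y, Nat.card {a // f a = y} = Nat.card {a // g a = y}) :
    ∃ e : Perm α, ∀ a, g (e a) = f a :=
  ⟨Equiv.ofFiberEquiv fun y => (Finite.card_eq.1 (h y)).some, fun a => Equiv.ofFiberEquiv_map _ a⟩

/-- If the blocks of the invariant noncrossing flats are labelled equivariantly, in such a way
that a flat is determined by the multiplicities of its labels, then the fixed points of `(u, c^l)`
correspond to the equivariant functions with such multiplicities. -/
theorem ncard_fixedParkNC {Y : Type} (u : Perm (Fin n)) (l : ℤ) (σ : Y → Y)
    (F : NCFlat n → Fin n → Y)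
    (hker : ∀ X, X.rotate (coxPow n l) = X → ∀ i j, F X i = F X j ↔ flatRel X.1 i j)
    (hequiv : ∀ X, X.rotate (coxPow n l) = X → ∀ i, F X ((cox n ^ l) i) = σ (F X i))
    (hcard : ∀ X X', X.rotate (coxPow n l) = X → X'.rotate (coxPow n l) = X' →
      (∀ y, Nat.card {i // F X i = y} = Nat.card {i // F X' i = y}) → F X = F X') :
    (fixedParkNC u l).ncard = Nat.card {f : Fin n → Y // (∀ j, f (u j) = σ (f j)) ∧
      ∃ X, X.rotate (coxPow n l) = X ∧
        ∀ y, Nat.card {i // F X i = y} = Nat.card {i // f i = y}} := by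
  choose V Z hVZ using parkMk_surjective (n := n)
  have hfix : ∀ q : fixedParkNC u l, (Z q).rotate (coxPow n l) = Z q ∧
      ∀ x, flatRel (Z q).1 x (((V q)⁻¹ * u * V q * (cox n ^ l)⁻¹) x) := by
    intro q
    rw [← smul_parkMk_eq_iff, hVZ]
    exact q.2
  -- The class `[v, X]` goes to `F X ∘ v⁻¹`. Multiplicities recover `F X`, hence `X`, and the
  -- function then determines `v` up to permutations preserving the blocks of `X`, which form its
  -- pointwise stabilizer.
  let Φ : fixedParkNC u l → {f : Fin n → Y // (∀ j, f (u j) = σ (f j)) ∧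
      ∃ X, X.rotate (coxPow n l) = X ∧
        ∀ y, Nat.card {i // F X i = y} = Nat.card {i // f i = y}} := fun q =>
    ⟨fun j => F (Z q) ((V q)⁻¹ j), by
      obtain ⟨h1, h2⟩ := hfix q
      refine ⟨fun j => ?_, _, h1, fun y => ?_⟩
      · rw [← hequiv _ h1, hker _ h1]
        have := (flatRel (Z q).1).symm (h2 ((cox n ^ l) ((V q)⁻¹ j)))
        simpa using this
      · exact Nat.card_congr (Equiv.subtypeEquiv (V q) fun i => by simp)⟩
  refine (Nat.card_coe_set_eq _).symm.trans (Nat.card_congr (Equiv.ofBijective Φ ⟨?_, ?_⟩))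
  · intro q q' h
    obtain ⟨h1, -⟩ := hfix q
    obtain ⟨h1', -⟩ := hfix q'
    have h3 : ∀ j, F (Z q) ((V q)⁻¹ j) = F (Z q') ((V q')⁻¹ j) :=
      congrFun (congrArg Subtype.val h)
    have h4 : F (Z q) = F (Z q') := by
      refine hcard _ _ h1 h1' fun y => ?_
      refine Nat.card_congr (Equiv.subtypeEquiv ((V q).trans (V q')⁻¹) fun i => ?_)
      rw [Equiv.trans_apply, ← h3]
      simp
    have h5 : Z q = Z q' := by
      refine NCFlat.ext fun i j => ?_
      rw [← hker _ h1, ← hker _ h1', h4]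
    refine Subtype.ext ?_
    rw [← hVZ q, ← hVZ q']
    refine parkMk_eq_parkMk_iff.2 ⟨h5, fun x => ?_⟩
    rw [← hker _ h1, Perm.mul_apply, h3, h4]
    simp
  · rintro ⟨f, hf, X, hX, hcardX⟩
    obtain ⟨v, hv⟩ := exists_perm_comp_eq hcardX
    have hq : parkMk v X ∈ fixedParkNC u l := by
      refine smul_parkMk_eq_iff.2 ⟨hX, fun x => ?_⟩
      rw [← hker X hX, ← hv ((v⁻¹ * u * v * (cox n ^ l)⁻¹) x)]
      have h1 : v ((v⁻¹ * u * v * (cox n ^ l)⁻¹) x) = u (v ((cox n ^ l)⁻¹ x)) := by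
        simp [Perm.mul_apply]
      rw [h1, hf, hv, ← hequiv X hX]
      simp
    refine ⟨⟨_, hq⟩, Subtype.ext (funext fun j => ?_)⟩
    change F (Z (parkMk v X)) ((V (parkMk v X))⁻¹ j) = f j
    obtain ⟨h1, h2⟩ := parkMk_eq_parkMk_iff.1 (hVZ (parkMk v X)).symm
    rw [← h1]
    have h3 := (hker X hX _ _).2 (h2 ((V (parkMk v X))⁻¹ j))
    rw [show f j = F X (v⁻¹ j) by rw [← hv]; simp]
    simpa using h3

end FixedPoints

/-! ### Rotation-invariant noncrossing partitions and parking maps. -/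

section RotationInvariant

open TypeAParking
open Equiv (Perm)

variable {n : ℕ}

/-- `ρ` is the rotation by `s`. -/
def IsRotation (ρ : Perm (Fin n)) (s : ℕ) : Prop :=
  ∀ x, ((ρ x : Fin n) : ℕ) = x + s ∨ ((ρ x : Fin n) : ℕ) + n = x + s

theorem IsRotation.inArc {ρ : Perm (Fin n)} {s : ℕ} (h : IsRotation ρ s) {b j k : Fin n} :
    InArc (ρ b) (ρ j) (ρ k) ↔ InArc b j k := by
  have h1 := h b
  have h2 := h j
  have h3 := h k
  have := (ρ b).isLt
  have := (ρ j).isLt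
  have := (ρ k).isLt
  have := b.isLt
  have := j.isLt
  have := k.isLt
  unfold InArc
  simp only [Fin.le_def, Fin.lt_def]
  constructor <;> omega

/-- The first point of the class of `x` met when going forward from `a` is `b`. -/
def IsFirst (r : Setoid (Fin n)) (a x b : Fin n) : Prop :=
  r x b ∧ ∀ z, InArc a z b → r x z → z = b

theorem IsFirst.unique {r : Setoid (Fin n)} {a x b b' : Fin n} (h : IsFirst r a x b)
    (h' : IsFirst r a x b') : b = b' := by
  have : InArc a b b' ∨ InArc a b' b := by unfold InArc; omega
  rcases this with h1 | h1
  · exact h'.2 b h1 h.1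
  · exact (h.2 b' h1 h'.1).symm

theorem exists_isFirst (r : Setoid (Fin n)) (a x : Fin n) : ∃ b, IsFirst r a x b := by
  classical
  obtain ⟨b, hb, hmin⟩ := (Finset.univ.filter fun b => r x b).exists_min_image
    (fun b => (arc a b).card) ⟨x, by simp⟩
  refine ⟨b, (Finset.mem_filter.1 hb).2, fun z hz hxz => ?_⟩
  by_contra hne
  refine absurd (hmin z (by simp [hxz])) (not_le.2 ?_)
  refine Finset.card_lt_card ((Finset.ssubset_iff_of_subset ?_).2 ⟨b, ?_, ?_⟩)
  · intro j hj
    rw [mem_arc] at *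
    unfold InArc at *
    omega
  · rw [mem_arc]; unfold InArc; omega
  · rw [mem_arc]; unfold InArc at *; omega

open Classical in
/-- Labels each block by its first point after the preceding rotated copy of the block; the block
that is invariant under the rotation, if any, has no label. -/
noncomputable def startMap (r : Setoid (Fin n)) (ρ : Perm (Fin n)) (x : Fin n) : Option (Fin n) :=
  if r x (ρ⁻¹ x) then none else some (exists_isFirst r (ρ⁻¹ x) x).choose

theorem startMap_eq_none {r : Setoid (Fin n)} {ρ : Perm (Fin n)} {x : Fin n} :
    startMap r ρ x = none ↔ r x (ρ⁻¹ x) := by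
  unfold startMap
  split_ifs with h
  · exact iff_of_true rfl h
  · exact iff_of_false (by simp) h

theorem startMap_eq_some {r : Setoid (Fin n)} {ρ : Perm (Fin n)} {x b : Fin n} :
    startMap r ρ x = some b ↔ ¬ r x (ρ⁻¹ x) ∧ IsFirst r (ρ⁻¹ x) x b := by
  unfold startMap
  split_ifs with h
  · exact iff_of_false (by simp) fun h' => h'.1 h
  · rw [Option.some_inj]
    refine ⟨fun hb => ⟨h, hb ▸ (exists_isFirst r (ρ⁻¹ x) x).choose_spec⟩, fun hb => ?_⟩
    exact (exists_isFirst r (ρ⁻¹ x) x).choose_spec.unique hb.2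

theorem apply_inv_apply (ρ : Perm (Fin n)) (x : Fin n) : ρ (ρ⁻¹ x) = x := by
  rw [← Perm.mul_apply, mul_inv_cancel, Perm.one_apply]

theorem inv_apply_apply (ρ : Perm (Fin n)) (x : Fin n) : ρ⁻¹ (ρ x) = x := by
  rw [← Perm.mul_apply, inv_mul_cancel, Perm.one_apply]

theorem IsRotation.inv {ρ : Perm (Fin n)} {s : ℕ} (h : IsRotation ρ s) (x : Fin n) :
    (x : ℕ) = (ρ⁻¹ x : Fin n) + s ∨ (x : ℕ) + n = (ρ⁻¹ x : Fin n) + s := by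
  have := h (ρ⁻¹ x)
  rwa [apply_inv_apply] at this

variable {r : Setoid (Fin n)} {ρ : Perm (Fin n)} {s : ℕ}

theorem startMap_rotation (hρ : IsRotation ρ s) (hr : ∀ i j, r (ρ i) (ρ j) ↔ r i j) (x : Fin n) :
    startMap r ρ (ρ x) = (startMap r ρ x).map ρ := by
  have hr' : ∀ i j, r (ρ i) j ↔ r i (ρ⁻¹ j) := fun i j => by
    rw [← hr i, apply_inv_apply]
  rcases h : startMap r ρ x with _ | b
  · rw [Option.map_none, startMap_eq_none]
    rw [startMap_eq_none] at h
    rw [inv_apply_apply, hr']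
    exact h
  · rw [Option.map_some, startMap_eq_some]
    rw [startMap_eq_some] at h
    rw [inv_apply_apply, hr']
    refine ⟨h.1, (hr _ _).2 h.2.1, fun z hz hxz => ?_⟩
    have h1 := h.2.2 (ρ⁻¹ z) (by
      rw [← hρ.inArc, apply_inv_apply, apply_inv_apply]
      exact hz) ((hr' _ _).1 hxz)
    rw [← h1, apply_inv_apply]

/-- There is at most one invariant block. A power of `ρ` moves `y` within its block to the arc from
`x` to `ρ x`, and then `x, y, ρ x, ρ y` would be a crossing of two different blocks. -/
theorem rel_of_rel_rotation (hρ : IsRotation ρ s) (hs : s + s ≤ n) (hs0 : 1 ≤ s)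
    (hr : ∀ i j, r (ρ i) (ρ j) ↔ r i j) (hnc : IsNoncrossing r)
    {x y : Fin n} (hx : r x (ρ x)) (hy : r y (ρ y)) : r x y := by
  obtain ⟨i, hi, rfl⟩ := exists_rot x y
  have hpow : ∀ (q : ℕ) (z : Fin n), (ρ ^ q) z = rot z (q * s) := by
    intro q
    induction q with
    | zero => intro z; rw [zero_mul, rot_zero]; rfl
    | succ q ih =>
      intro z
      have h1 : ∀ z, ρ z = rot z s := by
        intro z
        have h2 := hρ z
        have h3 := rot_val z (show s < n by omega)
        have := (ρ z).isLt
        exact Fin.ext (by omega)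
      rw [pow_succ', Perm.mul_apply, ih, h1, rot_rot, Nat.succ_mul]
  have hrpow : ∀ (q : ℕ) i j, r ((ρ ^ q) i) ((ρ ^ q) j) ↔ r i j := by
    intro q
    induction q with
    | zero => exact fun i j => Iff.rfl
    | succ q ih => intro i j; rw [pow_succ', Perm.mul_apply, Perm.mul_apply, hr, ih]
  have hdecomp : rot x i = (ρ ^ (i / s)) (rot x (i % s)) := by
    rw [hpow, rot_rot, Nat.mul_comm, Nat.mod_add_div]
  have hlt : i % s < s := Nat.mod_lt _ hs0
  rw [hdecomp] at hy ⊢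
  have hval := rot_val x (show i % s < n by omega)
  generalize rot x (i % s) = y at *
  generalize i / s = q at *
  have hy' : r y (ρ y) := by
    rw [← Perm.mul_apply, ← pow_succ', pow_succ, Perm.mul_apply, hrpow] at hy
    exact hy
  have hyq : r y ((ρ ^ q) y) := by
    clear hy hdecomp
    induction q with
    | zero => exact r.refl y
    | succ q ih =>
      rw [pow_succ', Perm.mul_apply]
      exact r.trans hy' ((hr _ _).2 ih)
  refine r.trans ?_ hyq
  by_cases hxy : x = y
  · rw [hxy]
  · have e1 := hρ x
    have e2 := hρ y
    have := (ρ x).isLt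
    have := (ρ y).isLt
    refine hnc x y (ρ x) (ρ y) hx hy' ?_ ?_ <;>
    · clear hdecomp
      unfold Between
      simp only [Fin.lt_def]
      omega

/-- A label lies in its block, so labels separate blocks, and the unlabelled points form a single
block. If two points of one block had different labels, the block would cross its preceding rotated
copy. -/
theorem startMap_eq_iff (hρ : IsRotation ρ s) (hs : s + s ≤ n) (hs0 : 1 ≤ s)
    (hr : ∀ i j, r (ρ i) (ρ j) ↔ r i j) (hnc : IsNoncrossing r)
    {x y : Fin n} : startMap r ρ x = startMap r ρ y ↔ r x y := by
  have hr' : ∀ i j, r (ρ⁻¹ i) (ρ⁻¹ j) ↔ r i j := fun i j => by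
    rw [← hr, apply_inv_apply, apply_inv_apply]
  constructor
  · intro h
    rcases hx : startMap r ρ x with _ | b
    · have hy := h.symm.trans hx
      rw [startMap_eq_none] at hx hy
      have h1 : r (ρ⁻¹ x) (ρ⁻¹ y) := by
        refine rel_of_rel_rotation hρ hs hs0 hr hnc ?_ ?_
        · rw [apply_inv_apply]; exact r.symm hx
        · rw [apply_inv_apply]; exact r.symm hy
      exact (hr' _ _).1 h1
    · have hy := h.symm.trans hx
      rw [startMap_eq_some] at hx hy
      exact r.trans hx.2.1 (r.symm hy.2.1)
  · intro h
    have h0 : r x (ρ⁻¹ x) ↔ r y (ρ⁻¹ y) :=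
      ⟨fun h' => r.trans (r.symm h) (r.trans h' ((hr' _ _).2 h)),
        fun h' => r.trans h (r.trans h' (r.symm ((hr' _ _).2 h)))⟩
    rcases hx : startMap r ρ x with _ | b
    · rw [startMap_eq_none] at hx
      exact (startMap_eq_none.2 (h0.1 hx)).symm
    · rw [startMap_eq_some] at hx
      refine (startMap_eq_some.2 ⟨fun h' => hx.1 (h0.2 h'), r.trans (r.symm h) hx.2.1,
        fun z hz hyz => ?_⟩).symm
      by_contra hne
      have hxz : r x z := r.trans h hyz
      have h1 : r b z := r.trans (r.symm hx.2.1) hxz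
      have h2 := hx.2.2 z
      have h3 : ¬ InArc (ρ⁻¹ x) z b := fun h' => hne (h2 h' hxz)
      have hxb : ρ⁻¹ x ≠ b := fun h' => hx.1 (h' ▸ hx.2.1)
      have hyb : ρ⁻¹ y ≠ b := fun h' => hx.1 (h0.2 (h' ▸ r.trans (r.symm h) hx.2.1))
      have hyz' : ρ⁻¹ y ≠ z := fun h' => hx.1 (h0.2 (h' ▸ hyz))
      have h4 : r (ρ⁻¹ x) b := by
        refine hnc (ρ⁻¹ x) b (ρ⁻¹ y) z ((hr' _ _).2 h) h1 ?_ ?_ <;>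
        · clear h2
          unfold InArc at *
          unfold Between
          omega
      exact hx.1 (r.trans hx.2.1 (r.symm h4))

/-- By noncrossing, a block that meets the arc from `b` to `x` without being the block of `x` lies
inside that arc. It is therefore not rotation-invariant, and its first point falls between `b` and
`j`. -/
theorem isParkMap_startMap (hρ : IsRotation ρ s) (hs : s + s ≤ n) (hs0 : 1 ≤ s)
    (hr : ∀ i j, r (ρ i) (ρ j) ↔ r i j) (hnc : IsNoncrossing r) : IsParkMap (startMap r ρ) := by
  intro b x hx j hj
  by_cases hxj : r x j
  · have := (startMap_eq_iff hρ hs hs0 hr hnc).2 hxj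
    refine ⟨b, by rw [← this, hx], ?_⟩
    unfold InArc
    omega
  · rw [startMap_eq_some] at hx
    obtain ⟨hx0, hxb, hfirst⟩ := hx
    have hbj : b ≠ j := fun h => hxj (h ▸ hxb)
    have hxj' : x ≠ j := fun h => hxj (h ▸ r.refl x)
    have hclass : ∀ z, r j z → Between b z x := by
      intro z hz
      have hzb : z ≠ b := fun h => hxj (r.trans hxb (r.symm (h ▸ hz)))
      have hzx : z ≠ x := fun h => hxj (r.symm (h ▸ hz))
      by_contra hcon
      refine hxj (r.trans hxb (hnc b j x z (r.symm hxb) hz ?_ ?_)) <;>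
      · unfold InArc at hj
        unfold Between at *
        omega
    have hbx : InArc (ρ⁻¹ x) b x := by
      have := hfirst x
      by_contra hcon
      have h1 := this (by unfold InArc at *; omega) (r.refl x)
      rw [h1] at hcon
      unfold InArc at hcon
      omega
    have e1 := hρ.inv x
    have e2 := hρ.inv j
    have hj0 : ¬ r j (ρ⁻¹ j) := by
      intro h
      have := hclass _ h
      have := x.isLt
      have := j.isLt
      have := b.isLt
      have := (ρ⁻¹ x).isLt
      have := (ρ⁻¹ j).isLt
      unfold InArc at *
      unfold Between at *
      simp only [Fin.lt_def, Fin.le_def] at *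
      omega
    obtain ⟨b', hb'⟩ := exists_isFirst r (ρ⁻¹ j) j
    refine ⟨b', startMap_eq_some.2 ⟨hj0, hb'⟩, ?_⟩
    have h3 := hclass b' hb'.1
    have h4 : InArc (ρ⁻¹ j) b' j := by
      by_contra hcon
      have h1 := hb'.2 j (by unfold InArc at *; omega) (r.refl j)
      rw [h1] at hcon
      unfold InArc at hcon
      omega
    have := x.isLt
    have := j.isLt
    have := b.isLt
    have := (ρ⁻¹ x).isLt
    have := (ρ⁻¹ j).isLt
    clear hclass hb' hfirst
    unfold InArc at *
    unfold Between at *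
    simp only [Fin.lt_def, Fin.le_def] at *
    omega

theorem IsParkMap.self {P : Fin n → Option (Fin n)} (hP : IsParkMap P) {b k : Fin n}
    (h : P k = some b) : P b = some b := by
  obtain ⟨b', h1, h2⟩ := hP b k h b (by unfold InArc; omega)
  have : b' = b := by unfold InArc at h2; omega
  rwa [this] at h1

theorem IsParkMap.inArc {P : Fin n → Option (Fin n)} (hP : IsParkMap P) {b b' k j : Fin n}
    (h : P k = some b) (h' : P j = some b') (hj : InArc b j k) : InArc b b' j := by
  obtain ⟨b'', h1, h2⟩ := hP b k h j hj
  rw [h'] at h1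
  rwa [Option.some_injective _ h1]

theorem IsParkMap.not_inArc {P : Fin n → Option (Fin n)} (hP : IsParkMap P) {b k j : Fin n}
    (h : P k = some b) (h' : P j = none) : ¬ InArc b j k := by
  intro hj
  obtain ⟨b'', h1, -⟩ := hP b k h j hj
  rw [h'] at h1
  exact absurd h1 (by simp)

theorem eq_of_interleaved {a b c d e f : Fin n} (h1 : Between a b c) (h2 : Between c d a)
    (he : InArc d e b ∧ e ≠ d) (h3 : InArc e b c → InArc e f b) (h4 : InArc f a b → InArc f e a)
    (h5 : InArc f c d → InArc f e c) : e = f := by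
  by_contra hne
  have h6 : InArc e f b := by
    refine h3 ?_
    clear h3 h4 h5
    unfold InArc Between at *
    omega
  clear h3
  by_cases h7 : InArc f a b
  · have h8 := h4 h7
    clear h4 h5
    unfold InArc Between at *
    omega
  · have h8 : InArc f c d := by
      clear h4 h5
      unfold InArc Between at *
      omega
    have h9 := h5 h8
    clear h4 h5
    unfold InArc Between at *
    omega

/-- No empty spot lies between a car and its preference, so the empty spots cross no block. For two
crossing blocks of cars, the parking condition at the four points forces equal preferences. -/
theorem IsParkMap.isNoncrossing {P : Fin n → Option (Fin n)} (hP : IsParkMap P) :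
    IsNoncrossing (Setoid.ker P) := by
  intro a b c d hac hbd h1 h2
  change P a = P c at hac
  change P b = P d at hbd
  change P a = P b
  rcases ha : P a with _ | e <;> rcases hb : P b with _ | f
  · rfl
  · have e1 := hP.not_inArc hb ha
    have e2 := hP.not_inArc hb (hac ▸ ha)
    have e3 := hP.not_inArc (hbd ▸ hb) ha
    have e4 := hP.not_inArc (hbd ▸ hb) (hac ▸ ha)
    clear hac hbd ha hb
    unfold InArc Between at *
    omega
  · have e1 := hP.not_inArc ha hb
    have e2 := hP.not_inArc ha (hbd ▸ hb)
    have e3 := hP.not_inArc (hac ▸ ha) hb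
    have e4 := hP.not_inArc (hac ▸ ha) (hbd ▸ hb)
    clear hac hbd ha hb
    unfold InArc Between at *
    omega
  · by_contra hne
    have hef : e ≠ f := fun h => hne (h ▸ rfl)
    have hc : P c = some e := hac ▸ ha
    have hd : P d = some f := hbd ▸ hb
    have h3 := hP.inArc hc hb
    have h4 := hP.inArc ha hd
    have h5 := hP.inArc hb ha
    have h6 := hP.inArc hd hc
    by_cases h7 : InArc d e b ∧ e ≠ d
    · exact hef (eq_of_interleaved h1 h2 h7 h3 h5 h6)
    · refine hef (eq_of_interleaved h2 h1 ?_ h4 h6 h5)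
      clear h3 h4 h5 h6
      unfold InArc Between at *
      omega

/-- The common preference of a block is one of its own points. An earlier point of the block after
`ρ⁻¹ x` would contradict the parking condition for the rotated cars at `ρ z` or `ρ⁻¹ x`. -/
theorem startMap_ker {P : Fin n → Option (Fin n)} (hP : IsParkMap P) (hρ : IsRotation ρ s)
    (hs : s + s ≤ n) (hs0 : 1 ≤ s) (hPρ : ∀ x, P (ρ x) = (P x).map ρ) :
    startMap (Setoid.ker P) ρ = P := by
  funext x
  have hPρ' : ∀ x, P (ρ⁻¹ x) = (P x).map (ρ⁻¹ : Perm (Fin n)) := by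
    intro x
    have := hPρ (ρ⁻¹ x)
    rw [apply_inv_apply] at this
    rw [this]
    cases P (ρ⁻¹ x)
    · rfl
    · rw [Option.map_some, Option.map_some, inv_apply_apply]
  rcases hx : P x with _ | b
  · rw [startMap_eq_none]
    change P x = P (ρ⁻¹ x)
    rw [hPρ', hx, Option.map_none]
  · rw [startMap_eq_some]
    have e1 := hρ.inv b
    have hb := hP.self hx
    refine ⟨?_, hx.trans hb.symm, ?_⟩
    · intro h
      change P x = P (ρ⁻¹ x) at h
      rw [hPρ', hx, Option.map_some] at h
      have h1 := Option.some_injective _ h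
      have := b.isLt
      rw [← h1] at e1
      omega
    · intro z hz hxz
      by_contra hne
      have hz' : P z = some b := (show P x = P z from hxz) ▸ hx
      have h1 := hP.inArc hz' (j := ρ z) (b' := ρ b) (by rw [hPρ, hz', Option.map_some])
      have h2 := hP.inArc hx (j := ρ⁻¹ x) (b' := ρ⁻¹ b) (by rw [hPρ', hx, Option.map_some])
      have e2 := hρ.inv x
      have e3 := hρ b
      have e4 := hρ z
      have := x.isLt
      have := z.isLt
      have := b.isLt
      have := (ρ⁻¹ x).isLt
      have := (ρ⁻¹ b).isLt
      have := (ρ z).isLt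
      have := (ρ b).isLt
      unfold InArc at *
      simp only [Fin.lt_def, Fin.le_def] at *
      omega

end RotationInvariant

/-! ### Fixed points of pairs with nontrivial rotation. -/

section NontrivialRotation

open TypeAParking
open Equiv (Perm)

variable {n : ℕ}

theorem map_pow_of_map {P : Fin n → Option (Fin n)} {g : Perm (Fin n)}
    (h : ∀ x, P (g x) = (P x).map g) (k : ℕ) (x : Fin n) :
    P ((g ^ k) x) = (P x).map (g ^ k : Perm (Fin n)) := by
  induction k with
  | zero => cases h : P x <;> simp [h]
  | succ k ih =>
    rw [pow_succ', Perm.mul_apply, h, ih]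
    cases P x <;> simp

theorem rel_pow_iff {r : Setoid (Fin n)} {g : Perm (Fin n)} (h : ∀ i j, r (g i) (g j) ↔ r i j)
    (k : ℕ) (i j : Fin n) : r ((g ^ k) i) ((g ^ k) j) ↔ r i j := by
  induction k with
  | zero => exact Iff.rfl
  | succ k ih => rw [pow_succ', Perm.mul_apply, Perm.mul_apply, h, ih]

theorem rotate_eq_self_iff {X : NCFlat n} {l : ℤ} : X.rotate (coxPow n l) = X ↔
    ∀ i j, flatRel X.1 ((cox n ^ l) i) ((cox n ^ l) j) ↔ flatRel X.1 i j := by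
  have h1 : ∀ i j, flatRel (X.rotate (coxPow n l)).1 ((cox n ^ l) i) ((cox n ^ l) j) ↔
      flatRel X.1 i j := fun i j => flatRel_map X.1 (cox n ^ l) i j
  constructor
  · intro h i j
    conv_lhs => rw [← h]
    exact h1 i j
  · intro h
    refine NCFlat.ext fun i j => ?_
    have h2 := h1 ((cox n ^ l)⁻¹ i) ((cox n ^ l)⁻¹ j)
    have h3 := h ((cox n ^ l)⁻¹ i) ((cox n ^ l)⁻¹ j)
    rw [apply_inv_apply, apply_inv_apply] at h2 h3
    rw [h2, h3]

theorem fiberCard_eq_natCard (P : Fin n → Option (Fin n)) (b : Fin n) :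
    fiberCard P b = Nat.card {i // P i = some b} := by
  rw [Nat.card_eq_fintype_card, Fintype.card_subtype]
  rfl

theorem card_none_add_sum_fiberCard (P : Fin n → Option (Fin n)) :
    Nat.card {i // P i = none} + ∑ b, fiberCard P b = n := by
  have h := Finset.card_eq_sum_card_fiberwise (f := P) (s := Finset.univ) (t := Finset.univ)
    fun _ _ => Finset.mem_coe.2 (Finset.mem_univ _)
  rw [Finset.card_univ, Fintype.card_fin, Fintype.sum_option] at h
  rw [Nat.card_eq_fintype_card, Fintype.card_subtype]
  exact h.symm

/-- Rotating `Q` back gives a parking map with the multiplicities of `P`, and multiplicities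
determine the parking map. -/
theorem IsParkMap.map_rotation {P Q : Fin n → Option (Fin n)} (hP : IsParkMap P)
    (hQ : IsParkMap Q) {ρ : Perm (Fin n)} {s : ℕ} (hρ : IsRotation ρ s)
    (h : ∀ b, fiberCard Q (ρ b) = fiberCard P b) (x : Fin n) : Q (ρ x) = (P x).map ρ := by
  have h1 : (fun k => (Q (ρ k)).map (ρ⁻¹ : Perm (Fin n))) = P := by
    have h2 : ∀ k b, (Q (ρ k)).map (ρ⁻¹ : Perm (Fin n)) = some b ↔ Q (ρ k) = some (ρ b) := by
      intro k b
      cases Q (ρ k) with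
      | none => simp
      | some c => rw [Option.map_some, Option.some_inj, Option.some_inj, Perm.inv_eq_iff_eq]
    refine IsParkMap.ext ?_ hP (funext fun b => ?_)
    · intro b k hk j hj
      rw [h2] at hk
      obtain ⟨b', h3, h4⟩ := hQ _ _ hk (ρ j) (hρ.inArc.2 hj)
      refine ⟨ρ⁻¹ b', ?_, ?_⟩
      · dsimp only
        rw [h3, Option.map_some]
      · rw [← hρ.inArc, apply_inv_apply]
        exact h4
    · rw [← h b, fiberCard_eq_natCard, fiberCard_eq_natCard]
      exact Nat.card_congr (Equiv.subtypeEquiv ρ fun k => h2 k b)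
  rw [← congrFun h1 x]
  cases Q (ρ x) with
  | none => rfl
  | some c => rw [Option.map_some, Option.map_some, apply_inv_apply]

theorem isRotation_cox_pow {k : ℕ} (hk : k < n) : IsRotation (cox n ^ k) k := by
  intro x
  rw [cox_pow_apply]
  have := rot_val x hk
  omega

/-- For `c^l = c^k` take the rotation by `gcd(k, n)`, which generates the same cyclic group. The gcd
is a proper divisor of `n`, hence at most `n / 2`. -/
theorem exists_rotation (hn : 1 ≤ n) {l : ℤ} (hl : cox n ^ l ≠ 1) :
    ∃ (ρ : Perm (Fin n)) (s a b : ℕ), IsRotation ρ s ∧ 1 ≤ s ∧ s + s ≤ n ∧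
      cox n ^ l = ρ ^ a ∧ ρ = (cox n ^ l) ^ b := by
  obtain ⟨k, hk⟩ := cox_zpow_exists_pow (n := n) l
  rw [hk] at hl ⊢
  have hnk : ¬ n ∣ k := fun h => hl ((cox_pow_eq_one_iff hn).2 h)
  have h1 : k.gcd n ∣ n := Nat.gcd_dvd_right k n
  have h2 : k.gcd n ≠ n := fun h => hnk (h ▸ Nat.gcd_dvd_left k n)
  have h3 : k.gcd n + k.gcd n ≤ n := by
    obtain ⟨q, hq⟩ := h1
    have hq2 : 2 ≤ q := by
      rcases q with _ | _ | q
      · omega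
      · exact absurd (by rw [Nat.zero_add, Nat.mul_one] at hq; exact hq.symm) h2
      · omega
    calc k.gcd n + k.gcd n = k.gcd n * 2 := by ring
      _ ≤ k.gcd n * q := Nat.mul_le_mul_left _ hq2
      _ = n := hq.symm
  have h4 : 1 ≤ k.gcd n := Nat.gcd_pos_of_pos_right _ hn
  obtain ⟨b, hb⟩ : ∃ b : ℕ, (cox n ^ k) ^ b = cox n ^ k.gcd n := by
    refine (isOfFinOrder_of_finite (cox n ^ k)).mem_powers_iff_mem_zpowers.2
      ⟨k.gcdA n, ?_⟩
    have h5 := Nat.gcd_eq_gcd_ab k n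
    have h6 : cox n ^ (n : ℤ) = 1 := (cox_zpow_eq_one_iff hn).2 dvd_rfl
    change (cox n ^ k) ^ k.gcdA n = _
    rw [← zpow_natCast, ← zpow_natCast, h5, zpow_add, zpow_mul, zpow_mul _ (n : ℤ), h6, one_zpow,
      mul_one]
  refine ⟨cox n ^ k.gcd n, k.gcd n, k / k.gcd n, b, isRotation_cox_pow (by omega), h4, h3, ?_,
    hb.symm⟩
  rw [← pow_mul, Nat.mul_div_cancel' (Nat.gcd_dvd_left k n)]

theorem ncard_fixedParkNC_of_ne_one (hn : 1 ≤ n) (u : Perm (Fin n)) {l : ℤ} (hl : cox n ^ l ≠ 1) :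
    (fixedParkNC u l).ncard = (equivariantFunctions u l).ncard := by
  obtain ⟨ρ, s, a, b, hρ, hs0, hs, ha, hb⟩ := exists_rotation hn hl
  have hr : ∀ X : NCFlat n, X.rotate (coxPow n l) = X →
      ∀ i j, flatRel X.1 (ρ i) (ρ j) ↔ flatRel X.1 i j := by
    intro X hX i j
    rw [hb]
    exact rel_pow_iff (rotate_eq_self_iff.1 hX) b i j
  rw [ncard_fixedParkNC u l (Option.map (cox n ^ l)) (fun X => startMap (flatRel X.1) ρ),
    ← Nat.card_coe_set_eq]
  · refine Nat.card_congr (Equiv.subtypeEquivRight fun f => ⟨fun h => h.1, fun hf => ⟨hf, ?_⟩⟩)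
    change ∀ j, f (u j) = (f j).map (cox n ^ l) at hf
    have hsum : ∑ b, fiberCard f b ≤ n := by
      have := card_none_add_sum_fiberCard f
      omega
    have hP := isParkMap_parkMap (fiberCard f)
    have hfib := fiberCard_parkMap (fiberCard f) hsum
    generalize parkMap (fiberCard f) = P at hP hfib
    -- Equivariance makes `u` a bijection between the fibers. Thus the multiplicities are
    -- rotation-invariant, and so is the parking map built from them, whose blocks provide the flat.
    have hg : ∀ b, fiberCard f ((cox n ^ l) b) = fiberCard f b := by
      intro b
      rw [fiberCard_eq_natCard, fiberCard_eq_natCard]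
      refine (Nat.card_congr (Equiv.subtypeEquiv u fun k => ?_)).symm
      rw [hf]
      cases f k with
      | none => simp
      | some c => rw [Option.map_some, Option.some_inj, Option.some_inj,
          (cox n ^ l).injective.eq_iff]
    have hgρ : ∀ b, fiberCard P (ρ b) = fiberCard P b := by
      intro c
      rw [hfib, hb]
      clear hsum hb
      induction b with
      | zero => rfl
      | succ b ih => rw [pow_succ', Perm.mul_apply, hg, ih]
    have hPρ := hP.map_rotation hP hρ hgρ
    have hPg : ∀ x, P ((cox n ^ l) x) = (P x).map (cox n ^ l) := by
      rw [ha]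
      exact map_pow_of_map hPρ a
    obtain ⟨X, hX⟩ := hP.isNoncrossing.exists_flat hn
    have hXP : flatRel X.1 = Setoid.ker P := Setoid.ext hX
    refine ⟨X, ?_, ?_⟩
    · rw [rotate_eq_self_iff, hXP]
      intro i j
      change P _ = P _ ↔ P i = P j
      rw [hPg, hPg, (Option.map_injective (cox n ^ l).injective).eq_iff]
    · have h1 : startMap (flatRel X.1) ρ = P := by
        rw [hXP, startMap_ker hP hρ hs hs0 hPρ]
      rintro (_ | y)
      · have h2 := card_none_add_sum_fiberCard f
        have h3 := card_none_add_sum_fiberCard P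
        rw [hfib] at h3
        rw [h1]
        omega
      · rw [h1, ← fiberCard_eq_natCard, ← fiberCard_eq_natCard, hfib]
  · exact fun X hX i j => startMap_eq_iff hρ hs hs0 (hr X hX) (NCFlat.isNoncrossing X)
  · intro X hX i
    rw [ha]
    exact map_pow_of_map (startMap_rotation hρ (hr X hX)) a i
  · intro X X' hX hX' h
    refine (isParkMap_startMap hρ hs hs0 (hr X hX) (NCFlat.isNoncrossing X)).ext
      (isParkMap_startMap hρ hs hs0 (hr X' hX') (NCFlat.isNoncrossing X')) (funext fun b => ?_)
    rw [fiberCard_eq_natCard, fiberCard_eq_natCard, h]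

end NontrivialRotation

/-! ### Fixed points with trivial rotation: Pollak's circle argument. -/

section TrivialRotation

open TypeAParking
open Equiv (Perm)

variable {n : ℕ}

/-- The first point of the class of `i`. -/
theorem exists_min_rel (r : Setoid (Fin n)) (i : Fin n) :
    ∃ b, r i b ∧ ∀ j, r i j → b ≤ j := by
  classical
  obtain ⟨b, hb, hmin⟩ := (Finset.univ.filter fun b => r i b).exists_min_image id ⟨i, by simp⟩
  exact ⟨b, (Finset.mem_filter.1 hb).2, fun j hj => hmin j (by simp [hj])⟩

/-- Labels each point by the first point of its class. -/
noncomputable def minMap (r : Setoid (Fin n)) (i : Fin n) : Fin n := (exists_min_rel r i).choose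

theorem rel_minMap (r : Setoid (Fin n)) (i : Fin n) : r i (minMap r i) :=
  (exists_min_rel r i).choose_spec.1

theorem minMap_le {r : Setoid (Fin n)} {i j : Fin n} (h : r i j) : minMap r i ≤ j :=
  (exists_min_rel r i).choose_spec.2 j h

theorem minMap_eq_iff {r : Setoid (Fin n)} {i j : Fin n} : minMap r i = minMap r j ↔ r i j := by
  constructor
  · intro h
    exact r.trans (rel_minMap r i) (h ▸ r.symm (rel_minMap r j))
  · intro h
    exact le_antisymm (minMap_le (r.trans h (rel_minMap r j)))
      (minMap_le (r.trans (r.symm h) (rel_minMap r i)))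

/-- Extends a map by an empty spot at the end. -/
def withLast (p : Fin n → Fin (n + 1)) : Fin (n + 1) → Option (Fin (n + 1)) :=
  Fin.snoc (α := fun _ => Option (Fin (n + 1))) (fun i => some (p i)) none

theorem withLast_castSucc (p : Fin n → Fin (n + 1)) (i : Fin n) :
    withLast p i.castSucc = some (p i) := by simp [withLast]

theorem withLast_last (p : Fin n → Fin (n + 1)) : withLast p (Fin.last n) = none := by
  simp [withLast]

theorem withLast_injective : Function.Injective (withLast (n := n)) := by
  intro p q h
  funext i
  have := congrFun h i.castSucc
  rw [withLast_castSucc, withLast_castSucc] at this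
  exact Option.some_injective _ this

theorem fiberCard_withLast (p : Fin n → Fin (n + 1)) (y : Fin (n + 1)) :
    fiberCard (withLast p) y = Nat.card {i // p i = y} := by
  rw [fiberCard_eq_natCard]
  refine (Nat.card_congr (Equiv.ofBijective
    (fun i : {i // p i = y} => (⟨i.1.castSucc, by rw [withLast_castSucc, i.2]⟩ :
      {k // withLast p k = some y})) ⟨?_, ?_⟩)).symm
  · intro i j h
    exact Subtype.ext (Fin.castSucc_injective n (congrArg Subtype.val h))
  · rintro ⟨k, hk⟩
    induction k using Fin.lastCases with
    | last => exact absurd hk (by simp [withLast_last])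
    | cast i =>
      rw [withLast_castSucc] at hk
      exact ⟨⟨i, Option.some_injective _ hk⟩, rfl⟩

/-- A point `y` between the minimum of the block of `x` and `x` has a block that starts no earlier,
for otherwise the two blocks would cross. The empty last spot is never reached, because arcs from a
minimum do not wrap around. -/
theorem isParkMap_minMap {r : Setoid (Fin n)} (hr : IsNoncrossing r) :
    IsParkMap (withLast fun i => (minMap r i).castSucc) := by
  intro b k hk j hj
  induction k using Fin.lastCases with
  | last => exact absurd hk (by simp [withLast_last])
  | cast x =>
    rw [withLast_castSucc] at hk
    obtain rfl := Option.some_injective _ hk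
    have h1 := minMap_le (r.refl x)
    induction j using Fin.lastCases with
    | last =>
      exfalso
      have := x.isLt
      unfold InArc at hj
      simp only [Fin.le_def, Fin.lt_def, Fin.val_castSucc, Fin.val_last] at *
      omega
    | cast y =>
      refine ⟨_, withLast_castSucc _ y, ?_⟩
      have h2 := minMap_le (r.refl y)
      have h3 : minMap r x ≤ minMap r y := by
        by_contra hlt
        have hxy : ¬ r x y := fun h => hlt (minMap_eq_iff.2 h).le
        have e1 : minMap r x ≠ y := fun h => hxy (h ▸ rel_minMap r x)
        have e2 : x ≠ y := fun h => hxy (h ▸ r.refl x)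
        refine hxy (r.symm (r.trans (rel_minMap r y) (r.trans (hr (minMap r y) (minMap r x) y x
          (r.symm (rel_minMap r y)) (r.symm (rel_minMap r x)) ?_ ?_)
          (r.symm (rel_minMap r x))))) <;>
        · unfold InArc at hj
          unfold Between
          simp only [Fin.le_def, Fin.lt_def, Fin.val_castSucc] at *
          omega
      unfold InArc at *
      simp only [Fin.le_def, Fin.lt_def, Fin.val_castSucc] at *
      omega

/-- Number of preferences. -/
noncomputable def prefCard (f : Fin n → Fin (n + 1)) (y : Fin (n + 1)) : ℕ :=
  Nat.card {i // f i = y}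

theorem sum_prefCard (f : Fin n → Fin (n + 1)) : ∑ y, prefCard f y = n := by
  have h := card_none_add_sum_fiberCard (withLast f)
  have h1 : Nat.card {i // withLast f i = none} = 1 := by
    rw [Nat.card_eq_one_iff_unique]
    refine ⟨⟨?_⟩, ⟨⟨_, withLast_last f⟩⟩⟩
    have key : ∀ a : {i // withLast f i = none}, a.1 = Fin.last n := by
      rintro ⟨a, ha⟩
      induction a using Fin.lastCases with
      | last => rfl
      | cast i => rw [withLast_castSucc] at ha; exact absurd ha (by simp)
    exact fun a b => Subtype.ext ((key a).trans (key b).symm)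
  simp only [fiberCard_withLast] at h
  change ∑ y, Nat.card {i // f i = y} = n
  omega

theorem fiberCard_parkMap_prefCard (f : Fin n → Fin (n + 1)) :
    fiberCard (parkMap (prefCard f)) = prefCard f :=
  fiberCard_parkMap _ (by rw [sum_prefCard]; omega)

/-- Exactly one of the `n + 1` cyclically arranged spots stays empty. -/
theorem existsUnique_empty (f : Fin n → Fin (n + 1)) :
    ∃! x, parkMap (prefCard f) x = none := by
  have h := card_none_add_sum_fiberCard (parkMap (prefCard f))
  rw [fiberCard_parkMap_prefCard, sum_prefCard] at h
  have h1 : Nat.card {x // parkMap (prefCard f) x = none} = 1 := by omega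
  obtain ⟨h2, ⟨x, hx⟩⟩ := Nat.card_eq_one_iff_unique.1 h1
  exact ⟨x, hx, fun y hy => congrArg Subtype.val (h2.elim ⟨y, hy⟩ ⟨x, hx⟩)⟩

theorem exists_flat_iff (hn : 1 ≤ n) (f : Fin n → Fin (n + 1)) :
    (∃ X : NCFlat n, ∀ y, Nat.card {i // (minMap (flatRel X.1) i).castSucc = y} =
        Nat.card {i // f i = y}) ↔ parkMap (prefCard f) (Fin.last n) = none := by
  have hpark := isParkMap_parkMap (prefCard f)
  constructor
  · rintro ⟨X, hX⟩
    have h1 := (isParkMap_minMap (NCFlat.isNoncrossing X)).ext hpark (by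
      rw [fiberCard_parkMap_prefCard]
      funext y
      rw [fiberCard_withLast, hX]
      rfl)
    rw [← h1, withLast_last]
  · intro hlast
    have hsome : ∀ i : Fin n, ∃ b, parkMap (prefCard f) i.castSucc = some b := by
      intro i
      rw [← Option.ne_none_iff_exists']
      intro h
      exact (Fin.castSucc_lt_last i).ne ((existsUnique_empty f).unique h hlast)
    choose p hp using hsome
    have hpe : withLast p = parkMap (prefCard f) := by
      funext k
      induction k using Fin.lastCases with
      | last => rw [withLast_last, hlast]
      | cast i => rw [withLast_castSucc, hp]
    have hnc : IsNoncrossing (Setoid.ker p) := by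
      intro a b c d hac hbd h1 h2
      have h3 := hpark.isNoncrossing a.castSucc b.castSucc c.castSucc d.castSucc
      change parkMap _ _ = parkMap _ _ → parkMap _ _ = parkMap _ _ → _ → _ →
        parkMap _ _ = parkMap _ _ at h3
      rw [hp, hp, hp, hp] at h3
      exact Option.some_injective _ (h3 (congrArg some hac) (congrArg some hbd) h1 h2)
    obtain ⟨X, hX⟩ := hnc.exists_flat hn
    refine ⟨X, fun y => ?_⟩
    -- No car passes the empty last spot, so every car parks at or after its preference in linear
    -- order. A preference is also a point of its own block, hence its minimum.
    have hmin : ∀ i, (minMap (flatRel X.1) i).castSucc = p i := by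
      intro i
      have h1 := hp i
      have h2 := hpark.not_inArc h1 hlast
      have h3 := hpark.self h1
      have h4 : p i ≠ Fin.last n := fun h => by
        rw [h, hlast] at h3
        exact absurd h3 (by simp)
      obtain ⟨b, hb⟩ : ∃ b : Fin n, b.castSucc = p i := Fin.exists_castSucc_eq.2 h4
      rw [← hb]
      congr 1
      have hib : flatRel X.1 i b := by
        rw [hX]
        change p i = p b
        have h5 := hp b
        rw [hb, h3] at h5
        exact Option.some_injective _ h5
      refine le_antisymm (minMap_le hib) ?_
      have h6 := (hX _ _).1 (rel_minMap (flatRel X.1) i)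
      change p i = p _ at h6
      have h7 := hp (minMap (flatRel X.1) i)
      rw [← h6, ← hb] at h7
      have h8 := hpark.not_inArc h7 hlast
      have := (minMap (flatRel X.1) i).isLt
      unfold InArc at h8
      simp only [Fin.le_def, Fin.lt_def, Fin.val_castSucc, Fin.val_last] at *
      omega
    have h1 := fiberCard_withLast p y
    rw [hpe, fiberCard_parkMap_prefCard] at h1
    simp only [hmin]
    exact h1.symm

theorem parkMap_prefCard_rotate (f : Fin n → Fin (n + 1)) {k : ℕ} (hk : k < n + 1)
    (x : Fin (n + 1)) :
    parkMap (prefCard fun i => (cox (n + 1) ^ k) (f i)) ((cox (n + 1) ^ k) x) =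
      (parkMap (prefCard f) x).map (cox (n + 1) ^ k : Perm (Fin (n + 1))) := by
  refine (isParkMap_parkMap _).map_rotation (isParkMap_parkMap _) (isRotation_cox_pow hk)
    (fun b => ?_) x
  rw [fiberCard_parkMap_prefCard, fiberCard_parkMap_prefCard]
  refine Nat.card_congr (Equiv.subtypeEquivRight fun i => ?_)
  exact (cox (n + 1) ^ k).injective.eq_iff

/-- Rotating all preferences rotates the unique empty spot, so each invariant function has exactly
one rotation that leaves the last spot empty. -/
theorem card_parking_mul (u : Perm (Fin n)) :
    (n + 1) * Nat.card {f : Fin n → Fin (n + 1) // (∀ j, f (u j) = f j) ∧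
        parkMap (prefCard f) (Fin.last n) = none} =
      Nat.card {f : Fin n → Fin (n + 1) // ∀ j, f (u j) = f j} := by
  let Φ : Fin (n + 1) × {f : Fin n → Fin (n + 1) // (∀ j, f (u j) = f j) ∧
        parkMap (prefCard f) (Fin.last n) = none} →
      {f : Fin n → Fin (n + 1) // ∀ j, f (u j) = f j} := fun q =>
    ⟨fun i => (cox (n + 1) ^ (q.1 : ℕ)) (q.2.1 i), fun j =>
      congrArg (cox (n + 1) ^ (q.1 : ℕ)) (q.2.2.1 j)⟩
  have hΦ : Function.Bijective Φ := by
    constructor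
    · rintro ⟨k, f, hf, hf'⟩ ⟨k', f', hg, hg'⟩ h
      replace h : (fun i => (cox (n + 1) ^ (k : ℕ)) (f i)) =
          fun i => (cox (n + 1) ^ (k' : ℕ)) (f' i) := congrArg Subtype.val h
      have h1 := parkMap_prefCard_rotate f k.isLt (Fin.last n)
      have h2 := parkMap_prefCard_rotate f' k'.isLt (Fin.last n)
      rw [hf', Option.map_none, h] at h1
      rw [hg', Option.map_none] at h2
      have h3 := (existsUnique_empty _).unique h1 h2
      rw [cox_pow_apply, cox_pow_apply] at h3
      obtain rfl := Fin.ext (rot_injOn _ k.isLt k'.isLt h3)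
      have h4 : f = f' := funext fun i => (cox (n + 1) ^ (k : ℕ)).injective (congrFun h i)
      subst h4
      rfl
    · rintro ⟨f, hf⟩
      obtain ⟨z, hz, -⟩ := existsUnique_empty f
      obtain ⟨k, hk, rfl⟩ := exists_rot (Fin.last n) z
      have h1 := parkMap_prefCard_rotate (fun i => (cox (n + 1) ^ k)⁻¹ (f i)) hk (Fin.last n)
      simp only [apply_inv_apply] at h1
      rw [cox_pow_apply, hz, eq_comm, Option.map_eq_none_iff] at h1
      refine ⟨(⟨k, hk⟩, ⟨fun i => (cox (n + 1) ^ k)⁻¹ (f i), fun j =>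
        congrArg _ (hf j), h1⟩),
        Subtype.ext (funext fun i => ?_)⟩
      exact apply_inv_apply _ _
  rw [← Nat.card_congr (Equiv.ofBijective Φ hΦ), Nat.card_prod, Nat.card_fin]

theorem ncard_fixedParkNC_of_eq_one (hn : 1 ≤ n) (u : Perm (Fin n)) {l : ℤ} (hl : cox n ^ l = 1) :
    (n + 1) * (fixedParkNC u l).ncard = (n + 1) ^ cyclesDvd 1 u := by
  have hrot : ∀ X : NCFlat n, X.rotate (coxPow n l) = X := by
    intro X
    rw [rotate_eq_self_iff, hl]
    exact fun _ _ => Iff.rfl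
  rw [ncard_fixedParkNC u l id (fun X i => (minMap (flatRel X.1) i).castSucc)]
  · have h1 := card_equivariant u (1 : Perm (Fin (n + 1))) 1 (fun k _ => one_pow k)
      fun k hk => absurd (one_dvd k) hk
    rw [Nat.card_fin] at h1
    simp only [Perm.one_apply] at h1
    rw [← h1, ← card_parking_mul u]
    congr 1
    refine Nat.card_congr (Equiv.subtypeEquivRight fun f => and_congr_right fun _ => ?_)
    rw [← exists_flat_iff hn f]
    exact exists_congr fun X => and_iff_right (hrot X)
  · intro X _ i j
    rw [(Fin.castSucc_injective n).eq_iff, minMap_eq_iff]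
  · intro X _ i
    rw [hl]
    rfl
  · intro X X' _ _ h
    refine withLast_injective ((isParkMap_minMap (NCFlat.isNoncrossing X)).ext
      (isParkMap_minMap (NCFlat.isNoncrossing X')) (funext fun y => ?_))
    rw [fiberCard_withLast, fiberCard_withLast, h]

theorem ncard_fixedParkNC_eq (hn : 1 ≤ n) (u : Perm (Fin n)) (l : ℤ) :
    (fixedParkNC u l).ncard = (n + 1) ^ eigMult u (omega n ^ l) := by
  have h := eigMult_omega hn u l
  by_cases hl : cox n ^ l = 1
  · have h1 := ncard_fixedParkNC_of_eq_one hn u hl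
    rw [hl, if_pos rfl, orderOf_one] at h
    rw [← h, pow_succ, Nat.mul_comm] at h1
    exact Nat.eq_of_mul_eq_mul_right (Nat.succ_pos n) h1
  · rw [if_neg hl, add_zero] at h
    rw [ncard_fixedParkNC_of_ne_one hn u hl, ncard_equivariantFunctions, h]

end TrivialRotation

/-! ### Comparison of characters. -/

section PermutationCharacter

open TypeAParking
open Equiv (Perm)

variable {n : ℕ}

theorem character_ofMulAction {k G H : Type*} [Field k] [Group G] [MulAction G H] [Finite H]
    (g : G) : (Representation.ofMulAction k G H).character g =
      ((MulAction.fixedBy H g).ncard : k) := by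
  classical
  have := Fintype.ofFinite H
  let b : Module.Basis H k (MonoidAlgebra k H) := ⟨MonoidAlgebra.coeffLinearEquiv k⟩
  have hb : ∀ x, b x = MonoidAlgebra.single x 1 := fun x => rfl
  have hrepr : ∀ x y, b.repr (MonoidAlgebra.single x 1) y = if x = y then 1 else 0 := by
    intro x y
    rw [← hb, b.repr_self, Finsupp.single_apply]
  rw [Representation.character, LinearMap.trace_eq_matrix_trace k b, Matrix.trace]
  simp only [Matrix.diag_apply, LinearMap.toMatrix_apply, hb, Representation.ofMulAction_single,
    hrepr]
  rw [Finset.sum_boole, ← Nat.card_coe_set_eq, Nat.card_eq_fintype_card, Fintype.card_subtype]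
  rfl

instance : Finite (NCFlat n) :=
  Finite.of_surjective (fun w : {w : Perm (Fin n) // AbsLE 1 w ∧ AbsLE w (cox n)} =>
    (⟨fixedSpace w.1, w.1, w.2.1, w.2.2, rfl⟩ : NCFlat n)) (by
      rintro ⟨_, w, h1, h2, rfl⟩
      exact ⟨⟨w, h1, h2⟩, rfl⟩)

instance : Finite (ParkNC n) := Quotient.finite _

instance : Module.Finite ℂ (MonoidAlgebra ℂ (ParkNC n)) :=
  Module.Finite.equiv (MonoidAlgebra.coeffLinearEquiv ℂ).symm

theorem nonempty_parkAlgRep_equiv (hn : 1 ≤ n) (P : ParkingHsop n) :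
    Nonempty ((parkAlgRep P).Equiv (parkNCRep n)) := by
  have := (parkAlgRep_character P hn 1 0).1
  refine Representation.nonempty_equiv_of_character_eq _ _ (funext ?_)
  rintro ⟨w, g, l, rfl⟩
  have h1 := (parkAlgRep_character P hn w l).2
  have h2 := ncard_fixedParkNC_eq hn w l
  -- The multiplicity depends on `w` only through its cycle type, which `w⁻¹` shares.
  have h3 : eigMult w⁻¹ (omega n ^ l) = eigMult w (omega n ^ l) := by
    have e1 := eigMult_omega hn w l
    have e2 := eigMult_omega hn w⁻¹ l
    rw [cyclesDvd_inv, ← e1] at e2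
    exact Nat.add_right_cancel e2
  refine h1.trans ?_
  rw [h3, ← Nat.cast_pow, ← h2]
  exact (character_ofMulAction (w, coxPow n l)).symm

end PermutationCharacter

theorem mainTheorem5 (n : ℕ) (hn : 1 ≤ n) :
    (∀ P : ParkingHsop n, Nonempty ((parkAlgRep P).Equiv (parkNCRep n))) ∧
    (∀ (u : Equiv.Perm (Fin n)) (l : ℤ),
      (fixedParkNC u l).ncard = (n + 1) ^ eigMult u (omega n ^ l)) ∧
    (∀ (u : Equiv.Perm (Fin n)) (l : ℤ), cox n ^ l ≠ 1 →
      (fixedParkNC u l).ncard = (n + 1) ^ cyclesDvd (orderOf (cox n ^ l)) u ∧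
      (equivariantFunctions u l).ncard = (n + 1) ^ cyclesDvd (orderOf (cox n ^ l)) u) :=
  ⟨nonempty_parkAlgRep_equiv hn, ncard_fixedParkNC_eq hn, fun u l hl =>
    ⟨(ncard_fixedParkNC_of_ne_one hn u hl).trans (ncard_equivariantFunctions u l),
      ncard_equivariantFunctions u l⟩⟩
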